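/- Let $T>0$, $H\in(0,1)$, and let $\alpha\in\mathbb{C}$ with $\lambda=\operatorname{Re}(\alpha)\in(0,H)$. Let $B^1,B^2$ be independent fractional Brownian motions on $[0,T]$ with Hurst parameter $H$ (continuous centered Gaussian processes with covariance $\tfrac12(s^{2H}+t^{2H}-|t-s|^{2H})$), and let $\zeta_t=\frac1{\sqrt2}(B^1_t+\mathrm{i}B^2_t)$. For $0\le t<T$ let $$\omega_t=\int_0^t (T-u)^{-\alpha}\,\mathrm{d}\zeta_u$$ be the complex Wiener integral, i.e. the $L^2$-limit of the integrals $\sum_k c_k\zeta_{s_k}$ of complex step functions $\sum_k c_k\mathbf 1_{[0,s_k]}$, $s_k\in[0,T]$, that converge uniformly on $[0,T]$ to $u\mapsto (T-u)^{-\alpha}\mathbf 1_{[0,t]}(u)$. Then the following hold. 1. The process $(\omega_t)_{0\le t<T}$ exists, and there is a square integrable random variable $\omega_T$ such that $\omega_t\to\omega_T$ in $L^2$ as $t\uparrow T$, and such that $\omega_t\to\omega_T$ almost surely as $t\uparrow T$ for every version of $(\omega_t)_{0\le t<T}$ with almost surely continuous paths. 2. $$\mathbb{E}\big[|\omega_T|^2\big]=\frac{\Gamma(1+2H)}{2(H-\lambda)}\operatorname{Re}\Big[\frac{\Gamma(1-\alpha)}{\Gamma(2H-\alpha)}\Big]T^{2(H-\lambda)}.$$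 3. The process $(\omega_t)_{t\in[0,T]}$ is Gaussian and has a modification on $[0,T]$ whose paths are $(H-\lambda-\epsilon)$-Hölder continuous on $[0,T]$ for all $\epsilon\in(0,H-\lambda)$. (In particular versions with continuous paths, as in 1 and 4, exist.) 4. For every version of $(\omega_t)_{0\le t<T}$ with almost surely continuous paths, the process $Z_t=(T-t)^{\alpha}\omega_t$ $(0\le t<T)$, $Z_T=0$, is a complex $\alpha$-fractional Brownian bridge on $[0,T]$: almost surely its paths are continuous on the closed interval $[0,T]$, $Z_0=0$, and $$Z_t=-\alpha\int_0^t\frac{Z_u}{T-u}\,\mathrm{d}u+\zeta_t\qquad\text{for all }t\in[0,T).$$ Moreover, every process with almost surely continuous paths on $[0,T)$ that starts at $0$ and solves this equation almost surely for all $t\in[0,T)$ coincides almost surely with $Z$ on all of $[0,T)$, and hence tends to $0$ as $t\uparrow T$. -/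

import Mathlib

open MeasureTheory ProbabilityTheory Set Filter Topology

noncomputable section

/-- `B` is, on the time interval `[0, T]`, a fractional Brownian motion with Hurst parameter `H`
under `P`: a centered Gaussian process with a.s. continuous paths and covariance
`(s^{2H} + t^{2H} - |t - s|^{2H}) / 2`. -/
structure IsFractionalBrownianMotion {Ω : Type*} [MeasurableSpace Ω] (P : Measure Ω) (H T : ℝ)
    (B : ℝ → Ω → ℝ) : Prop where
  gaussian : IsGaussianProcess (fun t : Icc (0 : ℝ) T => B t) P
  centered : ∀ t ∈ Icc (0 : ℝ) T, ∫ w, B t w ∂P = 0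
  covariance : ∀ s ∈ Icc (0 : ℝ) T, ∀ t ∈ Icc (0 : ℝ) T,
    ∫ w, B s w * B t w ∂P = (|s| ^ (2 * H) + |t| ^ (2 * H) - |t - s| ^ (2 * H)) / 2
  continuous_paths : ∀ᵐ w ∂P, ContinuousOn (fun t => B t w) (Icc (0 : ℝ) T)

/-- `(B₁, B₂)` is a two-dimensional fractional Brownian motion on `[0, T]`: two independent
fractional Brownian motions with the same Hurst parameter `H`. -/
structure IsPlanarFractionalBrownianMotion {Ω : Type*} [MeasurableSpace Ω] (P : Measure Ω)
    (H T : ℝ) (B₁ B₂ : ℝ → Ω → ℝ) : Prop where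
  fst : IsFractionalBrownianMotion P H T B₁
  snd : IsFractionalBrownianMotion P H T B₂
  indep : IndepFun (fun w (t : Icc (0 : ℝ) T) => B₁ t w) (fun w (t : Icc (0 : ℝ) T) => B₂ t w) P

/-- The complex process `ζ_t = (B₁(t) + i B₂(t)) / √2`. -/
def complexFBM {Ω : Type*} (B₁ B₂ : ℝ → Ω → ℝ) (t : ℝ) (w : Ω) : ℂ :=
  ((Real.sqrt 2)⁻¹ : ℝ) * ((B₁ t w : ℂ) + Complex.I * (B₂ t w : ℂ))

/-- The complex step function `∑ₛ c(s) 𝟏_{[0,s]}`, for finitely supported coefficients `c`. -/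
def stepFunction (c : ℝ →₀ ℂ) (u : ℝ) : ℂ :=
  c.sum fun s a => a * (Icc (0 : ℝ) s).indicator (fun _ => (1 : ℂ)) u

/-- The integral `∑ₛ c(s) ζ_s` of the step function `∑ₛ c(s) 𝟏_{[0,s]}` against `ζ`. -/
def stepIntegral {Ω : Type*} (ζ : ℝ → Ω → ℂ) (c : ℝ →₀ ℂ) (w : Ω) : ℂ :=
  c.sum fun s a => a * ζ s w

/-- `X` is (a version of) the Wiener integral `∫_{[0,T]} f dζ`: the square integrable random
variable `X` is the `L²(P)`-limit of the integrals of complex step functions on `[0, T]` that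
converge to `f` uniformly on `[0, T]`. The map from step functions to their integrals is an isometry
for the inner product with `⟨𝟏_{[0,s]}, 𝟏_{[0,t]}⟩ = E[ζ_s conj ζ_t]`, so the `L²(P)`-convergence
is the convergence of the step functions in the Hilbert space of the fractional Brownian motion;
uniform convergence identifies the limit in that space with the bounded function `f`. -/
def IsWienerIntegral {Ω : Type*} [MeasurableSpace Ω] (P : Measure Ω) (T : ℝ) (ζ : ℝ → Ω → ℂ)
    (f : ℝ → ℂ) (X : Ω → ℂ) : Prop :=
  MemLp X 2 P ∧
    ∃ c : ℕ → ℝ →₀ ℂ,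
      (∀ n, ∀ s ∈ (c n).support, s ∈ Icc (0 : ℝ) T) ∧
      TendstoUniformlyOn (fun n => stepFunction (c n)) f atTop (Icc (0 : ℝ) T) ∧
      Tendsto (fun n => eLpNorm (fun w => stepIntegral ζ (c n) w - X w) 2 P) atTop (𝓝 0)

/-- The integrand `u ↦ (T - u)^{-α} 𝟏_{[0,t]}(u)`, with the principal power. -/
def bridgeIntegrand (T : ℝ) (α : ℂ) (t : ℝ) : ℝ → ℂ :=
  (Icc (0 : ℝ) t).indicator fun u => ((T - u : ℝ) : ℂ) ^ (-α)

/-- `ω = (ω_t)_{0 ≤ t < T}` is (a version of) the process of complex Wiener integrals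
`ω_t = ∫_0^t (T - u)^{-α} dζ_u`. -/
def IsOmegaProcess {Ω : Type*} [MeasurableSpace Ω] (P : Measure Ω) (T : ℝ) (α : ℂ)
    (ζ : ℝ → Ω → ℂ) (ω : ℝ → Ω → ℂ) : Prop :=
  ∀ t ∈ Ico (0 : ℝ) T, IsWienerIntegral P T ζ (bridgeIntegrand T α t) (ω t)

/-- `Z_t = (T - t)^α ω_t` for `t < T`, with the terminal value `0`. -/
def bridgeProcess {Ω : Type*} (T : ℝ) (α : ℂ) (ω : ℝ → Ω → ℂ) (t : ℝ) (w : Ω) : ℂ :=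
  if t < T then ((T - t : ℝ) : ℂ) ^ α * ω t w else 0

/-- `Z` is a pathwise solution on `[0, T)` of `dZ_t = -α Z_t / (T - t) dt + dζ_t`, `Z_0 = 0`. -/
structure IsBridgeSolution {Ω : Type*} [MeasurableSpace Ω] (P : Measure Ω) (T : ℝ) (α : ℂ)
    (ζ : ℝ → Ω → ℂ) (Z : ℝ → Ω → ℂ) : Prop where
  aemeasurable : ∀ t ∈ Ico (0 : ℝ) T, AEMeasurable (Z t) P
  continuous_paths : ∀ᵐ w ∂P, ContinuousOn (fun t => Z t w) (Ico (0 : ℝ) T)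
  initial : ∀ᵐ w ∂P, Z 0 w = 0
  equation : ∀ᵐ w ∂P, ∀ t ∈ Ico (0 : ℝ) T,
    Z t w = -α * (∫ u in (0 : ℝ)..t, Z u w / ((T - u : ℝ) : ℂ)) + ζ t w

/-- `Z` is a complex `α`-fractional Brownian bridge on the closed interval `[0, T]`: it solves the
bridge equation on `[0, T)`, its paths are continuous up to and including `T`, and `Z_T = 0`. -/
structure IsComplexFractionalBridge {Ω : Type*} [MeasurableSpace Ω] (P : Measure Ω) (T : ℝ)
    (α : ℂ) (ζ : ℝ → Ω → ℂ) (Z : ℝ → Ω → ℂ) : Prop where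
  solution : IsBridgeSolution P T α ζ Z
  continuous_closed : ∀ᵐ w ∂P, ContinuousOn (fun t => Z t w) (Icc (0 : ℝ) T)
  terminal : ∀ᵐ w ∂P, Z T w = 0

end

/-! The paths of fractional Brownian motion are Hölder continuous of every order `γ < H`, with a
Hölder constant that is a square integrable random variable (chaining and Gaussian moments,
`exists_memLp_holder_const`). So `ζ` has a version `z` all of whose paths are Hölder, in the sense
of `IsHolderVersion`. An integration by parts, written in the reversed time `v = T - u`, turns
`∫_0^t (T - u) ^ (-α) dζ_u` into an ordinary integral of `v ^ (-α - 1) * (z (T - v) - z T)`, which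
converges absolutely up to the singular time since `re α < H`. This is `pathIntegral`. It is
Hölder continuous of order `γ - re α` on the closed interval (`norm_pathIntegral_sub_le`), which
gives the Hölder modification, the terminal value and both modes of convergence to it.

The pathwise integral is the `L²`-limit of Riemann–Stieltjes sums over step functions that converge
uniformly to the integrand, so it is a Wiener integral (`IsHolderVersion.isWienerIntegral`). Wiener
integrals are unique because the covariance function has an integrable density in each variable, so
that integration of step functions is closable for uniform convergence
(`ae_eq_zero_of_tendsto_stepIntegral`). Hence every process of Wiener integrals is a version of the
pathwise one. It is Gaussian as a limit in mean square of Gaussian processes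
(`isGaussianProcess_of_tendsto_eLpNorm`).

For the second moment of the terminal value let `A t = ∫_0^t v ^ (-α - 1) * η v dv` with
`η v = z (T - v) - z T`. The fundamental theorem of calculus for `|A|²`, Fubini and the
self-similarity of the covariance reduce `E |A T|²` and `E (A T * conj (η T))` to one integral over
`[0, 1]`, a Beta integral (`integral_cpow_mul_fbmCov_one`).

The bridge equation is the integrated product rule for `(T - t) ^ α` times the pathwise integral
(`cpow_mul_pathIntegral_eq`). The difference of two solutions solves a homogeneous linear equation,
which an integrating factor shows to vanish (`eq_zero_of_bridge_equation`). -/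

/-! ### Chaining and the Kolmogorov continuity estimate -/

/-- The dyadic approximation of level `n` of a continuous function converges to it. -/
lemma tendsto_dyadic_approx {f : ℝ → ℝ} (hf : ContinuousOn f (Icc 0 1)) {t : ℝ}
    (ht : t ∈ Icc (0 : ℝ) 1) :
    Tendsto (fun n : ℕ => f (⌊2 ^ n * t⌋₊ / 2 ^ n)) atTop (𝓝 (f t)) := by
  have h1 : Tendsto (fun n : ℕ => ((⌊2 ^ n * t⌋₊ : ℝ) / 2 ^ n)) atTop (𝓝 t) := by
    have h2 : Tendsto (fun n : ℕ => t - (1 / 2 : ℝ) ^ n) atTop (𝓝 (t - 0)) :=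
      tendsto_const_nhds.sub (tendsto_pow_atTop_nhds_zero_of_lt_one (by norm_num) (by norm_num))
    rw [sub_zero] at h2
    refine tendsto_of_tendsto_of_tendsto_of_le_of_le h2 tendsto_const_nhds (fun n => ?_)
      (fun n => ?_)
    · have h3 := Nat.lt_floor_add_one ((2 : ℝ) ^ n * t)
      have h4 : (0 : ℝ) < 2 ^ n := by positivity
      simp only [one_div, inv_pow]
      rw [sub_le_iff_le_add, ← one_div, ← add_div, le_div_iff₀ h4]
      linarith
    · have h4 : (0 : ℝ) < 2 ^ n := by positivity
      have h3 := Nat.floor_le (a := (2 : ℝ) ^ n * t) (mul_nonneg h4.le ht.1)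
      simp only
      rw [div_le_iff₀ h4]
      linarith
  have h5 : Tendsto (fun n : ℕ => ((⌊2 ^ n * t⌋₊ : ℝ) / 2 ^ n)) atTop (𝓝[Icc 0 1] t) := by
    refine tendsto_nhdsWithin_iff.2 ⟨h1, Eventually.of_forall fun n => ⟨by positivity, ?_⟩⟩
    have h4 : (0 : ℝ) < 2 ^ n := by positivity
    have h3 := Nat.floor_le (a := (2 : ℝ) ^ n * t) (mul_nonneg h4.le ht.1)
    rw [div_le_iff₀ h4]
    nlinarith [ht.2]
  exact (hf t ht).tendsto.comp h5

/-- Chaining: a continuous function on `[0, 1]` whose increments over the dyadic intervals of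
level `n` are at most `A * 2 ^ (-γ n)` is `γ`-Hölder, with a constant proportional to `A`. -/
lemma holder_of_dyadic_increments_unit {γ : ℝ} (hγ : 0 < γ) {f : ℝ → ℝ}
    (hf : ContinuousOn f (Icc 0 1)) {A : ℝ}
    (hA : ∀ n k : ℕ, k < 2 ^ n →
      |f ((k + 1 : ℕ) / 2 ^ n) - f (k / 2 ^ n)| ≤ A * ((1 / 2 : ℝ) ^ γ) ^ n)
    {s t : ℝ} (hs : s ∈ Icc (0 : ℝ) 1) (ht : t ∈ Icc (0 : ℝ) 1) :
    |f t - f s| ≤ 2 / (1 - (1 / 2 : ℝ) ^ γ) * 2 ^ γ * A * |t - s| ^ γ := by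
  set q : ℝ := (1 / 2 : ℝ) ^ γ with hq
  have hq0 : 0 < q := by positivity
  have hq1 : q < 1 := Real.rpow_lt_one (by norm_num) (by norm_num) hγ
  have hA0 : 0 ≤ A := by
    have := (abs_nonneg _).trans (hA 0 0 (by norm_num))
    simpa using this
  have hfl : ∀ n : ℕ, ∀ x ∈ Icc (0 : ℝ) 1, ⌊2 ^ n * x⌋₊ ≤ 2 ^ n := fun n x hx => by
    have : ⌊2 ^ n * x⌋₊ ≤ ⌊((2 ^ n : ℕ) : ℝ)⌋₊ := by
      apply Nat.floor_mono
      push_cast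
      have : (0 : ℝ) < 2 ^ n := by positivity
      nlinarith [hx.2]
    rwa [Nat.floor_natCast] at this
  -- consecutive levels differ by at most one increment of the finer level
  have hstep : ∀ x ∈ Icc (0 : ℝ) 1, ∀ n : ℕ,
      dist (f (⌊2 ^ n * x⌋₊ / 2 ^ n)) (f (⌊2 ^ (n + 1) * x⌋₊ / 2 ^ (n + 1))) ≤ (A * q) * q ^ n := by
    intro x hx n
    set k := ⌊2 ^ n * x⌋₊ with hk
    have hpos : (0 : ℝ) ≤ 2 ^ n * x := mul_nonneg (by positivity) hx.1
    have h1 : 2 * k ≤ ⌊2 ^ (n + 1) * x⌋₊ := by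
      apply Nat.le_floor
      have := Nat.floor_le hpos
      push_cast; rw [pow_succ]; linarith
    have h2 : ⌊2 ^ (n + 1) * x⌋₊ < 2 * k + 2 := by
      apply (Nat.floor_lt (by rw [pow_succ]; linarith)).2
      have := Nat.lt_floor_add_one ((2 : ℝ) ^ n * x)
      push_cast; rw [pow_succ]; linarith
    have h3 : f (k / 2 ^ n) = f ((2 * k : ℕ) / 2 ^ (n + 1)) := by
      congr 1; push_cast; rw [pow_succ]; field_simp
    rw [h3, dist_comm, Real.dist_eq]
    obtain h4 | h4 : ⌊2 ^ (n + 1) * x⌋₊ = 2 * k ∨ ⌊2 ^ (n + 1) * x⌋₊ = 2 * k + 1 := by omega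
    · rw [h4, sub_self, abs_zero]; positivity
    · rw [h4]
      have h5 := hfl (n + 1) x hx
      have := hA (n + 1) (2 * k) (by omega)
      calc _ ≤ _ := this
        _ = _ := by rw [pow_succ]; ring
  have hlim : ∀ x ∈ Icc (0 : ℝ) 1, ∀ n : ℕ,
      dist (f (⌊2 ^ n * x⌋₊ / 2 ^ n)) (f x) ≤ (A * q) * q ^ n / (1 - q) := fun x hx n =>
    dist_le_of_le_geometric_of_tendsto q (A * q) hq1 (hstep x hx) (tendsto_dyadic_approx hf hx) n
  wlog hst : s ≤ t generalizing s t with hw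
  · have := hw ht hs (le_of_not_ge hst)
    rwa [abs_sub_comm, abs_sub_comm s t] at this
  rcases hst.eq_or_lt with rfl | hlt
  · simp only [sub_self, abs_zero]
    rw [Real.zero_rpow hγ.ne', mul_zero]
  have hd0 : 0 < t - s := sub_pos.2 hlt
  obtain ⟨n, hn1, hn2⟩ := exists_nat_pow_near_of_lt_one hd0 (by linarith [hs.1, ht.2])
    (by norm_num : (0 : ℝ) < 1 / 2) (by norm_num)
  have hpn : (0 : ℝ) < 2 ^ n := by positivity
  have hcell : dist (f (⌊2 ^ n * t⌋₊ / 2 ^ n)) (f (⌊2 ^ n * s⌋₊ / 2 ^ n)) ≤ A * q ^ n := by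
    have hn2' : 2 ^ n * (t - s) ≤ 1 := by
      rw [one_div, inv_pow] at hn2
      calc 2 ^ n * (t - s) ≤ 2 ^ n * ((2 : ℝ) ^ n)⁻¹ := by gcongr
        _ = 1 := by field_simp
    set k := ⌊2 ^ n * s⌋₊ with hk
    have h1 : k ≤ ⌊2 ^ n * t⌋₊ := Nat.floor_mono (by gcongr)
    have h2 : ⌊2 ^ n * t⌋₊ < k + 2 := by
      apply (Nat.floor_lt (mul_nonneg hpn.le ht.1)).2
      have := Nat.lt_floor_add_one ((2 : ℝ) ^ n * s)
      push_cast; linarith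
    rw [Real.dist_eq]
    obtain h4 | h4 : ⌊2 ^ n * t⌋₊ = k ∨ ⌊2 ^ n * t⌋₊ = k + 1 := by omega
    · rw [h4, sub_self, abs_zero]; positivity
    · rw [h4]
      have h5 := hfl n t ht
      exact hA n k (by omega)
  have hqn : q ^ n ≤ 2 ^ γ * (t - s) ^ γ := by
    rw [hq, ← Real.rpow_natCast, ← Real.rpow_mul (by norm_num), mul_comm γ, Real.rpow_mul
      (by norm_num), Real.rpow_natCast, ← Real.mul_rpow (by norm_num) hd0.le]
    apply Real.rpow_le_rpow (by positivity) _ hγ.le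
    rw [pow_succ] at hn1; linarith
  have h1q : 0 < 1 - q := by linarith
  rw [abs_of_pos hd0]
  calc |f t - f s| = dist (f t) (f s) := (Real.dist_eq _ _).symm
    _ ≤ dist (f (⌊2 ^ n * t⌋₊ / 2 ^ n)) (f t) +
        dist (f (⌊2 ^ n * t⌋₊ / 2 ^ n)) (f (⌊2 ^ n * s⌋₊ / 2 ^ n)) +
        dist (f (⌊2 ^ n * s⌋₊ / 2 ^ n)) (f s) := by
      rw [dist_comm _ (f t)]; exact dist_triangle4 _ _ _ _
    _ ≤ (A * q) * q ^ n / (1 - q) + A * q ^ n + (A * q) * q ^ n / (1 - q) := by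
      gcongr
      · exact hlim t ht n
      · exact hlim s hs n
    _ = (1 + q) / (1 - q) * A * q ^ n := by field_simp; ring
    _ ≤ 2 / (1 - q) * A * (2 ^ γ * (t - s) ^ γ) := by
      gcongr; linarith
    _ = _ := by ring

/-- The chaining estimate on `[0, T]`, the constant written out as a function of `γ` and `T`. -/
lemma holder_of_dyadic_increments {γ T : ℝ} (hγ : 0 < γ) (hT : 0 < T) {f : ℝ → ℝ}
    (hf : ContinuousOn f (Icc 0 T)) {A : ℝ}
    (hA : ∀ n k : ℕ, k < 2 ^ n →
      |f (T * ((k + 1 : ℕ) / 2 ^ n)) - f (T * (k / 2 ^ n))| ≤ A * ((1 / 2 : ℝ) ^ γ) ^ n)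
    {s t : ℝ} (hs : s ∈ Icc (0 : ℝ) T) (ht : t ∈ Icc (0 : ℝ) T) :
    |f t - f s| ≤ 2 / (1 - (1 / 2 : ℝ) ^ γ) * 2 ^ γ / T ^ γ * A * |t - s| ^ γ := by
  have hdiv : ∀ x ∈ Icc (0 : ℝ) T, x / T ∈ Icc (0 : ℝ) 1 := fun x hx =>
    ⟨div_nonneg hx.1 hT.le, (div_le_one hT).2 hx.2⟩
  have hc : ContinuousOn (fun x => f (T * x)) (Icc 0 1) := by
    refine hf.comp (by fun_prop) fun x hx => ⟨mul_nonneg hT.le hx.1, ?_⟩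
    nlinarith [hx.2]
  have := holder_of_dyadic_increments_unit hγ hc hA (hdiv s hs) (hdiv t ht)
  simp only [mul_div_cancel₀ _ hT.ne'] at this
  refine this.trans (le_of_eq ?_)
  rw [← sub_div, abs_div, abs_of_pos hT, Real.div_rpow (abs_nonneg _) hT.le]
  ring

/-- The sum over all dyadic increments of `X`, rescaled by `2 ^ (γ n)` at level `n`, of their
`p`-th powers. -/
noncomputable def dyadicSum {Ω : Type*} (γ p T : ℝ) (X : ℝ → Ω → ℝ) (w : Ω) : ENNReal :=
  ∑' n : ℕ, ∑ k ∈ Finset.range (2 ^ n),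
    (‖X (T * ((k + 1 : ℕ) / 2 ^ n)) w - X (T * (k / 2 ^ n)) w‖ₑ *
      ENNReal.ofReal ((2 ^ γ) ^ n)) ^ p

/-- Kolmogorov's continuity estimate for a process with continuous paths, with a Hölder constant
in `L²`. -/
lemma exists_memLp_holder_const {Ω : Type*} [MeasurableSpace Ω] {P : Measure Ω}
    [IsProbabilityMeasure P] {γ p T H K : ℝ} (hγ : 0 < γ) (hT : 0 < T) (hp : 2 ≤ p)
    (hpH : 1 < p * (H - γ)) {X : ℝ → Ω → ℝ} (hX : ∀ t ∈ Icc (0 : ℝ) T, AEMeasurable (X t) P)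
    (hc : ∀ᵐ w ∂P, ContinuousOn (fun t => X t w) (Icc 0 T)) (hK : 0 ≤ K)
    (hmom : ∀ s ∈ Icc (0 : ℝ) T, ∀ t ∈ Icc (0 : ℝ) T,
      ∫⁻ w, ‖X t w - X s w‖ₑ ^ p ∂P ≤ ENNReal.ofReal (K * |t - s| ^ (p * H))) :
    ∃ M : Ω → ℝ, MemLp M 2 P ∧ (∀ w, 0 ≤ M w) ∧
      ∀ᵐ w ∂P, ∀ s ∈ Icc (0 : ℝ) T, ∀ t ∈ Icc (0 : ℝ) T, |X t w - X s w| ≤ M w * |t - s| ^ γ := by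
  have hp0 : 0 < p := by linarith
  have hmem : ∀ n k : ℕ, k ≤ 2 ^ n → T * ((k : ℝ) / 2 ^ n) ∈ Icc (0 : ℝ) T := fun n k hk => by
    have h1 : (k : ℝ) / 2 ^ n ≤ 1 := by
      rw [div_le_one (by positivity)]; exact_mod_cast hk
    exact ⟨by positivity, by nlinarith⟩
  have hmeas : ∀ n : ℕ, ∀ k ∈ Finset.range (2 ^ n), AEMeasurable (fun w =>
      (‖X (T * ((k + 1 : ℕ) / 2 ^ n)) w - X (T * (k / 2 ^ n)) w‖ₑ *
      ENNReal.ofReal ((2 ^ γ) ^ n)) ^ p) P := fun n k hk => by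
    have hk' := Finset.mem_range.1 hk
    exact ((((hX _ (hmem n (k + 1) hk')).sub (hX _ (hmem n k hk'.le))).enorm).mul_const _).pow_const _
  have hSm : AEMeasurable (dyadicSum γ p T X) P := by
    unfold dyadicSum
    exact AEMeasurable.tsum fun n => Finset.aemeasurable_fun_sum _ (hmeas n)
  set r : ℝ := 2 * ((2 ^ γ) ^ p * (1 / 2) ^ (p * H)) with hr
  have hr0 : 0 ≤ r := by positivity
  have hr1 : r < 1 := by
    have : r = 2 ^ (1 + γ * p - p * H) := by
      rw [hr, one_div, Real.inv_rpow (by norm_num), ← Real.rpow_mul (by norm_num),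
        Real.rpow_sub (by norm_num), Real.rpow_add (by norm_num), Real.rpow_one]
      ring
    rw [this]
    apply Real.rpow_lt_one_of_one_lt_of_neg (by norm_num)
    linarith
  have hSint : ∫⁻ w, dyadicSum γ p T X w ∂P ≠ ⊤ := by
    unfold dyadicSum
    rw [lintegral_tsum (fun n => Finset.aemeasurable_fun_sum _ (hmeas n))]
    have hb : ∀ n : ℕ, ∫⁻ w, ∑ k ∈ Finset.range (2 ^ n),
        (‖X (T * ((k + 1 : ℕ) / 2 ^ n)) w - X (T * (k / 2 ^ n)) w‖ₑ *
        ENNReal.ofReal ((2 ^ γ) ^ n)) ^ p ∂P ≤ ENNReal.ofReal (K * T ^ (p * H) * r ^ n) := by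
      intro n
      rw [lintegral_finsetSum' _ (hmeas n)]
      have hterm : ∀ k ∈ Finset.range (2 ^ n), ∫⁻ w,
          (‖X (T * ((k + 1 : ℕ) / 2 ^ n)) w - X (T * (k / 2 ^ n)) w‖ₑ *
          ENNReal.ofReal ((2 ^ γ) ^ n)) ^ p ∂P ≤
          ENNReal.ofReal (K * T ^ (p * H) * ((2 ^ γ) ^ p * (1 / 2) ^ (p * H)) ^ n) := by
        intro k hk
        have hk' := Finset.mem_range.1 hk
        simp_rw [ENNReal.mul_rpow_of_nonneg _ _ hp0.le]
        rw [lintegral_mul_const' _ _ (by finiteness)]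
        refine (mul_le_mul_left (hmom _ (hmem n k hk'.le) _ (hmem n (k + 1) hk')) _).trans
          (le_of_eq ?_)
        rw [ENNReal.ofReal_rpow_of_nonneg (by positivity) hp0.le, ← ENNReal.ofReal_mul
          (by positivity)]
        congr 1
        have e1 : T * ((k + 1 : ℕ) / 2 ^ n) - T * (k / 2 ^ n) = T * (1 / 2) ^ n := by
          push_cast; rw [one_div, inv_pow]; field_simp; ring
        rw [e1, abs_of_nonneg (by positivity), Real.mul_rpow hT.le (by positivity), mul_pow,
          Real.rpow_pow_comm (by positivity : (0 : ℝ) ≤ 2 ^ γ),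
          Real.rpow_pow_comm (by positivity : (0 : ℝ) ≤ 1 / 2)]
        ring
      refine (Finset.sum_le_sum hterm).trans (le_of_eq ?_)
      rw [Finset.sum_const, Finset.card_range, nsmul_eq_mul, ← ENNReal.ofReal_natCast,
        ← ENNReal.ofReal_mul (by positivity), hr]
      congr 1
      rw [mul_pow 2]; push_cast; ring
    refine ne_top_of_le_ne_top ?_ (ENNReal.tsum_le_tsum hb)
    rw [← ENNReal.ofReal_tsum_of_nonneg (fun n => by positivity)
      ((summable_geometric_of_lt_one hr0 hr1).mul_left _)]
    exact ENNReal.ofReal_ne_top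
  have hSfin : ∀ᵐ w ∂P, dyadicSum γ p T X w < ⊤ := ae_lt_top' hSm hSint
  set C : ℝ := 2 / (1 - (1 / 2 : ℝ) ^ γ) * 2 ^ γ / T ^ γ with hC
  have hC0 : 0 ≤ C := by
    have : (1 / 2 : ℝ) ^ γ < 1 := Real.rpow_lt_one (by norm_num) (by norm_num) hγ
    have : 0 < 1 - (1 / 2 : ℝ) ^ γ := by linarith
    positivity
  set N : Ω → ℝ := fun w => ((dyadicSum γ p T X w) ^ p⁻¹).toReal with hN
  have hNm : MemLp N 2 P := by
    have hNae : AEStronglyMeasurable N P := (hSm.pow_const _).ennreal_toReal.aestronglyMeasurable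
    have : MemLp N (ENNReal.ofReal p) P := by
      refine ⟨hNae, ?_⟩
      have hp1 : ENNReal.ofReal p ≠ 0 := by simpa using hp0
      rw [eLpNorm_lt_top_iff_lintegral_rpow_enorm_lt_top hp1 ENNReal.ofReal_ne_top,
        ENNReal.toReal_ofReal hp0.le]
      refine lt_of_le_of_lt (lintegral_mono_ae ?_) hSint.lt_top
      filter_upwards [hSfin] with w hw
      have : (dyadicSum γ p T X w) ^ p⁻¹ ≠ ⊤ := by
        apply ENNReal.rpow_ne_top_of_nonneg (by positivity) hw.ne
      rw [hN, Real.enorm_eq_ofReal ENNReal.toReal_nonneg, ENNReal.ofReal_toReal this,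
        ENNReal.rpow_inv_rpow hp0.ne']
    refine this.mono_exponent ?_
    rw [show (2 : ENNReal) = ENNReal.ofReal 2 by simp]
    exact ENNReal.ofReal_le_ofReal hp
  refine ⟨fun w => C * N w, hNm.const_mul C, fun w => mul_nonneg hC0 ENNReal.toReal_nonneg, ?_⟩
  filter_upwards [hSfin, hc] with w hw hcw s hs t ht
  refine holder_of_dyadic_increments hγ hT hcw (A := N w) (fun n k hk => ?_) hs ht
  set d := X (T * ((k + 1 : ℕ) / 2 ^ n)) w - X (T * (k / 2 ^ n)) w with hd
  have h1 : (‖d‖ₑ * ENNReal.ofReal ((2 ^ γ) ^ n)) ^ p ≤ dyadicSum γ p T X w := by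
    refine le_trans ?_ (ENNReal.le_tsum n)
    exact Finset.single_le_sum (f := fun k : ℕ =>
      (‖X (T * ((k + 1 : ℕ) / 2 ^ n)) w - X (T * (k / 2 ^ n)) w‖ₑ *
      ENNReal.ofReal ((2 ^ γ) ^ n)) ^ p) (fun _ _ => zero_le) (Finset.mem_range.2 hk)
  have h2 : ‖d‖ₑ * ENNReal.ofReal ((2 ^ γ) ^ n) ≤ (dyadicSum γ p T X w) ^ p⁻¹ :=
    (ENNReal.le_rpow_inv_iff hp0).2 h1
  have h3 := ENNReal.toReal_mono (ENNReal.rpow_ne_top_of_nonneg (by positivity) hw.ne) h2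
  rw [ENNReal.toReal_mul, toReal_enorm, ENNReal.toReal_ofReal (by positivity),
    Real.norm_eq_abs] at h3
  have h4 : ((1 / 2 : ℝ) ^ γ) ^ n = ((2 ^ γ) ^ n)⁻¹ := by
    rw [one_div, Real.inv_rpow (by norm_num), inv_pow]
  rw [h4, ← div_eq_mul_inv, le_div_iff₀ (by positivity)]
  exact h3

/-! ### Hölder versions of fractional Brownian motion -/

/-- Absolute moments of a centered Gaussian variable are those of a standard one, rescaled. -/
lemma lintegral_enorm_rpow_of_hasGaussianLaw {Ω : Type*} [MeasurableSpace Ω] {P : Measure Ω}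
    [IsProbabilityMeasure P] {X : Ω → ℝ} (hX : HasGaussianLaw X P) (h0 : ∫ w, X w ∂P = 0)
    {σ : ℝ} (hσ : 0 ≤ σ) (hv : ∫ w, X w ^ 2 ∂P = σ ^ 2) {p : ℝ} (hp : 0 < p) :
    ∫⁻ w, ‖X w‖ₑ ^ p ∂P =
      ENNReal.ofReal ((∫⁻ x, ‖x‖ₑ ^ p ∂(gaussianReal 0 1)).toReal * σ ^ p) := by
  have hvar : Var[X; P] = σ ^ 2 := by
    rw [variance_of_integral_eq_zero hX.aemeasurable h0, hv]
  have hmap : P.map X = (gaussianReal 0 1).map (σ * ·) := by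
    rw [hX.map_eq_gaussianReal, hvar, h0, gaussianReal_map_const_mul]
    congr 1
    · simp
    · ext; simpa using sq_nonneg σ
  have hfin : ∫⁻ x, ‖x‖ₑ ^ p ∂(gaussianReal 0 1) ≠ ⊤ := by
    have := (memLp_id_gaussianReal' (μ := 0) (v := 1) (ENNReal.ofReal p) ENNReal.ofReal_ne_top).2
    rw [eLpNorm_lt_top_iff_lintegral_rpow_enorm_lt_top (by simpa using hp) ENNReal.ofReal_ne_top,
      ENNReal.toReal_ofReal hp.le] at this
    exact this.ne
  have hm : Measurable fun x : ℝ => ‖x‖ₑ ^ p := by fun_prop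
  rw [← lintegral_map' hm.aemeasurable hX.aemeasurable, hmap,
    lintegral_map hm (by fun_prop)]
  simp_rw [enorm_mul, ENNReal.mul_rpow_of_nonneg _ _ hp.le]
  rw [lintegral_const_mul _ hm, ENNReal.ofReal_mul ENNReal.toReal_nonneg, ENNReal.ofReal_toReal hfin,
    mul_comm, Real.enorm_eq_ofReal hσ, ENNReal.ofReal_rpow_of_nonneg hσ hp.le]

/-- The paths of a fractional Brownian motion are Hölder continuous of every order `γ < H`, with a
square integrable Hölder constant. -/
lemma IsFractionalBrownianMotion.exists_holder_const {Ω : Type*} [MeasurableSpace Ω]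
    {P : Measure Ω} [IsProbabilityMeasure P] {H T : ℝ} (hT : 0 < T) {B : ℝ → Ω → ℝ}
    (hB : IsFractionalBrownianMotion P H T B) {γ : ℝ} (hγ : 0 < γ) (hγH : γ < H) :
    ∃ M : Ω → ℝ, MemLp M 2 P ∧ (∀ w, 0 ≤ M w) ∧
      ∀ᵐ w ∂P, ∀ s ∈ Icc (0 : ℝ) T, ∀ t ∈ Icc (0 : ℝ) T, |B t w - B s w| ≤ M w * |t - s| ^ γ := by
  set p : ℝ := 2 + 1 / (H - γ) with hp
  have hd : 0 < H - γ := sub_pos.2 hγH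
  have hp2 : 2 ≤ p := by rw [hp]; have : 0 < 1 / (H - γ) := by positivity
                         linarith
  refine exists_memLp_holder_const (H := H) (p := p) hγ hT hp2 ?_
    (fun t ht => hB.gaussian.aemeasurable ⟨t, ht⟩) hB.continuous_paths
    (ENNReal.toReal_nonneg (a := ∫⁻ x, ‖x‖ₑ ^ p ∂(gaussianReal 0 1))) ?_
  · rw [hp, add_mul, one_div, inv_mul_cancel₀ hd.ne']; linarith
  · intro s hs t ht
    have hL2 : ∀ r ∈ Icc (0 : ℝ) T, MemLp (B r) 2 P := fun r hr =>
      (hB.gaussian.hasGaussianLaw_eval ⟨r, hr⟩).memLp_two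
    have hcov := hB.covariance
    have hG : HasGaussianLaw (fun w => B t w - B s w) P :=
      hB.gaussian.hasGaussianLaw_fun_sub (s := ⟨t, ht⟩) (t := ⟨s, hs⟩)
    have hmul : ∀ a ∈ Icc (0 : ℝ) T, ∀ b ∈ Icc (0 : ℝ) T, Integrable (fun w => B a w * B b w) P :=
      fun a ha b hb => (hL2 a ha).integrable_mul (hL2 b hb)
    rw [lintegral_enorm_rpow_of_hasGaussianLaw hG (σ := |t - s| ^ H) ?_ (by positivity) ?_
      (by linarith), ← Real.rpow_mul (abs_nonneg _), mul_comm H]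
    · rw [integral_sub ((hL2 t ht).integrable (by norm_num)) ((hL2 s hs).integrable (by norm_num)),
        hB.centered t ht, hB.centered s hs, sub_zero]
    · have : ∀ w, (B t w - B s w) ^ 2 = B t w * B t w - 2 * (B s w * B t w) + B s w * B s w :=
        fun w => by ring
      simp_rw [this]
      have hI : Integrable (fun w => B t w * B t w - 2 * (B s w * B t w)) P :=
        (hmul t ht t ht).sub ((hmul s hs t ht).const_mul 2)
      rw [integral_add hI (hmul s hs s hs),
        integral_sub (hmul t ht t ht) ((hmul s hs t ht).const_mul 2), integral_const_mul,
        hcov t ht t ht, hcov s hs t ht, hcov s hs s hs]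
      have h0 : (0 : ℝ) ^ (2 * H) = 0 := Real.zero_rpow (by linarith)
      simp only [sub_self, abs_zero, h0]
      rw [← Real.rpow_natCast, ← Real.rpow_mul (abs_nonneg _)]
      push_cast
      ring_nf

/-- A version `z` of the process `ζ` on `[0, T]` all of whose paths are continuous, with Hölder
constants on `[0, T]` in `L²` for every order `γ < H`. Continuity and
measurability are required at all real times, so that `z` is jointly measurable. -/
structure IsHolderVersion {Ω : Type*} [MeasurableSpace Ω] (P : Measure Ω) (H T : ℝ)
    (ζ z : ℝ → Ω → ℂ) : Prop where
  measurable : ∀ t, Measurable (z t)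
  continuous : ∀ w, Continuous fun t => z t w
  ae_eq : ∀ᵐ w ∂P, ∀ t ∈ Icc (0 : ℝ) T, z t w = ζ t w
  holder : ∀ γ ∈ Ioo (0 : ℝ) H, ∃ M : Ω → ℝ, MemLp M 2 P ∧ (∀ w, 0 ≤ M w) ∧
    ∀ w, ∀ s ∈ Icc (0 : ℝ) T, ∀ t ∈ Icc (0 : ℝ) T, ‖z t w - z s w‖ ≤ M w * |t - s| ^ γ

/-- A process with the Hölder bounds holding almost surely for a sequence of orders tending to `H`
has a Hölder version. -/
lemma exists_isHolderVersion {Ω : Type*} [MeasurableSpace Ω] {P : Measure Ω} {H T : ℝ}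
    (hH : 0 < H) (hT : 0 < T) {ζ : ℝ → Ω → ℂ} (hm : ∀ t ∈ Icc (0 : ℝ) T, AEMeasurable (ζ t) P)
    (hh : ∀ γ ∈ Ioo (0 : ℝ) H, ∃ M : Ω → ℝ, MemLp M 2 P ∧ (∀ w, 0 ≤ M w) ∧
      ∀ᵐ w ∂P, ∀ s ∈ Icc (0 : ℝ) T, ∀ t ∈ Icc (0 : ℝ) T, ‖ζ t w - ζ s w‖ ≤ M w * |t - s| ^ γ) :
    ∃ z, IsHolderVersion P H T ζ z := by
  classical
  obtain ⟨g, -, hg, hglim⟩ := exists_seq_strictMono_tendsto' hH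
  choose M hM2 hM0 hM using fun n => hh (g n) (hg n)
  set cl : ℝ → ℝ := fun t => max 0 (min T t) with hcl
  have hclc : Continuous cl := by fun_prop
  have hclm : ∀ t, cl t ∈ Icc (0 : ℝ) T := fun t =>
    ⟨le_max_left _ _, max_le hT.le (min_le_left _ _)⟩
  have hcle : ∀ t ∈ Icc (0 : ℝ) T, cl t = t := fun t ht => by
    simp only [hcl]; rw [min_eq_right ht.2, max_eq_right ht.1]
  set Y : ℝ → Ω → ℂ := fun t => (hm (cl t) (hclm t)).mk _ with hY
  have hYm : ∀ t, Measurable (Y t) := fun t => (hm (cl t) (hclm t)).measurable_mk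
  have hbad : ∀ᵐ w ∂P, (∀ n, ∀ s ∈ Icc (0 : ℝ) T, ∀ t ∈ Icc (0 : ℝ) T,
      ‖ζ t w - ζ s w‖ ≤ M n w * |t - s| ^ (g n)) ∧ ∀ q : ℚ, ζ (cl q) w = Y q w := by
    refine (ae_all_iff.2 hM).and (ae_all_iff.2 fun q => ?_)
    exact (hm (cl q) (hclm q)).ae_eq_mk
  set N := toMeasurable P {w | ¬ ((∀ n, ∀ s ∈ Icc (0 : ℝ) T, ∀ t ∈ Icc (0 : ℝ) T,
      ‖ζ t w - ζ s w‖ ≤ M n w * |t - s| ^ (g n)) ∧ ∀ q : ℚ, ζ (cl q) w = Y q w)} with hN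
  have hNm : MeasurableSet N := measurableSet_toMeasurable _ _
  have hN0 : P N = 0 := by rw [hN, measure_toMeasurable]; exact hbad
  have hgood : ∀ w, w ∉ N → (∀ n, ∀ s ∈ Icc (0 : ℝ) T, ∀ t ∈ Icc (0 : ℝ) T,
      ‖ζ t w - ζ s w‖ ≤ M n w * |t - s| ^ (g n)) ∧ ∀ q : ℚ, ζ (cl q) w = Y q w := by
    intro w hw
    by_contra hc
    exact hw (subset_toMeasurable _ _ hc)
  set z : ℝ → Ω → ℂ := fun t => Nᶜ.indicator (ζ (cl t)) with hz
  have hzc : ∀ w, Continuous fun t => z t w := by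
    intro w
    by_cases hw : w ∈ N
    · have : (fun t => z t w) = fun _ => 0 := by
        funext t; simp [hz, hw]
      rw [this]; exact continuous_const
    · have : (fun t => z t w) = fun t => ζ (cl t) w := by
        funext t; simp [hz, hw]
      rw [this, continuous_iff_continuousAt]
      intro t
      rw [ContinuousAt, tendsto_iff_norm_sub_tendsto_zero]
      have hlim : Tendsto (fun s => M 0 w * |cl s - cl t| ^ (g 0)) (𝓝 t)
          (𝓝 (M 0 w * |cl t - cl t| ^ (g 0))) := by
        refine Tendsto.const_mul _ ?_
        refine Tendsto.rpow_const ?_ (Or.inr (hg 0).1.le)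
        exact ((hclc.tendsto t).sub_const _).abs
      rw [sub_self, abs_zero, Real.zero_rpow (hg 0).1.ne', mul_zero] at hlim
      exact squeeze_zero (fun _ => norm_nonneg _)
        (fun s => (hgood w hw).1 0 _ (hclm t) _ (hclm s)) hlim
  refine ⟨z, ⟨fun t => ?_, hzc, ?_, fun γ hγ => ?_⟩⟩
  · obtain ⟨q, hq⟩ : ∃ q : ℕ → ℚ, Tendsto (fun n => (q n : ℝ)) atTop (𝓝 t) := by
      obtain ⟨u, hu, hulim⟩ := mem_closure_iff_seq_limit.1 (Rat.isDenseEmbedding_coe_real.dense t)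
      choose q hq using hu
      exact ⟨q, by simpa only [hq] using hulim⟩
    refine measurable_of_tendsto_metrizable (f := fun n => Nᶜ.indicator (Y (q n)))
      (fun n => (hYm _).indicator hNm.compl) ?_
    rw [tendsto_pi_nhds]
    intro w
    have h1 : ∀ n, Nᶜ.indicator (Y (q n)) w = z (q n) w := by
      intro n
      by_cases hw : w ∈ N
      · simp [hz, hw]
      · simp only [hz, mem_compl_iff, hw, not_false_eq_true, indicator_of_mem]
        exact ((hgood w hw).2 (q n)).symm
    simp_rw [h1]
    exact ((hzc w).tendsto t).comp hq
  · have : ∀ᵐ w ∂P, w ∉ N := measure_eq_zero_iff_ae_notMem.1 hN0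
    filter_upwards [this] with w hw t ht
    simp [hz, hw, hcle t ht]
  · obtain ⟨n, hn⟩ := ((tendsto_order.1 hglim).1 γ hγ.2).exists
    refine ⟨fun w => T ^ (g n - γ) * M n w, (hM2 n).const_mul _,
      fun w => mul_nonneg (by positivity) (hM0 n w), fun w s hs t ht => ?_⟩
    by_cases hw : w ∈ N
    · simp only [hz, mem_compl_iff, hw, not_true_eq_false, not_false_eq_true,
        indicator_of_notMem, sub_self, norm_zero]
      have := hM0 n w
      positivity
    · simp only [hz, mem_compl_iff, hw, not_false_eq_true, indicator_of_mem, hcle s hs, hcle t ht]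
      refine ((hgood w hw).1 n s hs t ht).trans ?_
      have h1 : |t - s| ^ (g n) ≤ T ^ (g n - γ) * |t - s| ^ γ := by
        have h2 : |t - s| ≤ T := abs_sub_le_iff.2 ⟨by linarith [hs.1, ht.2], by linarith [ht.1, hs.2]⟩
        calc |t - s| ^ (g n) = |t - s| ^ (g n - γ) * |t - s| ^ γ := by
              rw [← Real.rpow_add_of_nonneg (abs_nonneg _) (by linarith) hγ.1.le, sub_add_cancel]
          _ ≤ _ := by
              gcongr
      calc _ ≤ M n w * (T ^ (g n - γ) * |t - s| ^ γ) := mul_le_mul_of_nonneg_left h1 (hM0 n w)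
        _ = _ := by ring

/-- The complex fractional Brownian motion has a Hölder version. -/
lemma IsPlanarFractionalBrownianMotion.exists_isHolderVersion {Ω : Type*} [MeasurableSpace Ω]
    {P : Measure Ω} [IsProbabilityMeasure P] {H T : ℝ} (hH : 0 < H) (hT : 0 < T)
    {B₁ B₂ : ℝ → Ω → ℝ} (hB : IsPlanarFractionalBrownianMotion P H T B₁ B₂) :
    ∃ z, IsHolderVersion P H T (complexFBM B₁ B₂) z := by
  refine _root_.exists_isHolderVersion hH hT (fun t ht => ?_) (fun γ hγ => ?_)
  · have h1 := hB.fst.gaussian.aemeasurable ⟨t, ht⟩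
    have h2 := hB.snd.gaussian.aemeasurable ⟨t, ht⟩
    exact ((Complex.measurable_ofReal.comp_aemeasurable h1).add
      ((Complex.measurable_ofReal.comp_aemeasurable h2).const_mul _)).const_mul _
  · obtain ⟨M₁, h1, h10, h1b⟩ := hB.fst.exists_holder_const hT hγ.1 hγ.2
    obtain ⟨M₂, h2, h20, h2b⟩ := hB.snd.exists_holder_const hT hγ.1 hγ.2
    refine ⟨fun w => M₁ w + M₂ w, h1.add h2, fun w => add_nonneg (h10 w) (h20 w), ?_⟩
    filter_upwards [h1b, h2b] with w hw1 hw2 s hs t ht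
    have e : complexFBM B₁ B₂ t w - complexFBM B₁ B₂ s w =
        ((Real.sqrt 2)⁻¹ : ℝ) * (((B₁ t w - B₁ s w : ℝ) : ℂ) +
          Complex.I * ((B₂ t w - B₂ s w : ℝ) : ℂ)) := by
      simp only [complexFBM]; push_cast; ring
    have hs2 : (Real.sqrt 2)⁻¹ ≤ 1 := by
      apply inv_le_one_of_one_le₀
      rw [Real.one_le_sqrt]; norm_num
    rw [e, norm_mul, Complex.norm_real, Real.norm_of_nonneg (by positivity), add_mul]
    refine (mul_le_of_le_one_left (norm_nonneg _) hs2).trans ((norm_add_le _ _).trans ?_)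
    rw [norm_mul, Complex.norm_I, one_mul, Complex.norm_real, Complex.norm_real]
    exact add_le_add (hw1 s hs t ht) (hw2 s hs t ht)

/-! ### Covariance of the complex process and uniqueness of Wiener integrals -/

/-- The covariance function of fractional Brownian motion. -/
noncomputable def fbmCov (H s t : ℝ) : ℝ :=
  (|s| ^ (2 * H) + |t| ^ (2 * H) - |t - s| ^ (2 * H)) / 2

lemma IsPlanarFractionalBrownianMotion.memLp {Ω : Type*} [MeasurableSpace Ω] {P : Measure Ω}
    {H T : ℝ} {B₁ B₂ : ℝ → Ω → ℝ} (hB : IsPlanarFractionalBrownianMotion P H T B₁ B₂) {t : ℝ}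
    (ht : t ∈ Icc (0 : ℝ) T) : MemLp (complexFBM B₁ B₂ t) 2 P := by
  have h1 : MemLp (B₁ t) 2 P := (hB.fst.gaussian.hasGaussianLaw_eval ⟨t, ht⟩).memLp_two
  have h2 : MemLp (B₂ t) 2 P := (hB.snd.gaussian.hasGaussianLaw_eval ⟨t, ht⟩).memLp_two
  have h3 : MemLp (fun w => (B₁ t w : ℂ) + Complex.I * (B₂ t w : ℂ)) 2 P :=
    (h1.ofReal (K := ℂ)).add ((h2.ofReal (K := ℂ)).const_mul Complex.I)
  exact h3.const_mul (((Real.sqrt 2)⁻¹ : ℝ) : ℂ)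

lemma IsPlanarFractionalBrownianMotion.integral_mul_conj {Ω : Type*} [MeasurableSpace Ω]
    {P : Measure Ω} {H T : ℝ} {B₁ B₂ : ℝ → Ω → ℝ}
    (hB : IsPlanarFractionalBrownianMotion P H T B₁ B₂) {s t : ℝ}
    (hs : s ∈ Icc (0 : ℝ) T) (ht : t ∈ Icc (0 : ℝ) T) :
    ∫ w, complexFBM B₁ B₂ s w * (starRingEnd ℂ) (complexFBM B₁ B₂ t w) ∂P = fbmCov H s t := by
  have h1 : ∀ t ∈ Icc (0 : ℝ) T, MemLp (B₁ t) 2 P := fun t ht =>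
    (hB.fst.gaussian.hasGaussianLaw_eval ⟨t, ht⟩).memLp_two
  have h2 : ∀ t ∈ Icc (0 : ℝ) T, MemLp (B₂ t) 2 P := fun t ht =>
    (hB.snd.gaussian.hasGaussianLaw_eval ⟨t, ht⟩).memLp_two
  have hcross : ∀ s ∈ Icc (0 : ℝ) T, ∀ t ∈ Icc (0 : ℝ) T, ∫ w, B₁ s w * B₂ t w ∂P = 0 := by
    intro s hs t ht
    have hi : IndepFun (B₁ s) (B₂ t) P :=
      hB.indep.comp (measurable_pi_apply (⟨s, hs⟩ : Icc (0 : ℝ) T))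
        (measurable_pi_apply (⟨t, ht⟩ : Icc (0 : ℝ) T))
    rw [hi.integral_fun_mul_eq_mul_integral (h1 s hs).1 (h2 t ht).1, hB.fst.centered s hs, zero_mul]
  have hs2 : ((Real.sqrt 2)⁻¹ : ℝ) * ((Real.sqrt 2)⁻¹ : ℝ) = 1 / 2 := by
    rw [← mul_inv, Real.mul_self_sqrt (by norm_num)]; norm_num
  have hs2' : (((Real.sqrt 2)⁻¹ : ℝ) : ℂ) * (((Real.sqrt 2)⁻¹ : ℝ) : ℂ) = 1 / 2 := by
    rw [← Complex.ofReal_mul, hs2]; norm_num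
  have hexp : ∀ w, complexFBM B₁ B₂ s w * (starRingEnd ℂ) (complexFBM B₁ B₂ t w) =
      ((1 / 2 * (B₁ s w * B₁ t w + B₂ s w * B₂ t w) : ℝ) : ℂ) +
      ((1 / 2 * (B₁ t w * B₂ s w - B₁ s w * B₂ t w) : ℝ) : ℂ) * Complex.I := by
    intro w
    simp only [complexFBM, map_mul, map_add, Complex.conj_ofReal, Complex.conj_I]
    calc _ = ((((Real.sqrt 2)⁻¹ : ℝ) : ℂ) * (((Real.sqrt 2)⁻¹ : ℝ) : ℂ)) *
          ((B₁ s w : ℂ) * B₁ t w - Complex.I * Complex.I * (B₂ s w : ℂ) * B₂ t w +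
            ((B₁ t w : ℂ) * B₂ s w - (B₁ s w : ℂ) * B₂ t w) * Complex.I) := by ring
      _ = _ := by rw [hs2', Complex.I_mul_I]; push_cast; ring
  have i11 := (h1 s hs).integrable_mul (h1 t ht)
  have i22 := (h2 s hs).integrable_mul (h2 t ht)
  have i12 := (h1 s hs).integrable_mul (h2 t ht)
  have i21 := (h1 t ht).integrable_mul (h2 s hs)
  have ia : Integrable (fun w => 1 / 2 * (B₁ s w * B₁ t w + B₂ s w * B₂ t w)) P :=
    (i11.add i22).const_mul _
  have ib : Integrable (fun w => 1 / 2 * (B₁ t w * B₂ s w - B₁ s w * B₂ t w)) P :=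
    (i21.sub i12).const_mul _
  simp_rw [hexp]
  rw [integral_add ia.ofReal (ib.ofReal.mul_const _), integral_mul_const, integral_complex_ofReal,
    integral_complex_ofReal, integral_const_mul, integral_const_mul]
  have e1 : ∫ w, (B₁ s w * B₁ t w + B₂ s w * B₂ t w) ∂P =
      (∫ w, B₁ s w * B₁ t w ∂P) + ∫ w, B₂ s w * B₂ t w ∂P := integral_add i11 i22
  have e2 : ∫ w, (B₁ t w * B₂ s w - B₁ s w * B₂ t w) ∂P =
      (∫ w, B₁ t w * B₂ s w ∂P) - ∫ w, B₁ s w * B₂ t w ∂P := integral_sub i21 i12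
  rw [e1, e2, hcross t ht s hs, hcross s hs t ht, hB.fst.covariance s hs t ht,
    hB.snd.covariance s hs t ht]
  simp only [fbmCov]
  push_cast
  ring

/-- Continuity of `f ↦ ∫ f g` for `L²` convergence. -/
lemma tendsto_integral_mul_of_eLpNorm {Ω : Type*} [MeasurableSpace Ω] {P : Measure Ω}
    {f : ℕ → Ω → ℂ} {f₀ g : Ω → ℂ} (hf : ∀ n, MemLp (f n) 2 P) (hf₀ : MemLp f₀ 2 P)
    (hg : MemLp g 2 P) (hlim : Tendsto (fun n => eLpNorm (fun w => f n w - f₀ w) 2 P) atTop (𝓝 0)) :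
    Tendsto (fun n => ∫ w, f n w * g w ∂P) atTop (𝓝 (∫ w, f₀ w * g w ∂P)) := by
  refine tendsto_integral_of_L1' (F := fun n w => f n w * g w) (fun w => f₀ w * g w)
    (hf₀.1.mul hg.1) (Eventually.of_forall fun n => (hf n).integrable_mul hg) ?_
  have h1 : Tendsto (fun n => eLpNorm (fun w => f n w - f₀ w) 2 P * eLpNorm g 2 P) atTop (𝓝 0) := by
    simpa using ENNReal.Tendsto.mul_const hlim (Or.inr hg.2.ne)
  refine tendsto_of_tendsto_of_tendsto_of_le_of_le tendsto_const_nhds h1 (fun _ => zero_le) ?_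
  intro n
  have h2 := eLpNorm_smul_le_mul_eLpNorm (p := 2) (q := 2) (r := 1) (μ := P) (f := g)
    (φ := fun w => f n w - f₀ w) hg.1 ((hf n).1.sub hf₀.1)
  have h3 : (fun w => f n w * g w) - (fun w => f₀ w * g w) = (fun w => f n w - f₀ w) • g := by
    funext w
    simp only [Pi.sub_apply, Pi.smul_apply', smul_eq_mul, sub_mul]
  simp only [h3]
  exact h2

lemma ae_eq_zero_of_integral_mul_conj_eq_zero {Ω : Type*} [MeasurableSpace Ω] {P : Measure Ω}
    {Y : Ω → ℂ} (hY : MemLp Y 2 P) (h : ∫ w, Y w * (starRingEnd ℂ) (Y w) ∂P = 0) : Y =ᵐ[P] 0 := by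
  simp_rw [Complex.mul_conj, integral_complex_ofReal] at h
  have h4 : ∫ w, Complex.normSq (Y w) ∂P = 0 := by exact_mod_cast h
  have hint : Integrable (fun w => Complex.normSq (Y w)) P := by
    have := hY.integrable_norm_pow (by norm_num)
    simpa [Complex.normSq_eq_norm_sq] using this
  rw [integral_eq_zero_iff_of_nonneg (fun w => Complex.normSq_nonneg _) hint] at h4
  filter_upwards [h4] with w hw
  exact Complex.normSq_eq_zero.1 hw

lemma intervalIntegrable_complex_ofReal {f : ℝ → ℝ} {a b : ℝ}
    (hf : IntervalIntegrable f volume a b) :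
    IntervalIntegrable (fun u => (f u : ℂ)) volume a b :=
  ⟨hf.1.ofReal, hf.2.ofReal⟩

lemma intervalIntegrable_abs_rpow {r : ℝ} (hr : -1 < r) (a b : ℝ) :
    IntervalIntegrable (fun x : ℝ => |x| ^ r) volume a b := by
  have hpos : ∀ c : ℝ, 0 ≤ c → IntervalIntegrable (fun x : ℝ => |x| ^ r) volume 0 c := by
    intro c hc
    refine (intervalIntegral.intervalIntegrable_rpow' hr (a := 0) (b := c)).congr fun x hx => ?_
    rw [uIoc_of_le hc] at hx
    simp only [abs_of_pos hx.1]
  have hall : ∀ c : ℝ, IntervalIntegrable (fun x : ℝ => |x| ^ r) volume 0 c := by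
    intro c
    rcases le_total 0 c with hc | hc
    · exact hpos c hc
    · rw [IntervalIntegrable.iff_comp_neg]
      simpa using hpos (-c) (by linarith)
  exact (hall a).symm.trans (hall b)

/-- The density in `u` of the covariance function `u ↦ fbmCov H u t`. -/
noncomputable def fbmCovDensity (H t u : ℝ) : ℝ :=
  ((SignType.sign u : ℝ) * (2 * H) * |u| ^ (2 * H - 1) -
    (SignType.sign (u - t) : ℝ) * (2 * H) * |u - t| ^ (2 * H - 1)) / 2

lemma intervalIntegrable_fbmCovDensity {H : ℝ} (hH : 0 < H) (t a b : ℝ) :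
    IntervalIntegrable (fbmCovDensity H t) volume a b := by
  have key : ∀ a b : ℝ, IntervalIntegrable
      (fun u : ℝ => (SignType.sign u : ℝ) * (2 * H) * |u| ^ (2 * H - 1)) volume a b := by
    intro a b
    have h1 := (intervalIntegrable_abs_rpow (by linarith : -1 < 2 * H - 1) a b).const_mul (2 * H)
    refine h1.mono_fun ?_ ?_
    · have hs : Measurable fun u : ℝ => (SignType.sign u : ℝ) := by
        have : (fun u : ℝ => (SignType.sign u : ℝ)) =
            fun u => if 0 < u then 1 else if u < 0 then -1 else 0 := by
          funext u
          rw [sign_apply]; split_ifs <;> simp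
        rw [this]
        exact Measurable.ite measurableSet_Ioi measurable_const
          (Measurable.ite measurableSet_Iio measurable_const measurable_const)
      exact ((hs.mul_const _).mul (by fun_prop)).aestronglyMeasurable
    · refine Eventually.of_forall fun u => ?_
      simp only [norm_mul, mul_assoc]
      refine mul_le_of_le_one_left (by positivity) ?_
      rcases lt_trichotomy u 0 with h | h | h <;> simp [h]
  refine ((key a b).sub ?_).div_const 2
  simpa using (key (a - t) (b - t)).comp_sub_right t

lemma integral_fbmCovDensity {H : ℝ} (hH : 0 < H) (t s : ℝ) :
    ∫ u in (0 : ℝ)..s, fbmCovDensity H t u = fbmCov H s t := by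
  have hd : ∀ x : ℝ, x ≠ 0 → HasDerivAt (fun u : ℝ => |u| ^ (2 * H))
      ((SignType.sign x : ℝ) * (2 * H) * |x| ^ (2 * H - 1)) x := fun x hx =>
    (hasDerivAt_abs hx).rpow_const (Or.inl (abs_ne_zero.2 hx))
  have := integral_eq_of_hasDerivAt_off_countable (a := 0) (b := s) (fun u => fbmCov H u t)
    (fbmCovDensity H t) (s := {0, t}) (Set.Countable.insert _ (Set.countable_singleton _)) ?_ ?_
    (intervalIntegrable_fbmCovDensity hH t 0 s)
  · rw [this]
    simp only [fbmCov, abs_zero, sub_zero]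
    rw [Real.zero_rpow (by linarith)]
    ring
  · refine Continuous.continuousOn ?_
    unfold fbmCov
    have h2 : ∀ x : ℝ, x ≠ 0 ∨ 0 < 2 * H := fun _ => Or.inr (by linarith)
    have h3 : 0 ≤ 2 * H := by linarith
    fun_prop (disch := assumption)
  · intro x hx
    have hx2 := hx.2
    simp only [mem_insert_iff, mem_singleton_iff, not_or] at hx2
    have h1 := hd x hx2.1
    have h2 := (hd (x - t) (sub_ne_zero.2 hx2.2)).comp_sub_const x t
    have h3 := ((h1.add_const (|t| ^ (2 * H))).sub h2).div_const 2
    refine h3.congr_of_eventuallyEq (Eventually.of_forall fun u => ?_)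
    simp only [fbmCov, abs_sub_comm t u, Pi.sub_apply]

section WienerIntegral

variable {Ω : Type*} [MeasurableSpace Ω] {P : Measure Ω} {H T : ℝ} {ζ : ℝ → Ω → ℂ}

lemma memLp_stepIntegral (hL2 : ∀ t ∈ Icc (0 : ℝ) T, MemLp (ζ t) 2 P) {c : ℝ →₀ ℂ}
    (hc : ∀ s ∈ c.support, s ∈ Icc (0 : ℝ) T) : MemLp (stepIntegral ζ c) 2 P := by
  unfold stepIntegral Finsupp.sum
  exact memLp_finsetSum _ fun s hs => (hL2 s (hc s hs)).const_mul _

lemma stepIntegral_sub {Ω : Type*} {ζ : ℝ → Ω → ℂ} (c d : ℝ →₀ ℂ) (w : Ω) :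
    stepIntegral ζ (c - d) w = stepIntegral ζ c w - stepIntegral ζ d w :=
  Finsupp.sum_sub_index fun _ _ _ => sub_mul _ _ _

lemma stepFunction_sub (c d : ℝ →₀ ℂ) (u : ℝ) :
    stepFunction (c - d) u = stepFunction c u - stepFunction d u :=
  Finsupp.sum_sub_index fun _ _ _ => sub_mul _ _ _

lemma measurable_stepFunction (c : ℝ →₀ ℂ) : Measurable (stepFunction c) := by
  unfold stepFunction Finsupp.sum
  exact Finset.measurable_fun_sum _ fun s _ =>
    (measurable_const.indicator measurableSet_Icc).const_mul _

/-- The inner product of the integral of a step function with `ζ t` is an integral of that step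
function against an integrable kernel; in particular it is continuous for uniform convergence. -/
lemma integral_stepIntegral_mul_conj (hH : 0 < H) (hT : 0 < T)
    (hL2 : ∀ t ∈ Icc (0 : ℝ) T, MemLp (ζ t) 2 P)
    (hcov : ∀ s ∈ Icc (0 : ℝ) T, ∀ t ∈ Icc (0 : ℝ) T,
      ∫ w, ζ s w * (starRingEnd ℂ) (ζ t w) ∂P = fbmCov H s t)
    {c : ℝ →₀ ℂ} (hc : ∀ s ∈ c.support, s ∈ Icc (0 : ℝ) T) {t : ℝ} (ht : t ∈ Icc (0 : ℝ) T) :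
    ∫ w, stepIntegral ζ c w * (starRingEnd ℂ) (ζ t w) ∂P =
      ∫ u in (0 : ℝ)..T, stepFunction c u * (fbmCovDensity H t u : ℂ) := by
  have hk : ∀ s ∈ c.support, IntervalIntegrable (fun u =>
      (Icc (0 : ℝ) s).indicator (fun _ => (1 : ℂ)) u * (fbmCovDensity H t u : ℂ)) volume 0 T := by
    intro s hs
    have h1 : IntervalIntegrable (fun u => (fbmCovDensity H t u : ℂ)) volume 0 T :=
      intervalIntegrable_complex_ofReal (intervalIntegrable_fbmCovDensity hH t 0 T)
    refine h1.mono_fun ?_ (Eventually.of_forall fun u => ?_)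
    · exact ((measurable_const.indicator measurableSet_Icc).aestronglyMeasurable).mul
        (by rw [uIoc_of_le hT.le]; exact h1.1.aestronglyMeasurable)
    · simp only [norm_mul]
      refine mul_le_of_le_one_left (norm_nonneg _) ?_
      refine (norm_indicator_le_norm_self _ _).trans ?_
      simp
  have hint : ∀ s ∈ c.support, ∫ u in (0 : ℝ)..T,
      (Icc (0 : ℝ) s).indicator (fun _ => (1 : ℂ)) u * (fbmCovDensity H t u : ℂ) =
        fbmCov H s t := by
    intro s hs
    have hs' := hc s hs
    have e : ∀ u, (Icc (0 : ℝ) s).indicator (fun _ => (1 : ℂ)) u * (fbmCovDensity H t u : ℂ) =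
        (Icc (0 : ℝ) s).indicator (fun u => (fbmCovDensity H t u : ℂ)) u := by
      intro u
      by_cases hu : u ∈ Icc (0 : ℝ) s
      · rw [indicator_of_mem hu, indicator_of_mem hu, one_mul]
      · rw [indicator_of_notMem hu, indicator_of_notMem hu, zero_mul]
    simp_rw [e]
    rw [intervalIntegral.integral_of_le hT.le, ← integral_Icc_eq_integral_Ioc,
      setIntegral_indicator measurableSet_Icc, inter_eq_self_of_subset_right
      (Icc_subset_Icc_right hs'.2), integral_Icc_eq_integral_Ioc,
      ← intervalIntegral.integral_of_le hs'.1, intervalIntegral.integral_ofReal,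
      integral_fbmCovDensity hH]
  have el : ∀ w, stepIntegral ζ c w * (starRingEnd ℂ) (ζ t w) =
      ∑ s ∈ c.support, c s * (ζ s w * (starRingEnd ℂ) (ζ t w)) := by
    intro w
    simp only [stepIntegral, Finsupp.sum, Finset.sum_mul, mul_assoc]
  have er : ∀ u, stepFunction c u * (fbmCovDensity H t u : ℂ) = ∑ s ∈ c.support, c s *
      ((Icc (0 : ℝ) s).indicator (fun _ => (1 : ℂ)) u * (fbmCovDensity H t u : ℂ)) := by
    intro u
    simp only [stepFunction, Finsupp.sum, Finset.sum_mul, mul_assoc]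
  simp_rw [el, er]
  have hprod : ∀ s ∈ c.support,
      Integrable (fun w => c s * (ζ s w * (starRingEnd ℂ) (ζ t w))) P := fun s hs =>
    ((hL2 s (hc s hs)).integrable_mul (hL2 t ht).star).const_mul _
  rw [integral_finsetSum _ hprod,
    intervalIntegral.integral_finsetSum fun s hs => (hk s hs).const_mul _]
  refine Finset.sum_congr rfl fun s hs => ?_
  rw [integral_const_mul, intervalIntegral.integral_const_mul, hint s hs, hcov s (hc s hs) t ht]

/-- The integral of step functions is closable: if step functions tend to `0` uniformly and their
integrals converge in `L²`, then the limit is `0`. It is orthogonal to all `ζ t`, while it lies in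
their closed span. -/
lemma ae_eq_zero_of_tendsto_stepIntegral (hH : 0 < H) (hT : 0 < T)
    (hL2 : ∀ t ∈ Icc (0 : ℝ) T, MemLp (ζ t) 2 P)
    (hcov : ∀ s ∈ Icc (0 : ℝ) T, ∀ t ∈ Icc (0 : ℝ) T,
      ∫ w, ζ s w * (starRingEnd ℂ) (ζ t w) ∂P = fbmCov H s t)
    {c : ℕ → ℝ →₀ ℂ} (hc : ∀ n, ∀ s ∈ (c n).support, s ∈ Icc (0 : ℝ) T)
    (hunif : TendstoUniformlyOn (fun n => stepFunction (c n)) 0 atTop (Icc (0 : ℝ) T))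
    {Y : Ω → ℂ} (hY : MemLp Y 2 P)
    (hlim : Tendsto (fun n => eLpNorm (fun w => stepIntegral ζ (c n) w - Y w) 2 P) atTop (𝓝 0)) :
    Y =ᵐ[P] 0 := by
  have hmem := fun n => memLp_stepIntegral hL2 (hc n)
  have horth : ∀ t ∈ Icc (0 : ℝ) T, ∫ w, Y w * (starRingEnd ℂ) (ζ t w) ∂P = 0 := by
    intro t ht
    have h1 := tendsto_integral_mul_of_eLpNorm hmem hY (hL2 t ht).star hlim
    have h2 : Tendsto (fun n => ∫ u in (0 : ℝ)..T, stepFunction (c n) u * (fbmCovDensity H t u : ℂ))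
        atTop (𝓝 (∫ u in (0 : ℝ)..T, (0 : ℂ))) := by
      have hk := intervalIntegrable_fbmCovDensity hH t 0 T
      have hb : ∀ᶠ n in atTop, ∀ u ∈ Icc (0 : ℝ) T, ‖stepFunction (c n) u‖ ≤ 1 := by
        filter_upwards [Metric.tendstoUniformlyOn_iff.1 hunif 1 one_pos] with n hn u hu
        have := hn u hu
        simp only [Pi.zero_apply, dist_zero_left] at this
        exact this.le
      refine intervalIntegral.tendsto_integral_filter_of_dominated_convergence
        (fun u => ‖fbmCovDensity H t u‖) ?_ ?_ hk.norm ?_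
      · exact Eventually.of_forall fun n => (measurable_stepFunction _).aestronglyMeasurable.mul
          (by rw [uIoc_of_le hT.le]; exact hk.1.ofReal.aestronglyMeasurable)
      · filter_upwards [hb] with n hn
        refine Eventually.of_forall fun u hu => ?_
        rw [uIoc_of_le hT.le] at hu
        rw [norm_mul, Complex.norm_real]
        exact mul_le_of_le_one_left (norm_nonneg _) (hn u (Ioc_subset_Icc_self hu))
      · refine Eventually.of_forall fun u hu => ?_
        rw [uIoc_of_le hT.le] at hu
        have := (hunif.tendsto_at (Ioc_subset_Icc_self hu)).mul_const (fbmCovDensity H t u : ℂ)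
        simpa using this
    rw [intervalIntegral.integral_zero] at h2
    refine tendsto_nhds_unique h1 (h2.congr fun n => ?_)
    exact (integral_stepIntegral_mul_conj hH hT hL2 hcov (hc n) ht).symm
  have hz : ∀ n, ∫ w, stepIntegral ζ (c n) w * (starRingEnd ℂ) (Y w) ∂P = 0 := by
    intro n
    have e : ∀ w, stepIntegral ζ (c n) w * (starRingEnd ℂ) (Y w) =
        ∑ s ∈ (c n).support, c n s * (ζ s w * (starRingEnd ℂ) (Y w)) := by
      intro w
      simp only [stepIntegral, Finsupp.sum, Finset.sum_mul, mul_assoc]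
    simp_rw [e]
    have hprod : ∀ s ∈ (c n).support,
        Integrable (fun w => c n s * (ζ s w * (starRingEnd ℂ) (Y w))) P := fun s hs =>
      ((hL2 s (hc n s hs)).integrable_mul hY.star).const_mul _
    rw [integral_finsetSum _ hprod]
    refine Finset.sum_eq_zero fun s hs => ?_
    have h3 := congrArg (starRingEnd ℂ) (horth s (hc n s hs))
    rw [← integral_conj, map_zero] at h3
    rw [integral_const_mul]
    simp only [map_mul, Complex.conj_conj] at h3
    simp_rw [mul_comm (ζ s _)]
    rw [h3, mul_zero]
  have hself := tendsto_integral_mul_of_eLpNorm hmem hY hY.star hlim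
  have hself0 : ∫ w, Y w * (starRingEnd ℂ) (Y w) ∂P = 0 :=
    tendsto_nhds_unique hself ((tendsto_const_nhds (x := (0 : ℂ))).congr fun n => (hz n).symm)
  exact ae_eq_zero_of_integral_mul_conj_eq_zero hY hself0

/-- The Wiener integral of a function is unique up to almost sure equality. -/
lemma IsWienerIntegral.ae_eq (hH : 0 < H) (hT : 0 < T)
    (hL2 : ∀ t ∈ Icc (0 : ℝ) T, MemLp (ζ t) 2 P)
    (hcov : ∀ s ∈ Icc (0 : ℝ) T, ∀ t ∈ Icc (0 : ℝ) T,
      ∫ w, ζ s w * (starRingEnd ℂ) (ζ t w) ∂P = fbmCov H s t)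
    {f : ℝ → ℂ} {X Y : Ω → ℂ} (hX : IsWienerIntegral P T ζ f X)
    (hY : IsWienerIntegral P T ζ f Y) : X =ᵐ[P] Y := by
  obtain ⟨hX2, c, hc, hcu, hcl⟩ := hX
  obtain ⟨hY2, d, hd, hdu, hdl⟩ := hY
  have hcd : ∀ n, ∀ s ∈ (c n - d n).support, s ∈ Icc (0 : ℝ) T := by
    classical
    intro n s hs
    rcases Finset.mem_union.1 (Finsupp.support_sub hs) with h | h
    · exact hc n s h
    · exact hd n s h
  have h := ae_eq_zero_of_tendsto_stepIntegral hH hT hL2 hcov hcd ?_ (hX2.sub hY2) ?_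
  · filter_upwards [h] with w hw
    simpa [sub_eq_zero] using hw
  · have h1 : TendstoUniformlyOn (fun n u => stepFunction (c n) u - stepFunction (d n) u)
        (fun u => f u - f u) atTop (Icc (0 : ℝ) T) := hcu.sub hdu
    refine (h1.congr (Eventually.of_forall fun n u _ => (stepFunction_sub _ _ u).symm)).congr_right
      fun u _ => sub_self _
  · have h2 := hcl.add hdl
    rw [add_zero] at h2
    refine tendsto_of_tendsto_of_tendsto_of_le_of_le tendsto_const_nhds h2 (fun _ => zero_le) ?_
    intro n
    have e : (fun w => stepIntegral ζ (c n - d n) w - (X - Y) w) =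
        (fun w => stepIntegral ζ (c n) w - X w) - fun w => stepIntegral ζ (d n) w - Y w := by
      funext w
      simp only [stepIntegral_sub, Pi.sub_apply]; ring
    simp only [e]
    exact eLpNorm_sub_le ((memLp_stepIntegral hL2 (hc n)).1.sub hX2.1)
      ((memLp_stepIntegral hL2 (hd n)).1.sub hY2.1) (by norm_num)

end WienerIntegral

/-! ### The pathwise integral -/

lemma hasDerivAt_ofReal_cpow_of_pos {x : ℝ} (hx : 0 < x) (c : ℂ) :
    HasDerivAt (fun y : ℝ => (y : ℂ) ^ c) (c * (x : ℂ) ^ (c - 1)) x := by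
  have h := (hasDerivAt_id (x : ℂ)).cpow_const (c := c) (Or.inl (by simpa using hx))
  simpa using h.comp_ofReal

lemma continuousOn_ofReal_cpow (c : ℂ) : ContinuousOn (fun y : ℝ => (y : ℂ) ^ c) (Ioi 0) :=
  fun _ hx => (hasDerivAt_ofReal_cpow_of_pos hx c).continuousAt.continuousWithinAt

/-- The increment `z (T - v) - z T` of a path, read backwards from the time `T`. -/
noncomputable def revIncrement (T : ℝ) (z : ℝ → ℂ) (v : ℝ) : ℂ := z (T - v) - z T

/-- The value of `∫_0^{T-r} (T - u)^{-α} dz_u` after an integration by parts, in terms of the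
reversed increments of the path `z`. For `r = 0` the first summand vanishes, as `0 ^ (-α) = 0`, and
the integral converges as soon as `z` is Hölder continuous of an order above `re α`. -/
noncomputable def pathIntegral (T : ℝ) (α : ℂ) (z : ℝ → ℂ) (r : ℝ) : ℂ :=
  (r : ℂ) ^ (-α) * revIncrement T z r -
    α * (∫ v in r..T, (v : ℂ) ^ (-α - 1) * revIncrement T z v) + (T : ℂ) ^ (-α) * z T

lemma continuous_revIncrement (T : ℝ) {z : ℝ → ℂ} (hz : Continuous z) :
    Continuous (revIncrement T z) := by
  unfold revIncrement; fun_prop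

section Holder

variable {T M γ : ℝ} {α : ℂ} {z : ℝ → ℂ}

lemma norm_revIncrement_le (hT : 0 < T)
    (hH : ∀ s ∈ Icc (0 : ℝ) T, ∀ t ∈ Icc (0 : ℝ) T, ‖z t - z s‖ ≤ M * |t - s| ^ γ)
    {v : ℝ} (hv : v ∈ Icc (0 : ℝ) T) : ‖revIncrement T z v‖ ≤ M * v ^ γ := by
  have := hH T ⟨hT.le, le_rfl⟩ (T - v) ⟨by linarith [hv.2], by linarith [hv.1]⟩
  rwa [show T - v - T = -v by ring, abs_neg, abs_of_nonneg hv.1] at this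

lemma norm_cpow_mul_revIncrement_le (hT : 0 < T)
    (hH : ∀ s ∈ Icc (0 : ℝ) T, ∀ t ∈ Icc (0 : ℝ) T, ‖z t - z s‖ ≤ M * |t - s| ^ γ)
    {v : ℝ} (hv : v ∈ Ioc (0 : ℝ) T) (c : ℂ) :
    ‖(v : ℂ) ^ c * revIncrement T z v‖ ≤ M * v ^ (γ + c.re) := by
  rw [norm_mul, Complex.norm_cpow_eq_rpow_re_of_pos hv.1]
  calc v ^ c.re * ‖revIncrement T z v‖ ≤ v ^ c.re * (M * v ^ γ) := by
        gcongr
        · exact Real.rpow_nonneg hv.1.le _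
        · exact norm_revIncrement_le hT hH (Ioc_subset_Icc_self hv)
    _ = _ := by rw [Real.rpow_add hv.1]; ring

lemma intervalIntegrable_cpow_mul_revIncrement (hT : 0 < T) (hz : Continuous z)
    (hH : ∀ s ∈ Icc (0 : ℝ) T, ∀ t ∈ Icc (0 : ℝ) T, ‖z t - z s‖ ≤ M * |t - s| ^ γ)
    (hα : α.re < γ) {a b : ℝ} (ha : a ∈ Icc (0 : ℝ) T) (hb : b ∈ Icc (0 : ℝ) T) :
    IntervalIntegrable (fun v : ℝ => (v : ℂ) ^ (-α - 1) * revIncrement T z v) volume a b := by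
  have h0 : IntervalIntegrable (fun v : ℝ => (v : ℂ) ^ (-α - 1) * revIncrement T z v)
      volume 0 T := by
    have h1 : IntervalIntegrable (fun v : ℝ => M * v ^ (γ + (-α - 1).re)) volume 0 T := by
      apply IntervalIntegrable.const_mul
      apply intervalIntegral.intervalIntegrable_rpow'
      simp; linarith
    refine h1.mono_fun' ?_ ?_
    · rw [uIoc_of_le hT.le]
      refine ContinuousOn.aestronglyMeasurable ?_ measurableSet_Ioc
      exact ((continuousOn_ofReal_cpow _).mono fun x hx => hx.1).mul
        (continuous_revIncrement T hz).continuousOn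
    · rw [uIoc_of_le hT.le]
      exact (ae_restrict_iff' measurableSet_Ioc).2 (Eventually.of_forall fun v hv =>
        norm_cpow_mul_revIncrement_le hT hH hv _)
  refine h0.mono_set ?_
  rw [uIcc_of_le hT.le]
  exact uIcc_subset_Icc ha hb

lemma sub_rpow_le_rpow_sub {a b δ : ℝ} (ha : 0 ≤ a) (hab : a ≤ b) (hδ : 0 ≤ δ) (hδ1 : δ ≤ 1) :
    b ^ δ - a ^ δ ≤ (b - a) ^ δ := by
  have := Real.rpow_add_le_add_rpow ha (sub_nonneg.2 hab) hδ hδ1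
  rw [add_sub_cancel] at this
  linarith

lemma norm_integral_cpow_mul_revIncrement_le (hT : 0 < T)
    (hH : ∀ s ∈ Icc (0 : ℝ) T, ∀ t ∈ Icc (0 : ℝ) T, ‖z t - z s‖ ≤ M * |t - s| ^ γ) (hM : 0 ≤ M)
    (hα0 : 0 ≤ α.re) (hα : α.re < γ) (hγ1 : γ ≤ 1) {a b : ℝ} (ha : 0 ≤ a) (hab : a ≤ b)
    (hb : b ≤ T) :
    ‖∫ v in a..b, (v : ℂ) ^ (-α - 1) * revIncrement T z v‖ ≤
      M * (b - a) ^ (γ - α.re) / (γ - α.re) := by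
  have hδ : 0 < γ - α.re := sub_pos.2 hα
  have h1 : ‖∫ v in a..b, (v : ℂ) ^ (-α - 1) * revIncrement T z v‖ ≤
      ∫ v in a..b, M * v ^ (γ - α.re - 1) := by
    refine intervalIntegral.norm_integral_le_of_norm_le hab ?_ ?_
    · refine Eventually.of_forall fun v hv => ?_
      have := norm_cpow_mul_revIncrement_le hT hH (v := v) ⟨ha.trans_lt hv.1, hv.2.trans hb⟩
        (-α - 1)
      refine this.trans (le_of_eq ?_)
      congr 2
      simp; ring
    · apply IntervalIntegrable.const_mul
      apply intervalIntegral.intervalIntegrable_rpow'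
      linarith
  refine h1.trans ?_
  rw [intervalIntegral.integral_const_mul, integral_rpow (Or.inl (by linarith)), sub_add_cancel,
    mul_div_assoc]
  gcongr
  exact sub_rpow_le_rpow_sub ha hab hδ.le (by linarith)

/-- The boundary term of the integration by parts is Hölder continuous of order `γ - re α`. -/
lemma norm_cpow_mul_revIncrement_sub_le (hT : 0 < T)
    (hH : ∀ s ∈ Icc (0 : ℝ) T, ∀ t ∈ Icc (0 : ℝ) T, ‖z t - z s‖ ≤ M * |t - s| ^ γ) (hM : 0 ≤ M)
    (hα0 : 0 < α.re) (hα : α.re < γ) (hγ1 : γ ≤ 1) {a b : ℝ} (ha : 0 ≤ a) (hab : a < b)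
    (hb : b ≤ T) :
    ‖(a : ℂ) ^ (-α) * revIncrement T z a - (b : ℂ) ^ (-α) * revIncrement T z b‖ ≤
      (3 + 2 * ‖α‖) * M * (b - a) ^ (γ - α.re) := by
  set h := b - a with hh
  have h0 : 0 < h := sub_pos.2 hab
  set δ := γ - α.re with hδd
  have hδ : 0 < δ := sub_pos.2 hα
  have hδ1 : δ ≤ 1 := by linarith
  have hb0 : 0 < b := ha.trans_lt hab
  have hterm : ∀ x, 0 < x → x ≤ T → ‖(x : ℂ) ^ (-α) * revIncrement T z x‖ ≤ M * x ^ δ := by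
    intro x hx hxT
    have := norm_cpow_mul_revIncrement_le hT hH ⟨hx, hxT⟩ (-α)
    simpa [hδd, sub_eq_add_neg] using this
  have h2 : (2 : ℝ) ^ δ ≤ 2 := by
    calc (2 : ℝ) ^ δ ≤ 2 ^ (1 : ℝ) := Real.rpow_le_rpow_of_exponent_le (by norm_num) hδ1
      _ = 2 := Real.rpow_one 2
  have hhδ : 0 ≤ h ^ δ := by positivity
  -- near the singularity the two terms are estimated separately, away from it by their difference
  rcases le_or_gt a h with hah | hah
  · have e1 : ‖(a : ℂ) ^ (-α) * revIncrement T z a‖ ≤ M * h ^ δ := by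
      rcases ha.eq_or_lt with rfl | ha0
      · have : α ≠ 0 := by rintro rfl; simp at hα0
        rw [Complex.ofReal_zero, Complex.zero_cpow (neg_ne_zero.2 this), zero_mul, norm_zero]
        positivity
      · refine (hterm a ha0 (by linarith)).trans ?_
        gcongr
    have e2 : ‖(b : ℂ) ^ (-α) * revIncrement T z b‖ ≤ M * (2 * h ^ δ) := by
      refine (hterm b hb0 hb).trans ?_
      gcongr
      calc b ^ δ ≤ (2 * h) ^ δ := by gcongr; linarith
        _ = 2 ^ δ * h ^ δ := Real.mul_rpow (by norm_num) h0.le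
        _ ≤ 2 * h ^ δ := by gcongr
    calc _ ≤ M * h ^ δ + M * (2 * h ^ δ) := (norm_sub_le _ _).trans (add_le_add e1 e2)
      _ = 3 * M * h ^ δ := by ring
      _ ≤ _ := by
        gcongr
        have := norm_nonneg α
        linarith
  · have ha0 : 0 < a := h0.trans hah
    have e : (a : ℂ) ^ (-α) * revIncrement T z a - (b : ℂ) ^ (-α) * revIncrement T z b =
        (a : ℂ) ^ (-α) * (revIncrement T z a - revIncrement T z b) +
        ((a : ℂ) ^ (-α) - (b : ℂ) ^ (-α)) * revIncrement T z b := by ring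
    have e1 : ‖(a : ℂ) ^ (-α) * (revIncrement T z a - revIncrement T z b)‖ ≤ M * h ^ δ := by
      have h3 : ‖revIncrement T z a - revIncrement T z b‖ ≤ M * h ^ γ := by
        have := hH (T - b) ⟨by linarith, by linarith⟩ (T - a) ⟨by linarith, by linarith⟩
        rw [show T - a - (T - b) = h by rw [hh]; ring, abs_of_pos h0] at this
        simpa [revIncrement] using this
      rw [norm_mul, Complex.norm_cpow_eq_rpow_re_of_pos ha0, Complex.neg_re]
      calc a ^ (-α.re) * _ ≤ h ^ (-α.re) * (M * h ^ γ) := by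
            apply mul_le_mul _ h3 (norm_nonneg _) (by positivity)
            exact Real.rpow_le_rpow_of_nonpos h0 hah.le (by linarith)
        _ = M * h ^ δ := by rw [hδd, sub_eq_add_neg, Real.rpow_add h0]; ring
    have e2 : ‖((a : ℂ) ^ (-α) - (b : ℂ) ^ (-α)) * revIncrement T z b‖ ≤
        2 * ‖α‖ * M * h ^ δ := by
      have h4 : ‖(b : ℂ) ^ (-α) - (a : ℂ) ^ (-α)‖ ≤ ‖α‖ * a ^ (-α.re - 1) * ‖b - a‖ := by
        refine (convex_Icc a b).norm_image_sub_le_of_norm_hasDerivWithin_le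
          (f := fun x : ℝ => (x : ℂ) ^ (-α)) (f' := fun x : ℝ => -α * (x : ℂ) ^ (-α - 1))
          (fun x hx => ((hasDerivAt_ofReal_cpow_of_pos (ha0.trans_le hx.1) _).hasDerivWithinAt))
          (fun x hx => ?_) (left_mem_Icc.2 hab.le) (right_mem_Icc.2 hab.le)
        rw [norm_mul, norm_neg, Complex.norm_cpow_eq_rpow_re_of_pos (ha0.trans_le hx.1)]
        gcongr
        simp only [Complex.sub_re, Complex.neg_re, Complex.one_re]
        exact Real.rpow_le_rpow_of_nonpos ha0 hx.1 (by linarith)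
      rw [Real.norm_eq_abs, ← hh, abs_of_pos h0] at h4
      have h5 : ‖revIncrement T z b‖ ≤ M * (2 * a ^ γ) := by
        refine (norm_revIncrement_le hT hH ⟨hb0.le, hb⟩).trans ?_
        gcongr
        calc b ^ γ ≤ (2 * a) ^ γ := by
              apply Real.rpow_le_rpow hb0.le (by linarith) (by linarith)
          _ = 2 ^ γ * a ^ γ := Real.mul_rpow (by norm_num) ha
          _ ≤ 2 ^ (1 : ℝ) * a ^ γ := by
              gcongr
              norm_num
          _ = 2 * a ^ γ := by rw [Real.rpow_one]
      rw [norm_mul, norm_sub_rev]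
      calc _ ≤ (‖α‖ * a ^ (-α.re - 1) * h) * (M * (2 * a ^ γ)) := by gcongr
        _ = 2 * ‖α‖ * M * (h * a ^ (δ - 1)) := by
            rw [show δ - 1 = (-α.re - 1) + γ by rw [hδd]; ring, Real.rpow_add ha0]; ring
        _ ≤ 2 * ‖α‖ * M * (h * h ^ (δ - 1)) := by
            gcongr 2 * ‖α‖ * M * (h * ?_)
            exact Real.rpow_le_rpow_of_nonpos h0 hah.le (by linarith)
        _ = 2 * ‖α‖ * M * h ^ δ := by
            rw [Real.rpow_sub_one h0.ne']; field_simp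
    rw [e]
    calc _ ≤ M * h ^ δ + 2 * ‖α‖ * M * h ^ δ := (norm_add_le _ _).trans (add_le_add e1 e2)
      _ = (1 + 2 * ‖α‖) * M * h ^ δ := by ring
      _ ≤ _ := by gcongr; norm_num

/-- The pathwise integral loses `re α` of the Hölder exponent of the path, up to and including the
singular time `r = 0`. The Hölder constant is proportional to that of the path. -/
lemma norm_pathIntegral_sub_le (hT : 0 < T) (hz : Continuous z)
    (hH : ∀ s ∈ Icc (0 : ℝ) T, ∀ t ∈ Icc (0 : ℝ) T, ‖z t - z s‖ ≤ M * |t - s| ^ γ) (hM : 0 ≤ M)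
    (hα0 : 0 < α.re) (hα : α.re < γ) (hγ1 : γ ≤ 1) {a b : ℝ} (ha : a ∈ Icc (0 : ℝ) T)
    (hb : b ∈ Icc (0 : ℝ) T) :
    ‖pathIntegral T α z a - pathIntegral T α z b‖ ≤
      (3 + 2 * ‖α‖ + ‖α‖ / (γ - α.re)) * M * |a - b| ^ (γ - α.re) := by
  have hδ : 0 < γ - α.re := sub_pos.2 hα
  wlog hab : a ≤ b generalizing a b with hw
  · rw [norm_sub_rev, abs_sub_comm]
    exact hw hb ha (le_of_not_ge hab)
  rcases hab.eq_or_lt with rfl | hlt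
  · rw [sub_self, sub_self, norm_zero, abs_zero, Real.zero_rpow hδ.ne', mul_zero]
  have hi : (∫ v in a..T, (v : ℂ) ^ (-α - 1) * revIncrement T z v) =
      (∫ v in a..b, (v : ℂ) ^ (-α - 1) * revIncrement T z v) +
      ∫ v in b..T, (v : ℂ) ^ (-α - 1) * revIncrement T z v :=
    (intervalIntegral.integral_add_adjacent_intervals
      (intervalIntegrable_cpow_mul_revIncrement hT hz hH hα ha hb)
      (intervalIntegrable_cpow_mul_revIncrement hT hz hH hα hb ⟨hT.le, le_rfl⟩)).symm
  have e : pathIntegral T α z a - pathIntegral T α z b =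
      ((a : ℂ) ^ (-α) * revIncrement T z a - (b : ℂ) ^ (-α) * revIncrement T z b) -
      α * ∫ v in a..b, (v : ℂ) ^ (-α - 1) * revIncrement T z v := by
    simp only [pathIntegral]; rw [hi]; ring
  rw [e, abs_sub_comm, abs_of_pos (sub_pos.2 hlt)]
  refine (norm_sub_le _ _).trans ?_
  rw [norm_mul]
  calc _ ≤ (3 + 2 * ‖α‖) * M * (b - a) ^ (γ - α.re) +
        ‖α‖ * (M * (b - a) ^ (γ - α.re) / (γ - α.re)) := by
        gcongr
        · exact norm_cpow_mul_revIncrement_sub_le hT hH hM hα0 hα hγ1 ha.1 hlt hb.2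
        · exact norm_integral_cpow_mul_revIncrement_le hT hH hM hα0.le hα hγ1 ha.1 hab hb.2
    _ = _ := by ring

lemma continuousOn_pathIntegral (hT : 0 < T) (hz : Continuous z)
    (hH : ∀ s ∈ Icc (0 : ℝ) T, ∀ t ∈ Icc (0 : ℝ) T, ‖z t - z s‖ ≤ M * |t - s| ^ γ) (hM : 0 ≤ M)
    (hα0 : 0 < α.re) (hα : α.re < γ) (hγ1 : γ ≤ 1) :
    ContinuousOn (pathIntegral T α z) (Icc (0 : ℝ) T) := by
  have hδ : 0 < γ - α.re := sub_pos.2 hα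
  intro b hb
  rw [ContinuousWithinAt, tendsto_iff_norm_sub_tendsto_zero]
  have hlim : Tendsto (fun a => (3 + 2 * ‖α‖ + ‖α‖ / (γ - α.re)) * M * |a - b| ^ (γ - α.re))
      (𝓝[Icc (0 : ℝ) T] b) (𝓝 0) := by
    have h1 : ContinuousAt
        (fun a => (3 + 2 * ‖α‖ + ‖α‖ / (γ - α.re)) * M * |a - b| ^ (γ - α.re)) b := by
      refine ContinuousAt.mul continuousAt_const (ContinuousAt.rpow_const ?_ (Or.inr hδ.le))
      fun_prop
    have h2 := h1.tendsto
    rw [sub_self, abs_zero, Real.zero_rpow hδ.ne', mul_zero] at h2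
    exact h2.mono_left nhdsWithin_le_nhds
  refine squeeze_zero' (Eventually.of_forall fun _ => norm_nonneg _) ?_ hlim
  filter_upwards [self_mem_nhdsWithin] with a ha
  exact norm_pathIntegral_sub_le hT hz hH hM hα0 hα hγ1 ha hb

end Holder

section Equation

variable {T : ℝ} {α : ℂ} {z : ℝ → ℂ}

/-- Before the terminal time, the pathwise integral is obtained from an integration by parts. -/
lemma pathIntegral_eq (hα0 : α ≠ 0) (hz : Continuous z) {t : ℝ} (ht : t ∈ Ico (0 : ℝ) T) :
    pathIntegral T α z (T - t) = ((T - t : ℝ) : ℂ) ^ (-α) * z t -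
      ∫ u in (0 : ℝ)..t, α * ((T - u : ℝ) : ℂ) ^ (-α - 1) * z u := by
  have hr : 0 < T - t := sub_pos.2 ht.2
  have hT : T - t ≤ T := by linarith [ht.1]
  have hsub : uIcc (T - t) T ⊆ Ioi 0 := by
    rw [uIcc_of_le hT]; exact fun x hx => hr.trans_le hx.1
  have h1 : (∫ u in (0 : ℝ)..t, α * ((T - u : ℝ) : ℂ) ^ (-α - 1) * z u) =
      ∫ v in (T - t)..T, α * (v : ℂ) ^ (-α - 1) * z (T - v) := by
    have := intervalIntegral.integral_comp_sub_left (a := 0) (b := t)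
      (fun v : ℝ => α * (v : ℂ) ^ (-α - 1) * z (T - v)) T
    rw [sub_zero] at this
    rw [← this]
    simp only [sub_sub_cancel]
  have i1 : IntervalIntegrable (fun v : ℝ => (v : ℂ) ^ (-α - 1) * revIncrement T z v) volume
      (T - t) T :=
    (((continuousOn_ofReal_cpow _).mono hsub).mul
      (continuous_revIncrement T hz).continuousOn).intervalIntegrable
  have i2 : IntervalIntegrable (fun v : ℝ => (v : ℂ) ^ (-α - 1)) volume (T - t) T :=
    ((continuousOn_ofReal_cpow _).mono hsub).intervalIntegrable
  have h2 : (∫ v in (T - t)..T, α * (v : ℂ) ^ (-α - 1) * z (T - v)) =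
      α * (∫ v in (T - t)..T, (v : ℂ) ^ (-α - 1) * revIncrement T z v) +
      (α * z T) * ∫ v in (T - t)..T, (v : ℂ) ^ (-α - 1) := by
    rw [← intervalIntegral.integral_const_mul, ← intervalIntegral.integral_const_mul,
      ← intervalIntegral.integral_add (i1.const_mul _) (i2.const_mul _)]
    congr 1
    funext v
    simp only [revIncrement]; ring
  have h3 : (∫ v in (T - t)..T, (v : ℂ) ^ (-α - 1)) =
      ((T : ℂ) ^ (-α) - ((T - t : ℝ) : ℂ) ^ (-α)) / (-α) := by
    rw [integral_cpow]
    · rw [sub_add_cancel]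
    · refine Or.inr ⟨?_, fun h0 => lt_irrefl (0 : ℝ) (hsub h0)⟩
      intro h
      exact hα0 (by linear_combination -h)
  rw [h1, h2, h3]
  simp only [pathIntegral, revIncrement, sub_sub_cancel]
  field_simp
  ring

/-- The pathwise integral solves the bridge equation once multiplied by `(T - t) ^ α`: the
difference of the product and the path `z` is differentiable. -/
lemma cpow_mul_pathIntegral_eq {M γ : ℝ} (hT : 0 < T) (hz : Continuous z)
    (hH : ∀ s ∈ Icc (0 : ℝ) T, ∀ t ∈ Icc (0 : ℝ) T, ‖z t - z s‖ ≤ M * |t - s| ^ γ) (hM : 0 ≤ M)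
    (hα0 : 0 < α.re) (hα : α.re < γ) (hγ1 : γ ≤ 1) {t : ℝ} (ht : t ∈ Ico (0 : ℝ) T) :
    ((T - t : ℝ) : ℂ) ^ α * pathIntegral T α z (T - t) =
      -α * (∫ u in (0 : ℝ)..t,
        (((T - u : ℝ) : ℂ) ^ α * pathIntegral T α z (T - u)) / ((T - u : ℝ) : ℂ)) + z t := by
  set I : ℝ → ℂ := fun r => ∫ v in r..T, (v : ℂ) ^ (-α - 1) * revIncrement T z v with hI
  set E : ℝ → ℂ := fun r => -α * ((r : ℂ) ^ α * I r) + (r : ℂ) ^ α * ((T : ℂ) ^ (-α) * z T) - z T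
    with hE
  have hmulinv : ∀ r : ℝ, 0 < r → (r : ℂ) ^ α * (r : ℂ) ^ (-α) = 1 := fun r hr => by
    have hr' : (r : ℂ) ≠ 0 := by exact_mod_cast hr.ne'
    rw [← Complex.cpow_add _ _ hr', add_neg_cancel, Complex.cpow_zero]
  have hZ : ∀ r : ℝ, 0 < r → (r : ℂ) ^ α * pathIntegral T α z r =
      revIncrement T z r - α * ((r : ℂ) ^ α * I r) + (r : ℂ) ^ α * ((T : ℂ) ^ (-α) * z T) := by
    intro r hr
    simp only [pathIntegral]
    linear_combination (revIncrement T z r) * hmulinv r hr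
  have hderI : ∀ r : ℝ, 0 < r → HasDerivAt I (-((r : ℂ) ^ (-α - 1) * revIncrement T z r)) r := by
    intro r hr
    have hc : ContinuousOn (fun v : ℝ => (v : ℂ) ^ (-α - 1) * revIncrement T z v) (Ioi 0) :=
      (continuousOn_ofReal_cpow _).mul (continuous_revIncrement T hz).continuousOn
    refine intervalIntegral.integral_hasDerivAt_left ?_ ?_ (hc.continuousAt (Ioi_mem_nhds hr))
    · refine (hc.mono ?_).intervalIntegrable
      intro x hx
      exact (lt_min hr hT).trans_le hx.1
    · exact hc.stronglyMeasurableAtFilter isOpen_Ioi r hr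
  have hderE : ∀ r : ℝ, 0 < r →
      HasDerivAt E (α * (((r : ℂ) ^ α * pathIntegral T α z r) / (r : ℂ))) r := by
    intro r hr
    have hr' : (r : ℂ) ≠ 0 := by exact_mod_cast hr.ne'
    have h1 := hasDerivAt_ofReal_cpow_of_pos hr α
    have h2 := (((h1.mul (hderI r hr)).const_mul (-α)).add
      (h1.mul_const ((T : ℂ) ^ (-α) * z T))).sub_const (z T)
    refine h2.congr_deriv ?_
    rw [hZ r hr, Complex.cpow_sub _ _ hr', Complex.cpow_sub _ _ hr', Complex.cpow_one]
    field_simp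
    linear_combination (α * revIncrement T z r) * hmulinv r hr
  have hderD : ∀ u ∈ uIcc 0 t, HasDerivAt (fun u => E (T - u))
      (-(α * ((((T - u : ℝ) : ℂ) ^ α * pathIntegral T α z (T - u)) / ((T - u : ℝ) : ℂ)))) u := by
    intro u hu
    rw [uIcc_of_le ht.1] at hu
    exact (hderE (T - u) (by linarith [hu.2, ht.2])).comp_const_sub T u
  have hcont : ContinuousOn (fun u : ℝ =>
      -(α * ((((T - u : ℝ) : ℂ) ^ α * pathIntegral T α z (T - u)) / ((T - u : ℝ) : ℂ))))
      (uIcc 0 t) := by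
    rw [uIcc_of_le ht.1]
    have hsub : Continuous fun u : ℝ => T - u := by fun_prop
    have h1 : ContinuousOn (fun u : ℝ => ((T - u : ℝ) : ℂ) ^ α) (Icc 0 t) :=
      (continuousOn_ofReal_cpow α).comp hsub.continuousOn fun u hu => by
        have := hu.2; have := ht.2; simp only [mem_Ioi]; linarith
    have h2 : ContinuousOn (fun u : ℝ => pathIntegral T α z (T - u)) (Icc 0 t) :=
      (continuousOn_pathIntegral hT hz hH hM hα0 hα hγ1).comp hsub.continuousOn fun u hu =>
        ⟨by linarith [hu.2, ht.2], by linarith [hu.1]⟩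
    refine ((h1.mul h2).div (Complex.continuous_ofReal.comp hsub).continuousOn ?_).const_mul α |>.neg
    intro u hu
    have : T - u ≠ 0 := by have := hu.2; have := ht.2; intro h; linarith
    simpa using (by exact_mod_cast this : ((T - u : ℝ) : ℂ) ≠ 0)
  have hftc := intervalIntegral.integral_eq_sub_of_hasDerivAt hderD hcont.intervalIntegrable
  rw [intervalIntegral.integral_neg, intervalIntegral.integral_const_mul] at hftc
  have hr : 0 < T - t := sub_pos.2 ht.2
  have hET : E (T - 0) = 0 := by
    rw [sub_zero]
    simp only [hE, hI, intervalIntegral.integral_same]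
    linear_combination (z T) * hmulinv T hT
  have hEt : E (T - t) = ((T - t : ℝ) : ℂ) ^ α * pathIntegral T α z (T - t) - z t := by
    rw [hZ (T - t) hr]
    simp only [hE, revIncrement, sub_sub_cancel]
    ring
  rw [hET, hEt] at hftc
  linear_combination -hftc

/-- The homogeneous bridge equation has only the zero solution among the continuous functions: for a
solution `D`, the function `(T - t) ^ (-α) * D t` has derivative `0`. -/
lemma eq_zero_of_bridge_equation {D : ℝ → ℂ} (hD : ContinuousOn D (Ico (0 : ℝ) T))
    (hDeq : ∀ t ∈ Ico (0 : ℝ) T, D t = -α * ∫ u in (0 : ℝ)..t, D u / ((T - u : ℝ) : ℂ))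
    {t : ℝ} (ht : t ∈ Ico (0 : ℝ) T) : D t = 0 := by
  have hsub : Continuous fun u : ℝ => T - u := by fun_prop
  have hpos : ∀ u ∈ Ico (0 : ℝ) T, 0 < T - u := fun u hu => sub_pos.2 hu.2
  have hne : ∀ u ∈ Ico (0 : ℝ) T, ((T - u : ℝ) : ℂ) ≠ 0 := fun u hu => by
    exact_mod_cast (hpos u hu).ne'
  have hq : ContinuousOn (fun u => D u / ((T - u : ℝ) : ℂ)) (Ico (0 : ℝ) T) :=
    hD.div (Complex.continuous_ofReal.comp hsub).continuousOn hne
  have hder : ∀ x ∈ Ioo (0 : ℝ) t, HasDerivAt (fun u => ((T - u : ℝ) : ℂ) ^ (-α) * D u) 0 x := by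
    intro x hx
    have hxT : x ∈ Ioo (0 : ℝ) T := ⟨hx.1, hx.2.trans ht.2⟩
    have hx' := Ioo_subset_Ico_self hxT
    have h1 : HasDerivAt (fun s => ∫ u in (0 : ℝ)..s, D u / ((T - u : ℝ) : ℂ))
        (D x / ((T - x : ℝ) : ℂ)) x := by
      refine intervalIntegral.integral_hasDerivAt_right ?_ ?_ ?_
      · refine (hq.mono ?_).intervalIntegrable
        rw [uIcc_of_le hx.1.le]
        exact fun y hy => ⟨hy.1, hy.2.trans_lt hxT.2⟩
      · exact (hq.mono Ioo_subset_Ico_self).stronglyMeasurableAtFilter isOpen_Ioo x hxT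
      · exact (hq.mono Ioo_subset_Ico_self).continuousAt (Ioo_mem_nhds hxT.1 hxT.2)
    have h2 : HasDerivAt D (-α * (D x / ((T - x : ℝ) : ℂ))) x := by
      refine (h1.const_mul (-α)).congr_of_eventuallyEq ?_
      filter_upwards [Ioo_mem_nhds hxT.1 hxT.2] with s hs
      exact hDeq s (Ioo_subset_Ico_self hs)
    have h3 := (hasDerivAt_ofReal_cpow_of_pos (hpos x hx') (-α)).comp_const_sub T x
    refine (h3.mul h2).congr_deriv ?_
    rw [Complex.cpow_sub _ _ (hne x hx'), Complex.cpow_one]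
    have := hne x hx'
    field_simp
    ring
  have hc : ContinuousOn (fun u => ((T - u : ℝ) : ℂ) ^ (-α) * D u) (Icc 0 t) := by
    have hs : Icc 0 t ⊆ Ico 0 T := fun u hu => ⟨hu.1, hu.2.trans_lt ht.2⟩
    exact ((continuousOn_ofReal_cpow (-α)).comp hsub.continuousOn
      fun u hu => hpos u (hs hu)).mul (hD.mono hs)
  have h4 := integral_eq_of_hasDerivAt_off_countable_of_le _ (fun _ => (0 : ℂ)) ht.1
    Set.countable_empty hc (fun x hx => hder x hx.1) (by simp)
  have hD0 : D 0 = 0 := by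
    have := hDeq 0 ⟨le_rfl, ht.1.trans_lt ht.2⟩
    simpa using this
  rw [intervalIntegral.integral_zero, hD0, mul_zero, sub_zero] at h4
  rcases mul_eq_zero.1 h4.symm with h | h
  · exact absurd ((Complex.cpow_eq_zero_iff _ _).1 h).1 (hne t ht)
  · exact h

end Equation

/-! ### Wiener integrals as pathwise integrals -/

lemma tendsto_eLpNorm_zero_of_le_mul {Ω ι : Type*} [MeasurableSpace Ω] {P : Measure Ω}
    {X : ι → Ω → ℂ} {M : Ω → ℝ} {ε : ι → ℝ} {l : Filter ι} (hM : MemLp M 2 P)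
    (hX : ∀ᶠ i in l, ∀ᵐ w ∂P, ‖X i w‖ ≤ ε i * M w) (hε : Tendsto ε l (𝓝 0)) :
    Tendsto (fun i => eLpNorm (X i) 2 P) l (𝓝 0) := by
  have h1 : Tendsto (fun i => ‖ε i‖ₑ * eLpNorm M 2 P) l (𝓝 0) := by
    have h2 : Tendsto (fun i => ‖ε i‖ₑ) l (𝓝 0) := by simpa using hε.enorm
    simpa using ENNReal.Tendsto.mul_const h2 (Or.inr hM.2.ne)
  refine tendsto_of_tendsto_of_tendsto_of_le_of_le' tendsto_const_nhds h1
    (Eventually.of_forall fun _ => zero_le) ?_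
  filter_upwards [hX] with i hi
  rw [← eLpNorm_const_smul]
  exact eLpNorm_mono_ae (hi.mono fun w hw => hw.trans (by
    simp only [Pi.smul_apply, smul_eq_mul]; exact le_abs_self _))

lemma measurable_pathIntegral {Ω : Type*} [MeasurableSpace Ω] {z : ℝ → Ω → ℂ}
    (hm : ∀ t, Measurable (z t)) (hc : ∀ w, Continuous fun t => z t w) (T : ℝ) (α : ℂ) (r : ℝ) :
    Measurable fun w => pathIntegral T α (fun t => z t w) r := by
  have hj : Measurable (Function.uncurry z) := measurable_uncurry_of_continuous_of_measurable hc hm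
  have hF : Measurable fun p : Ω × ℝ =>
      (p.2 : ℂ) ^ (-α - 1) * revIncrement T (fun t => z t p.1) p.2 := by
    have h1 : Measurable fun p : Ω × ℝ => z (T - p.2) p.1 :=
      hj.comp ((measurable_const.sub measurable_snd).prodMk measurable_fst)
    have h2 : Measurable fun p : Ω × ℝ => z T p.1 := (hm T).comp measurable_fst
    have h3 : Measurable fun p : Ω × ℝ => (p.2 : ℂ) ^ (-α - 1) :=
      (Complex.measurable_ofReal.comp measurable_snd).pow_const _
    exact h3.mul (h1.sub h2)
  have hI : ∀ s : Set ℝ, Measurable fun w =>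
      ∫ v in s, (v : ℂ) ^ (-α - 1) * revIncrement T (fun t => z t w) v := fun s =>
    (hF.stronglyMeasurable.integral_prod_right' (ν := volume.restrict s)).measurable
  unfold pathIntegral
  refine ((measurable_const.mul ?_).sub (((hI _).sub (hI _)).const_mul α)).add ((hm T).const_mul _)
  exact (hm _).sub (hm _)

section Version

variable {Ω : Type*} [MeasurableSpace Ω] {P : Measure Ω} {H T : ℝ} {α : ℂ}
  {ζ z : ℝ → Ω → ℂ}

lemma IsHolderVersion.memLp (hz : IsHolderVersion P H T ζ z)
    (hL2 : ∀ t ∈ Icc (0 : ℝ) T, MemLp (ζ t) 2 P) {t : ℝ} (ht : t ∈ Icc (0 : ℝ) T) :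
    MemLp (z t) 2 P :=
  (memLp_congr_ae (hz.ae_eq.mono fun _ hw => (hw t ht))).2 (hL2 t ht)

/-- The pathwise integrals depend on the time in a Hölder continuous way, the Hölder constant being
a square integrable random variable. -/
lemma IsHolderVersion.exists_norm_pathIntegral_sub_le (hz : IsHolderVersion P H T ζ z)
    (hT : 0 < T) (hH1 : H ≤ 1) (hα0 : 0 < α.re) {δ : ℝ} (hδ : 0 < δ) (hδH : δ < H - α.re) :
    ∃ M : Ω → ℝ, MemLp M 2 P ∧ ∀ w, ∀ a ∈ Icc (0 : ℝ) T, ∀ b ∈ Icc (0 : ℝ) T,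
      ‖pathIntegral T α (fun t => z t w) a - pathIntegral T α (fun t => z t w) b‖ ≤
        M w * |a - b| ^ δ := by
  obtain ⟨M, hM2, hM0, hM⟩ := hz.holder (δ + α.re) ⟨by linarith, by linarith⟩
  refine ⟨fun w => (3 + 2 * ‖α‖ + ‖α‖ / δ) * M w, hM2.const_mul _, fun w a ha b hb => ?_⟩
  have := norm_pathIntegral_sub_le hT (hz.continuous w) (hM w) (hM0 w) hα0 (by linarith)
    (by linarith) ha hb
  simpa only [add_sub_cancel_right] using this

lemma IsHolderVersion.memLp_pathIntegral (hz : IsHolderVersion P H T ζ z)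
    (hL2 : ∀ t ∈ Icc (0 : ℝ) T, MemLp (ζ t) 2 P)
    (hT : 0 < T) (hH1 : H ≤ 1) (hα : α.re ∈ Ioo 0 H) {r : ℝ} (hr : r ∈ Icc (0 : ℝ) T) :
    MemLp (fun w => pathIntegral T α (fun t => z t w) r) 2 P := by
  have hδ : 0 < (H - α.re) / 2 := by linarith [hα.2]
  obtain ⟨M, hM2, hM⟩ := hz.exists_norm_pathIntegral_sub_le (α := α) hT hH1 hα.1 hδ
    (by linarith)
  have hTm : T ∈ Icc (0 : ℝ) T := ⟨hT.le, le_rfl⟩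
  have h1 : MemLp (fun w => pathIntegral T α (fun t => z t w) T) 2 P := by
    have : (fun w => pathIntegral T α (fun t => z t w) T) = fun w => (T : ℂ) ^ (-α) * z 0 w := by
      funext w
      simp only [pathIntegral, revIncrement, intervalIntegral.integral_same, sub_self]
      ring
    rw [this]
    exact (hz.memLp hL2 ⟨le_rfl, hT.le⟩).const_mul _
  have h2 : MemLp (fun w => pathIntegral T α (fun t => z t w) r -
      pathIntegral T α (fun t => z t w) T) 2 P := by
    refine (hM2.const_mul (|r - T| ^ ((H - α.re) / 2))).of_le
      ((measurable_pathIntegral hz.measurable hz.continuous T α r).sub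
        (measurable_pathIntegral hz.measurable hz.continuous T α T)).aestronglyMeasurable
      (Eventually.of_forall fun w => (hM w r hr T hTm).trans ?_)
    rw [mul_comm]
    exact le_abs_self _
  exact (memLp_congr_ae (Eventually.of_forall fun w => by simp)).1 (h2.add h1)

end Version

section StepApproximation

variable {T : ℝ} {α : ℂ}

/-- Coefficients of the step function that equals `f t * 𝟏_{[0,t]}` minus the increments of `f` over
the intervals `[k t / N, (k + 1) t / N]` times `𝟏_{[0, k t / N]}`; at `u ≤ t` it takes the value of
`f` at the next node. -/
noncomputable def stepApprox (f : ℝ → ℂ) (t : ℝ) (N : ℕ) : ℝ →₀ ℂ :=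
  Finsupp.single t (f t) - ∑ k ∈ Finset.range N,
    Finsupp.single (k * (t / N)) (f ((k + 1 : ℕ) * (t / N)) - f (k * (t / N)))

lemma sum_stepApprox (f : ℝ → ℂ) (t : ℝ) (N : ℕ) (φ : ℝ → ℂ) :
    (stepApprox f t N).sum (fun s a => a * φ s) = f t * φ t - ∑ k ∈ Finset.range N,
      (f ((k + 1 : ℕ) * (t / N)) - f (k * (t / N))) * φ (k * (t / N)) := by
  unfold stepApprox
  rw [Finsupp.sum_sub_index fun _ _ _ => sub_mul _ _ _, Finsupp.sum_single_index (zero_mul _),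
    ← Finsupp.sum_finsetSum_index (fun _ => zero_mul _) fun _ _ _ => add_mul _ _ _]
  congr 1
  exact Finset.sum_congr rfl fun k _ => Finsupp.sum_single_index (zero_mul _)

lemma node_mem {t : ℝ} (ht : 0 ≤ t) {N k : ℕ} (hk : k ≤ N) :
    (k : ℝ) * (t / N) ∈ Icc 0 t := by
  refine ⟨by positivity, ?_⟩
  rcases Nat.eq_zero_or_pos N with rfl | hN
  · simpa using ht
  · have h1 : (k : ℝ) ≤ N := by exact_mod_cast hk
    have h2 : (0 : ℝ) < N := by exact_mod_cast hN
    calc (k : ℝ) * (t / N) ≤ N * (t / N) := by gcongr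
      _ = t := by field_simp

lemma support_stepApprox (f : ℝ → ℂ) {t : ℝ} (ht : t ∈ Icc (0 : ℝ) T) (N : ℕ) :
    ∀ s ∈ (stepApprox f t N).support, s ∈ Icc (0 : ℝ) T := by
  classical
  intro s hs
  rcases Finset.mem_union.1 (Finsupp.support_sub hs) with h | h
  · rw [Finset.mem_singleton.1 (Finsupp.support_single_subset h)]; exact ht
  · obtain ⟨k, hk, hks⟩ := Finset.mem_biUnion.1 (Finsupp.support_finsetSum h)
    rw [Finset.mem_singleton.1 (Finsupp.support_single_subset hks)]
    have := node_mem ht.1 (Finset.mem_range.1 hk).le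
    exact ⟨this.1, this.2.trans ht.2⟩

/-- Riemann–Stieltjes sums: the integral of `stepApprox f t N` against a path `z` approximates
`f t * z t - ∫ f' z` when the oscillation of `z` over the intervals of the subdivision is small. -/
lemma norm_sum_stepApprox_sub_le {f f' z : ℝ → ℂ} {t C ω : ℝ} (ht : 0 ≤ t) {N : ℕ} (hN : 0 < N)
    (hf : ∀ u ∈ Icc 0 t, HasDerivAt f (f' u) u) (hfc : ContinuousOn f' (Icc 0 t))
    (hC : ∀ u ∈ Icc 0 t, ‖f' u‖ ≤ C) (hz : Continuous z)
    (hω : ∀ u ∈ Icc 0 t, ∀ v ∈ Icc 0 t, |u - v| ≤ t / N → ‖z u - z v‖ ≤ ω) :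
    ‖(stepApprox f t N).sum (fun s a => a * z s) - (f t * z t - ∫ u in (0 : ℝ)..t, f' u * z u)‖ ≤
      C * ω * t := by
  have hN' : (0 : ℝ) < N := by exact_mod_cast hN
  set u : ℕ → ℝ := fun k => (k : ℝ) * (t / N) with hu
  have hu0 : u 0 = 0 := by simp [hu]
  have huN : u N = t := by simp only [hu]; field_simp
  have hum : ∀ k, k ≤ N → u k ∈ Icc 0 t := fun k hk => node_mem ht hk
  have hule : ∀ k, u k ≤ u (k + 1) := fun k => by
    simp only [hu]; push_cast; nlinarith [div_nonneg ht hN'.le]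
  have hud : ∀ k, u (k + 1) - u k = t / N := fun k => by
    simp only [hu]; push_cast; ring
  have hsub : ∀ k, k < N → Icc (u k) (u (k + 1)) ⊆ Icc 0 t := fun k hk =>
    Icc_subset_Icc (hum k hk.le).1 (hum (k + 1) hk).2
  have hI : ∀ k, k < N → IntervalIntegrable (fun x => f' x * z x) volume (u k) (u (k + 1)) :=
    fun k hk => by
      refine ContinuousOn.intervalIntegrable ?_
      rw [uIcc_of_le (hule k)]
      exact (hfc.mono (hsub k hk)).mul hz.continuousOn
  have hI' : ∀ k, k < N → IntervalIntegrable f' volume (u k) (u (k + 1)) := fun k hk => by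
    refine ContinuousOn.intervalIntegrable ?_
    rw [uIcc_of_le (hule k)]
    exact hfc.mono (hsub k hk)
  have hsum : (∫ x in (0 : ℝ)..t, f' x * z x) =
      ∑ k ∈ Finset.range N, ∫ x in u k..u (k + 1), f' x * z x := by
    rw [intervalIntegral.sum_integral_adjacent_intervals hI, hu0, huN]
  have hfd : ∀ k, k < N → f (u (k + 1)) - f (u k) = ∫ x in u k..u (k + 1), f' x := fun k hk => by
    rw [intervalIntegral.integral_eq_sub_of_hasDerivAt _ (hI' k hk)]
    intro x hx
    rw [uIcc_of_le (hule k)] at hx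
    exact hf x (hsub k hk hx)
  have e : (stepApprox f t N).sum (fun s a => a * z s) -
      (f t * z t - ∫ x in (0 : ℝ)..t, f' x * z x) =
      ∑ k ∈ Finset.range N, ∫ x in u k..u (k + 1), f' x * (z x - z (u k)) := by
    rw [sum_stepApprox, hsum, sub_sub_sub_cancel_left, ← Finset.sum_sub_distrib]
    refine Finset.sum_congr rfl fun k hk => ?_
    have hk' := Finset.mem_range.1 hk
    have h1 := hfd k hk'
    simp only [hu] at h1 ⊢
    rw [h1, ← intervalIntegral.integral_mul_const, ← intervalIntegral.integral_sub (hI k hk')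
      ((hI' k hk').mul_const _)]
    simp only [hu, mul_sub]
  rw [e]
  have hterm : ∀ k ∈ Finset.range N,
      ‖∫ x in u k..u (k + 1), f' x * (z x - z (u k))‖ ≤ C * ω * (t / N) := by
    intro k hk
    have hk' := Finset.mem_range.1 hk
    have h2 : ‖∫ x in u k..u (k + 1), f' x * (z x - z (u k))‖ ≤ C * ω * |u (k + 1) - u k| := by
      refine intervalIntegral.norm_integral_le_of_norm_le_const fun x hx => ?_
      rw [uIoc_of_le (hule k)] at hx
      have hx' := hsub k hk' (Ioc_subset_Icc_self hx)
      rw [norm_mul]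
      refine mul_le_mul (hC x hx') (hω x hx' (u k) (hum k hk'.le) ?_) (norm_nonneg _)
        ((norm_nonneg _).trans (hC x hx'))
      rw [abs_of_nonneg (by linarith [hx.1]), ← hud k]
      linarith [hx.2]
    rwa [hud, abs_of_nonneg (by positivity)] at h2
  refine (norm_sum_le _ _).trans ((Finset.sum_le_sum hterm).trans (le_of_eq ?_))
  rw [Finset.sum_const, Finset.card_range, nsmul_eq_mul]
  field_simp

/-- On `[0, t]` the step function takes the value of `f` at the next node. -/
lemma norm_stepFunction_stepApprox_sub_le {f : ℝ → ℂ} {t C : ℝ} (ht : 0 ≤ t) {N : ℕ} (hN : 0 < N)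
    (hC : ∀ a ∈ Icc 0 t, ∀ b ∈ Icc 0 t, ‖f a - f b‖ ≤ C * |a - b|) (hC0 : 0 ≤ C)
    {x : ℝ} (hx : 0 ≤ x) :
    ‖stepFunction (stepApprox f t N) x - (Icc (0 : ℝ) t).indicator f x‖ ≤ C * (t / N) := by
  classical
  have hN' : (0 : ℝ) < N := by exact_mod_cast hN
  set u : ℕ → ℝ := fun k => (k : ℝ) * (t / N) with hu
  have huN : u N = t := by simp only [hu]; field_simp
  have hum : ∀ k, k ≤ N → u k ∈ Icc 0 t := fun k hk => node_mem ht hk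
  have hmono : Monotone u := fun a b hab => by
    have : (a : ℝ) ≤ b := by exact_mod_cast hab
    simp only [hu]; gcongr
  have hbound : 0 ≤ C * (t / N) := by positivity
  have hind : ∀ s : ℝ, (Icc (0 : ℝ) s).indicator (fun _ => (1 : ℂ)) x = if x ≤ s then 1 else 0 := by
    intro s
    by_cases h : x ≤ s <;> simp [indicator, hx, h]
  unfold stepFunction
  rw [sum_stepApprox]
  simp_rw [hind]
  rcases le_or_gt x t with hxt | hxt
  · have hex : ∃ k, x ≤ u k := ⟨N, by rw [huN]; exact hxt⟩
    set K := Nat.find hex with hK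
    have hKx : x ≤ u K := Nat.find_spec hex
    have hKN : K ≤ N := Nat.find_min' hex (by rw [huN]; exact hxt)
    have hiff : ∀ k, x ≤ u k ↔ K ≤ k := fun k =>
      ⟨fun h => Nat.find_min' hex h, fun h => hKx.trans (hmono h)⟩
    have hsum : ∑ k ∈ Finset.range N, (f (u (k + 1)) - f (u k)) * (if x ≤ u k then (1 : ℂ) else 0) =
        f t - f (u K) := by
      simp_rw [hiff, mul_ite, mul_one, mul_zero]
      rw [← Finset.sum_filter]
      have : (Finset.range N).filter (fun k => K ≤ k) = Finset.Ico K N := by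
        ext k; simp [and_comm]
      rw [this, Finset.sum_Ico_eq_sub _ hKN, Finset.sum_range_sub (fun k => f (u k)),
        Finset.sum_range_sub (fun k => f (u k)), huN]
      ring
    simp only [hu] at hsum
    rw [hsum, if_pos hxt, indicator_of_mem (show x ∈ Icc 0 t from ⟨hx, hxt⟩), mul_one,
      sub_sub_cancel]
    refine (hC _ (hum K hKN) x ⟨hx, hxt⟩).trans ?_
    gcongr
    rw [abs_of_nonneg (sub_nonneg.2 hKx)]
    rcases Nat.eq_zero_or_pos K with h0 | h0
    · have : u K = 0 := by rw [h0]; simp [hu]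
      rw [this]
      have : 0 ≤ t / N := by positivity
      linarith
    · have h1 : ¬ x ≤ u (K - 1) := Nat.find_min hex (by omega)
      have h2 : u K = u (K - 1) + t / N := by
        simp only [hu]
        rw [Nat.cast_sub h0]; push_cast; ring
      push Not at h1
      linarith
  · have h1 : ∀ k ∈ Finset.range N, (f ((k + 1 : ℕ) * (t / N)) - f (k * (t / N))) *
        (if x ≤ k * (t / N) then (1 : ℂ) else 0) = 0 := by
      intro k hk
      have := (hum k (Finset.mem_range.1 hk).le).2
      simp only [hu] at this
      rw [if_neg (by linarith), mul_zero]
    rw [Finset.sum_eq_zero h1, if_neg (by linarith), indicator_of_notMem (fun h => by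
      have := h.2; linarith)]
    simpa using hbound

end StepApproximation

/-- The pathwise integral of a Hölder version of `ζ` is the Wiener integral. -/
lemma IsHolderVersion.isWienerIntegral {Ω : Type*} [MeasurableSpace Ω] {P : Measure Ω} {H T : ℝ}
    {α : ℂ} {ζ z : ℝ → Ω → ℂ} (hz : IsHolderVersion P H T ζ z)
    (hL2 : ∀ t ∈ Icc (0 : ℝ) T, MemLp (ζ t) 2 P) (hT : 0 < T) (hH1 : H ≤ 1)
    (hα : α.re ∈ Ioo 0 H) {t : ℝ} (ht : t ∈ Ico (0 : ℝ) T) :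
    IsWienerIntegral P T ζ (bridgeIntegrand T α t)
      (fun w => pathIntegral T α (fun s => z s w) (T - t)) := by
  set f : ℝ → ℂ := fun u => ((T - u : ℝ) : ℂ) ^ (-α) with hf
  set f' : ℝ → ℂ := fun u => α * ((T - u : ℝ) : ℂ) ^ (-α - 1) with hf'
  have hα0 : α ≠ 0 := by rintro rfl; simp at hα
  have hpos : ∀ u ∈ Icc 0 t, 0 < T - u := fun u hu => by linarith [hu.2, ht.2]
  have htT : t ∈ Icc (0 : ℝ) T := ⟨ht.1, ht.2.le⟩
  have hder : ∀ u ∈ Icc 0 t, HasDerivAt f (f' u) u := by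
    intro u hu
    refine ((hasDerivAt_ofReal_cpow_of_pos (hpos u hu) (-α)).comp_const_sub T u).congr_deriv ?_
    simp only [hf']; ring
  have hf'c : ContinuousOn f' (Icc 0 t) :=
    ((continuousOn_ofReal_cpow _).comp (by fun_prop) hpos).const_mul α
  set C : ℝ := ‖α‖ * (T - t) ^ (-α.re - 1) with hC
  have hTt : 0 < T - t := sub_pos.2 ht.2
  have hC0 : 0 ≤ C := by positivity
  have hCb : ∀ u ∈ Icc 0 t, ‖f' u‖ ≤ C := by
    intro u hu
    simp only [hf']
    rw [norm_mul, Complex.norm_cpow_eq_rpow_re_of_pos (hpos u hu)]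
    simp only [Complex.sub_re, Complex.neg_re, Complex.one_re]
    rw [hC]
    gcongr 1
    exact Real.rpow_le_rpow_of_nonpos hTt (by linarith [hu.2]) (by linarith [hα.1])
  have hlip : ∀ a ∈ Icc 0 t, ∀ b ∈ Icc 0 t, ‖f a - f b‖ ≤ C * |a - b| := by
    intro a ha b hb
    exact (convex_Icc 0 t).norm_image_sub_le_of_norm_hasDerivWithin_le
      (fun x hx => (hder x hx).hasDerivWithinAt) hCb hb ha
  have hmesh : Tendsto (fun n : ℕ => t / ((n + 1 : ℕ) : ℝ)) atTop (𝓝 0) :=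
    (tendsto_const_div_atTop_nhds_zero_nat t).comp (tendsto_add_atTop_nat 1)
  refine ⟨hz.memLp_pathIntegral hL2 hT hH1 hα ⟨hTt.le, by linarith [ht.1]⟩,
    fun n => stepApprox f t (n + 1), fun n => support_stepApprox f htT (n + 1), ?_, ?_⟩
  · rw [Metric.tendstoUniformlyOn_iff]
    intro ε hε
    have h1 : Tendsto (fun n : ℕ => C * (t / ((n + 1 : ℕ) : ℝ))) atTop (𝓝 0) := by
      simpa using hmesh.const_mul C
    filter_upwards [h1.eventually (gt_mem_nhds hε)] with n hn x hx
    rw [dist_comm, dist_eq_norm]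
    exact (norm_stepFunction_stepApprox_sub_le ht.1 n.succ_pos hlip hC0 hx.1).trans_lt hn
  · obtain ⟨M, hM2, hM0, hM⟩ := hz.holder α.re hα
    refine tendsto_eLpNorm_zero_of_le_mul (ε := fun n : ℕ =>
      C * (t / ((n + 1 : ℕ) : ℝ)) ^ α.re * t) hM2 (Eventually.of_forall fun n => ?_) ?_
    · filter_upwards [hz.ae_eq] with w hw
      have e1 : stepIntegral ζ (stepApprox f t (n + 1)) w =
          (stepApprox f t (n + 1)).sum (fun s a => a * z s w) := by
        unfold stepIntegral
        exact Finsupp.sum_congr fun s hs => by rw [hw s (support_stepApprox f htT _ s hs)]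
      rw [e1, pathIntegral_eq hα0 (hz.continuous w) ht]
      refine (norm_sum_stepApprox_sub_le (C := C) (ω := M w * (t / ((n + 1 : ℕ) : ℝ)) ^ α.re)
        ht.1 n.succ_pos hder hf'c hCb (hz.continuous w) ?_).trans (le_of_eq (by ring))
      intro u hu v hv huv
      refine (hM w v ⟨hv.1, hv.2.trans ht.2.le⟩ u ⟨hu.1, hu.2.trans ht.2.le⟩).trans ?_
      have := hM0 w
      have := hα.1
      gcongr
    · have h1 := hmesh.rpow_const (p := α.re) (Or.inr hα.1.le)
      rw [Real.zero_rpow hα.1.ne'] at h1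
      simpa using (h1.const_mul C).mul_const t

/-! ### Gaussian processes and limits in mean square -/

/-- A limit in mean square of Gaussian processes is a Gaussian process: means and variances of
linear functionals converge, and so do their characteristic functions. -/
lemma isGaussianProcess_of_tendsto_eLpNorm {Ω S : Type*} [MeasurableSpace Ω] {P : Measure Ω}
    [IsProbabilityMeasure P] {X : S → Ω → ℂ} {Xn : ℕ → S → Ω → ℂ}
    (hXn : ∀ n, IsGaussianProcess (Xn n) P) (hX : ∀ s, MemLp (X s) 2 P)
    (hlim : ∀ s, Tendsto (fun n => eLpNorm (fun w => Xn n s w - X s w) 2 P) atTop (𝓝 0)) :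
    IsGaussianProcess X P where
  hasGaussianLaw I := by
    have hmeas : AEMeasurable (fun w => I.restrict (X · w)) P :=
      aemeasurable_pi_lambda _ fun i => (hX i).1.aemeasurable
    rw [hasGaussianLaw_iff_charFunDual_map_eq hmeas]
    intro L
    set Y : Ω → ℝ := L ∘ fun w => I.restrict (X · w) with hY
    set Yn : ℕ → Ω → ℝ := fun n => L ∘ fun w => I.restrict (Xn n · w) with hYn
    have hbound : ∀ n w, ‖Yn n w - Y w‖ ≤ ‖‖L‖ * ∑ i ∈ I, ‖Xn n i w - X i w‖‖ := by
      intro n w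
      simp only [hY, hYn, Function.comp_apply]
      rw [← map_sub, Real.norm_of_nonneg (by positivity : 0 ≤ ‖L‖ * _)]
      refine (L.le_opNorm _).trans ?_
      gcongr
      rw [pi_norm_le_iff_of_nonneg (by positivity)]
      intro i
      exact Finset.single_le_sum (f := fun i => ‖Xn n i w - X i w‖)
        (fun _ _ => norm_nonneg _) i.2
    have hGn : ∀ n, HasGaussianLaw (Yn n) P := fun n => ((hXn n).hasGaussianLaw I).map L
    have hYn2 : ∀ n, MemLp (Yn n) 2 P := fun n => (hGn n).memLp_two
    have hYm : AEStronglyMeasurable Y P :=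
      (L.continuous.measurable.comp_aemeasurable hmeas).aestronglyMeasurable
    have hY2 : MemLp Y 2 P := by
      have h1 : MemLp (fun w => ‖L‖ * ∑ i ∈ I, ‖X i w‖) 2 P :=
        (memLp_finsetSum _ fun i _ => (hX i).norm).const_mul _
      refine h1.of_le hYm (Eventually.of_forall fun w => ?_)
      rw [Real.norm_of_nonneg (by positivity : 0 ≤ ‖L‖ * _)]
      refine (L.le_opNorm _).trans ?_
      gcongr
      rw [pi_norm_le_iff_of_nonneg (by positivity)]
      intro i
      exact Finset.single_le_sum (f := fun i => ‖X i w‖) (fun _ _ => norm_nonneg _) i.2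
    have hconv : Tendsto (fun n => eLpNorm (Yn n - Y) 2 P) atTop (𝓝 0) := by
      have h1 : Tendsto (fun n => ‖‖L‖‖ₑ * ∑ i ∈ I, eLpNorm (fun w => Xn n i w - X i w) 2 P) atTop
          (𝓝 0) := by
        have h2 := tendsto_finsetSum I fun i _ => hlim i
        rw [Finset.sum_const_zero] at h2
        simpa using ENNReal.Tendsto.const_mul h2 (Or.inr (enorm_ne_top (x := ‖L‖)))
      refine tendsto_of_tendsto_of_tendsto_of_le_of_le tendsto_const_nhds h1
        (fun _ => zero_le) fun n => ?_
      refine (eLpNorm_mono (hbound n)).trans ?_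
      have h3 : (fun w => ‖L‖ * ∑ i ∈ I, ‖Xn n i w - X i w‖) =
          ‖L‖ • ∑ i ∈ I, fun w => ‖Xn n i w - X i w‖ := by
        funext w; simp
      rw [h3, eLpNorm_const_smul]
      gcongr
      refine (eLpNorm_sum_le (fun i _ => ?_) (by norm_num)).trans ?_
      · exact (((hXn n).aemeasurable i).aestronglyMeasurable.sub (hX i).1).norm
      · simp only [eLpNorm_norm]; exact le_rfl
    -- first and second moments converge, by continuity of the inner product of `L²`
    have hLp : Tendsto (fun n => (hYn2 n).toLp (Yn n)) atTop (𝓝 (hY2.toLp Y)) :=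
      (Lp.tendsto_Lp_iff_tendsto_eLpNorm'' _ hYn2 _ hY2).2 hconv
    have hinner : ∀ {f g : Ω → ℝ} (hf : MemLp f 2 P) (hg : MemLp g 2 P),
        inner ℝ (hf.toLp f) (hg.toLp g) = ∫ w, f w * g w ∂P := by
      intro f g hf hg
      rw [L2.inner_def]
      refine integral_congr_ae ?_
      filter_upwards [hf.coeFn_toLp, hg.coeFn_toLp] with w h1 h2
      rw [h1, h2]
      simp [mul_comm]
    have hm1 : Tendsto (fun n => ∫ w, Yn n w ∂P) atTop (𝓝 (∫ w, Y w ∂P)) := by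
      have h1 : MemLp (fun _ : Ω => (1 : ℝ)) 2 P := memLp_const 1
      have := hLp.inner (𝕜 := ℝ) (tendsto_const_nhds (x := h1.toLp _))
      simpa only [hinner, mul_one] using this
    have hm2 : Tendsto (fun n => ∫ w, Yn n w * Yn n w ∂P) atTop (𝓝 (∫ w, Y w * Y w ∂P)) := by
      have := hLp.inner (𝕜 := ℝ) hLp
      simpa only [hinner] using this
    have hvar : Tendsto (fun n => Var[Yn n; P]) atTop (𝓝 Var[Y; P]) := by
      have h1 : ∀ {f : Ω → ℝ}, MemLp f 2 P →
          Var[f; P] = ∫ w, f w * f w ∂P - (∫ w, f w ∂P) ^ 2 := by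
        intro f hf
        rw [variance_eq_sub hf]
        simp [pow_two]
      rw [h1 hY2]
      simp_rw [h1 (hYn2 _)]
      exact hm2.sub (hm1.pow 2)
    have hchar : Tendsto (fun n => charFunDual (P.map fun w => I.restrict (Xn n · w)) L) atTop
        (𝓝 (charFunDual (P.map fun w => I.restrict (X · w)) L)) := by
      have hexp : Continuous fun v : I → ℂ => Complex.exp (L v * Complex.I) := by fun_prop
      have e1 : ∀ n, charFunDual (P.map fun w => I.restrict (Xn n · w)) L =
          ∫ w, Complex.exp (Yn n w * Complex.I) ∂P := fun n => by
        rw [charFunDual_apply, integral_map ((hXn n).hasGaussianLaw I).aemeasurable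
          hexp.aestronglyMeasurable]
        rfl
      have e2 : charFunDual (P.map fun w => I.restrict (X · w)) L =
          ∫ w, Complex.exp (Y w * Complex.I) ∂P := by
        rw [charFunDual_apply, integral_map hmeas hexp.aestronglyMeasurable]
        rfl
      have hexp' : Continuous fun x : ℝ => Complex.exp (x * Complex.I) := by fun_prop
      rw [e2]
      simp_rw [e1]
      refine tendsto_integral_of_L1' (F := fun n w => Complex.exp (Yn n w * Complex.I))
        (fun w => Complex.exp (Y w * Complex.I)) (hexp'.comp_aestronglyMeasurable hYm)
        (Eventually.of_forall fun n => ?_) ?_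
      · refine Integrable.of_bound (hexp'.comp_aestronglyMeasurable (hYn2 n).1) 1
          (Eventually.of_forall fun w => ?_)
        rw [Complex.norm_exp_ofReal_mul_I]
      · refine tendsto_of_tendsto_of_tendsto_of_le_of_le tendsto_const_nhds hconv
          (fun _ => zero_le) fun n => ?_
        refine le_trans ?_ (eLpNorm_le_eLpNorm_of_exponent_le (by norm_num : (1 : ENNReal) ≤ 2)
          ((hYn2 n).1.sub hYm))
        refine eLpNorm_mono fun w => ?_
        simp only [Pi.sub_apply]
        have h1 : Complex.exp (Yn n w * Complex.I) - Complex.exp (Y w * Complex.I) =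
            Complex.exp (Y w * Complex.I) *
              (Complex.exp (Complex.I * ((Yn n w - Y w : ℝ) : ℂ)) - 1) := by
          rw [mul_sub, ← Complex.exp_add, mul_one]
          congr 2
          push_cast; ring
        rw [h1, norm_mul, Complex.norm_exp_ofReal_mul_I, one_mul]
        exact Real.norm_exp_I_mul_ofReal_sub_one_le
    refine tendsto_nhds_unique hchar ?_
    have e3 : ∀ n, charFunDual (P.map fun w => I.restrict (Xn n · w)) L =
        Complex.exp ((∫ w, Yn n w ∂P : ℝ) * Complex.I - Var[Yn n; P] / 2) := fun n =>
      ((hXn n).hasGaussianLaw I).charFunDual_map_eq L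
    simp_rw [e3]
    have h1 : Continuous fun p : ℝ × ℝ => Complex.exp ((p.1 : ℂ) * Complex.I - (p.2 : ℂ) / 2) := by
      fun_prop
    exact (h1.tendsto _).comp (hm1.prodMk_nhds hvar)

section Planar

variable {Ω : Type*} [MeasurableSpace Ω] {P : Measure Ω} {H T : ℝ} {B₁ B₂ : ℝ → Ω → ℝ}

lemma IsPlanarFractionalBrownianMotion.isGaussianProcess_prodMk
    (hB : IsPlanarFractionalBrownianMotion P H T B₁ B₂) :
    IsGaussianProcess (fun (t : Icc (0 : ℝ) T) w => (B₁ t w, B₂ t w)) P where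
  hasGaussianLaw I := by
    have hi : IndepFun (fun w => I.restrict (fun t : Icc (0 : ℝ) T => B₁ t w))
        (fun w => I.restrict (fun t : Icc (0 : ℝ) T => B₂ t w)) P :=
      hB.indep.comp (Finset.measurable_restrict I) (Finset.measurable_restrict I)
    have h := IndepFun.hasGaussianLaw (hB.fst.gaussian.hasGaussianLaw I)
      (hB.snd.gaussian.hasGaussianLaw I) hi
    let L : ((I → ℝ) × (I → ℝ)) →L[ℝ] (I → ℝ × ℝ) :=
      { toFun x i := (x.1 i, x.2 i)
        map_add' x y := by ext <;> simp
        map_smul' c x := by ext <;> simp }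
    exact h.map L

/-- Integrals of step functions form a Gaussian process. -/
lemma IsPlanarFractionalBrownianMotion.isGaussianProcess_stepIntegral
    (hB : IsPlanarFractionalBrownianMotion P H T B₁ B₂) {S : Type*} {c : S → ℝ →₀ ℂ}
    (hc : ∀ x, ∀ s ∈ (c x).support, s ∈ Icc (0 : ℝ) T) :
    IsGaussianProcess (fun x => stepIntegral (complexFBM B₁ B₂) (c x)) P := by
  classical
  refine hB.isGaussianProcess_prodMk.of_isGaussianProcess fun x => ?_
  refine ⟨(c x).support.subtype (· ∈ Icc (0 : ℝ) T),
    { toFun v := ∑ s, c x s.1.1 * (((Real.sqrt 2)⁻¹ : ℝ) *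
        (((v s).1 : ℂ) + Complex.I * ((v s).2 : ℂ)))
      map_add' v v' := by
        rw [← Finset.sum_add_distrib]
        refine Finset.sum_congr rfl fun s _ => ?_
        simp only [Pi.add_apply, Prod.fst_add, Prod.snd_add]
        push_cast; ring
      map_smul' r v := by
        rw [RingHom.id_apply, Finset.smul_sum]
        refine Finset.sum_congr rfl fun s _ => ?_
        simp only [Pi.smul_apply, Prod.smul_fst, Prod.smul_snd, smul_eq_mul, Complex.real_smul]
        push_cast; ring }, fun w => ?_⟩
  change _ = ∑ s : ((c x).support.subtype (· ∈ Icc (0 : ℝ) T)),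
    c x s.1.1 * complexFBM B₁ B₂ s.1.1 w
  rw [Finset.sum_coe_sort ((c x).support.subtype (· ∈ Icc (0 : ℝ) T))
    (fun s => c x s.1 * complexFBM B₁ B₂ s.1 w),
    Finset.sum_subtype_of_mem (fun s => c x s * complexFBM B₁ B₂ s w) (hc x)]
  rfl

/-- The process of pathwise integrals, including the terminal value, is Gaussian. -/
lemma IsPlanarFractionalBrownianMotion.isGaussianProcess_pathIntegral [IsProbabilityMeasure P]
    (hB : IsPlanarFractionalBrownianMotion P H T B₁ B₂) {z : ℝ → Ω → ℂ}
    (hz : IsHolderVersion P H T (complexFBM B₁ B₂) z) (hT : 0 < T) (hH1 : H ≤ 1) {α : ℂ}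
    (hα : α.re ∈ Ioo 0 H) :
    IsGaussianProcess (fun (t : Icc (0 : ℝ) T) w => pathIntegral T α (fun s => z s w) (T - t)) P := by
  have hL2 : ∀ t ∈ Icc (0 : ℝ) T, MemLp (complexFBM B₁ B₂ t) 2 P := fun t ht => hB.memLp ht
  have hW : ∀ t ∈ Ico (0 : ℝ) T, IsWienerIntegral P T (complexFBM B₁ B₂) (bridgeIntegrand T α t)
      (fun w => pathIntegral T α (fun s => z s w) (T - t)) := fun t ht =>
    hz.isWienerIntegral hL2 hT hH1 hα ht
  have hIco : IsGaussianProcess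
      (fun (t : Ico (0 : ℝ) T) w => pathIntegral T α (fun s => z s w) (T - t)) P := by
    choose hmem c hc _ hcl using fun t : Ico (0 : ℝ) T => hW t t.2
    exact isGaussianProcess_of_tendsto_eLpNorm
      (fun n => hB.isGaussianProcess_stepIntegral fun t => hc t n) hmem hcl
  -- the terminal value is reached from earlier times `t (1 - 1 / (n + 1))`
  have hfac : ∀ n : ℕ, 0 ≤ 1 - 1 / ((n : ℝ) + 1) ∧ 1 - 1 / ((n : ℝ) + 1) < 1 := fun n => by
    have h1 : (0 : ℝ) < 1 / ((n : ℝ) + 1) := by positivity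
    have h2 : 1 / ((n : ℝ) + 1) ≤ 1 := by
      rw [div_le_one (by positivity)]
      have : (0 : ℝ) ≤ n := n.cast_nonneg
      linarith
    exact ⟨by linarith, by linarith⟩
  set θ : ℕ → Icc (0 : ℝ) T → Ico (0 : ℝ) T := fun n t =>
    ⟨t * (1 - 1 / ((n : ℝ) + 1)), mul_nonneg t.2.1 (hfac n).1, by
      rcases t.2.1.eq_or_lt with h | h
      · rw [← h, zero_mul]; exact hT
      · exact (mul_lt_of_lt_one_right h (hfac n).2).trans_le t.2.2⟩ with hθ
  have hδ : 0 < (H - α.re) / 2 := by linarith [hα.2]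
  obtain ⟨M, hM2, hM⟩ := hz.exists_norm_pathIntegral_sub_le (α := α) hT hH1 hα.1 hδ (by linarith)
  refine isGaussianProcess_of_tendsto_eLpNorm (fun n => hIco.comp_right (θ n)) (fun t => ?_)
    fun t => ?_
  · exact hz.memLp_pathIntegral hL2 hT hH1 hα ⟨by linarith [t.2.2], by linarith [t.2.1]⟩
  · refine tendsto_eLpNorm_zero_of_le_mul (ε := fun n : ℕ =>
      |(t : ℝ) * (1 / ((n : ℝ) + 1))| ^ ((H - α.re) / 2)) hM2
      (Eventually.of_forall fun n => Eventually.of_forall fun w => ?_) ?_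
    · have := hM w (T - θ n t) ⟨by linarith [(θ n t).2.2], by linarith [(θ n t).2.1]⟩ (T - t)
        ⟨by linarith [t.2.2], by linarith [t.2.1]⟩
      rw [mul_comm]
      refine this.trans (le_of_eq ?_)
      congr 3
      simp only [hθ]; ring
    · have h1 := ((tendsto_one_div_add_atTop_nhds_zero_nat (𝕜 := ℝ)).const_mul (t : ℝ)).abs
      have h2 := h1.rpow_const (p := (H - α.re) / 2) (Or.inr hδ.le)
      rwa [mul_zero, abs_zero, Real.zero_rpow hδ.ne'] at h2

end Planar

/-! ### A Beta integral -/

lemma one_sub_one_sub_rpow_bounds {p x : ℝ} (hp0 : 0 < p) (hp2 : p ≤ 2) (hx : x ∈ Icc (0 : ℝ) 1) :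
    0 ≤ 1 - (1 - x) ^ p ∧ 1 - (1 - x) ^ p ≤ 2 * x := by
  have h1 : 0 ≤ 1 - x := by linarith [hx.2]
  constructor
  · have := Real.rpow_le_one h1 (by linarith [hx.1]) hp0.le
    linarith
  · have h2 : (1 - x) ^ (2 : ℝ) ≤ (1 - x) ^ p := by
      rcases h1.eq_or_lt with h | h
      · rw [← h, Real.zero_rpow (by norm_num), Real.zero_rpow hp0.ne']
      · exact Real.rpow_le_rpow_of_exponent_ge h (by linarith [hx.1]) hp2
    rw [Real.rpow_two] at h2
    nlinarith [sq_nonneg x]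

lemma norm_cpow_mul_one_sub_rpow_le {p x : ℝ} (hp0 : 0 < p) (hp2 : p ≤ 2) (hx : x ∈ Ioc (0 : ℝ) 1)
    (c : ℂ) : ‖(x : ℂ) ^ c * ((1 - (1 - x) ^ p : ℝ) : ℂ)‖ ≤ 2 * x ^ (c.re + 1) := by
  have h := one_sub_one_sub_rpow_bounds hp0 hp2 (Ioc_subset_Icc_self hx)
  have hxp : 0 ≤ x ^ c.re := Real.rpow_nonneg hx.1.le _
  rw [norm_mul, Complex.norm_cpow_eq_rpow_re_of_pos hx.1, Complex.norm_real,
    Real.norm_of_nonneg h.1, Real.rpow_add_one hx.1.ne']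
  nlinarith [h.2]

lemma intervalIntegrable_cpow_mul_one_sub_rpow {p : ℝ} (hp0 : 0 < p) (hp2 : p ≤ 2) {α : ℂ}
    (hα : α.re < 1) : IntervalIntegrable
      (fun x : ℝ => (x : ℂ) ^ (-α - 1) * ((1 - (1 - x) ^ p : ℝ) : ℂ)) volume 0 1 := by
  have h1 : IntervalIntegrable (fun x : ℝ => 2 * x ^ ((-α - 1).re + 1)) volume 0 1 := by
    apply IntervalIntegrable.const_mul
    apply intervalIntegral.intervalIntegrable_rpow'
    simp; linarith
  refine h1.mono_fun' ?_ ?_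
  · refine Measurable.aestronglyMeasurable ?_
    fun_prop
  · rw [uIoc_of_le zero_le_one]
    exact (ae_restrict_iff' measurableSet_Ioc).2 (Eventually.of_forall fun x hx =>
      norm_cpow_mul_one_sub_rpow_le hp0 hp2 hx _)

/-- Integration by parts, which moves the singularity `x ^ (-α - 1)` to a Beta integral. -/
lemma mul_integral_cpow_mul_one_sub_rpow {p : ℝ} (hp0 : 0 < p) (hp2 : p ≤ 2) {α : ℂ}
    (hα0 : 0 < α.re) (hα : α.re < 1) :
    α * (∫ x in (0 : ℝ)..1, (x : ℂ) ^ (-α - 1) * ((1 - (1 - x) ^ p : ℝ) : ℂ)) =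
      p * Complex.betaIntegral (1 - α) p - 1 := by
  have hα' : -α ≠ 0 := by
    intro h
    have := congrArg Complex.re h
    simp at this
    linarith
  set F : ℝ → ℂ := fun x => (x : ℂ) ^ (-α) * ((1 - (1 - x) ^ p : ℝ) : ℂ) with hF
  set b : ℝ → ℂ := fun x => (x : ℂ) ^ (1 - α - 1) * (1 - (x : ℂ)) ^ ((p : ℂ) - 1) with hb
  have hbi : IntervalIntegrable b volume 0 1 :=
    Complex.betaIntegral_convergent (by simpa using hα) (by simpa using hp0)
  have hki := intervalIntegrable_cpow_mul_one_sub_rpow hp0 hp2 hα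
  have hcont : ContinuousOn F (Icc 0 1) := by
    intro x hx
    rcases hx.1.eq_or_lt with rfl | hx0
    · have hF0 : F 0 = 0 := by
        simp [hF, Complex.zero_cpow hα']
      rw [ContinuousWithinAt, hF0]
      have hlim : Tendsto (fun x : ℝ => 2 * x ^ ((-α).re + 1)) (𝓝[Icc 0 1] 0) (𝓝 0) := by
        have h1 : 0 < (-α).re + 1 := by simp; linarith
        have h2 : ContinuousAt (fun x : ℝ => 2 * x ^ ((-α).re + 1)) 0 :=
          continuousAt_const.mul (continuousAt_id.rpow_const (Or.inr h1.le))
        have h3 := h2.tendsto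
        rw [Real.zero_rpow h1.ne', mul_zero] at h3
        exact h3.mono_left nhdsWithin_le_nhds
      refine squeeze_zero_norm' ?_ hlim
      filter_upwards [self_mem_nhdsWithin] with y hy
      rcases hy.1.eq_or_lt with rfl | hy0
      · rw [hF0, norm_zero]
        positivity
      · exact norm_cpow_mul_one_sub_rpow_le hp0 hp2 ⟨hy0, hy.2⟩ _
    · refine ContinuousAt.continuousWithinAt ?_
      refine (hasDerivAt_ofReal_cpow_of_pos hx0 _).continuousAt.mul ?_
      refine Complex.continuous_ofReal.continuousAt.comp ?_
      exact continuousAt_const.sub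
        ((continuousAt_const.sub continuousAt_id).rpow_const (Or.inr hp0.le))
  have hderiv : ∀ x ∈ Ioo (0 : ℝ) 1 \ ∅, HasDerivAt F
      (-α * ((x : ℂ) ^ (-α - 1) * ((1 - (1 - x) ^ p : ℝ) : ℂ)) + p * b x) x := by
    intro x hx
    have hx := hx.1
    have h1x : 0 < 1 - x := sub_pos.2 hx.2
    have h1 := hasDerivAt_ofReal_cpow_of_pos hx.1 (-α)
    have h2 : HasDerivAt (fun x : ℝ => 1 - (1 - x) ^ p) (p * (1 - x) ^ (p - 1)) x := by
      have h3 := (((hasDerivAt_id x).const_sub 1).rpow_const (p := p) (Or.inl h1x.ne')).const_sub 1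
      refine h3.congr_deriv ?_
      simp
    refine (h1.mul h2.ofReal_comp).congr_deriv ?_
    have h4 : (((1 - x) ^ (p - 1) : ℝ) : ℂ) = (1 - (x : ℂ)) ^ ((p : ℂ) - 1) := by
      rw [Complex.ofReal_cpow h1x.le]; push_cast; rfl
    simp only [hb]
    rw [Complex.ofReal_mul, h4, show 1 - α - 1 = -α by ring]
    ring
  have hftc := integral_eq_of_hasDerivAt_off_countable_of_le F _ zero_le_one Set.countable_empty
    hcont hderiv ((hki.const_mul (-α)).add (hbi.const_mul p))
  have h5 := intervalIntegral.integral_add (hki.const_mul (-α)) (hbi.const_mul (p : ℂ))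
  rw [h5, intervalIntegral.integral_const_mul, intervalIntegral.integral_const_mul] at hftc
  have hF1 : F 1 - F 0 = 1 := by
    simp [hF, Complex.zero_cpow hα', Real.zero_rpow hp0.ne']
  rw [hF1] at hftc
  have h6 : Complex.betaIntegral (1 - α) p = ∫ x in (0 : ℝ)..1, b x := rfl
  rw [h6]
  linear_combination -hftc

/-- The value of `∫_0^1 x ^ (-α - 1) R(x, 1) dx` for the covariance function `R` of fractional
Brownian motion. -/
lemma integral_cpow_mul_fbmCov_one {H : ℝ} (hH : H ∈ Ioo (0 : ℝ) 1) {α : ℂ}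
    (hα : α.re ∈ Ioo 0 H) :
    2 * α * (∫ x in (0 : ℝ)..1, (x : ℂ) ^ (-α - 1) * (fbmCov H x 1 : ℂ)) =
      (2 * α - 2 * H + Real.Gamma (1 + 2 * H) *
        (Complex.Gamma (1 - α) / Complex.Gamma (2 * (H : ℂ) - α))) / (2 * H - α) := by
  have hp0 : 0 < 2 * H := by linarith [hH.1]
  have hp2 : 2 * H ≤ 2 := by linarith [hH.2]
  have hα1 : α.re < 1 := hα.2.trans hH.2
  have hki := intervalIntegrable_cpow_mul_one_sub_rpow hp0 hp2 hα1
  have hre : 0 < (2 * (H : ℂ) - α).re := by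
    simp; linarith [hα.2, hα.1]
  have hne : 2 * (H : ℂ) - α ≠ 0 := by
    intro h; rw [h] at hre; simp at hre
  have hpi : IntervalIntegrable (fun x : ℝ => (x : ℂ) ^ (2 * (H : ℂ) - α - 1)) volume 0 1 := by
    apply intervalIntegral.intervalIntegrable_cpow'
    simp at hre ⊢; linarith
  have e1 : (∫ x in (0 : ℝ)..1, (x : ℂ) ^ (-α - 1) * (fbmCov H x 1 : ℂ)) =
      (∫ x in (0 : ℝ)..1, (1 / 2 : ℂ) * ((x : ℂ) ^ (2 * (H : ℂ) - α - 1) +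
        (x : ℂ) ^ (-α - 1) * ((1 - (1 - x) ^ (2 * H) : ℝ) : ℂ))) := by
    refine intervalIntegral.integral_congr_ae (Eventually.of_forall fun x hx => ?_)
    rw [uIoc_of_le zero_le_one] at hx
    have hx' : (x : ℂ) ≠ 0 := by exact_mod_cast hx.1.ne'
    have h1 : 0 ≤ 1 - x := by linarith [hx.2]
    have h2 : ((x ^ (2 * H) : ℝ) : ℂ) = (x : ℂ) ^ (2 * (H : ℂ)) := by
      rw [Complex.ofReal_cpow hx.1.le]; push_cast; rfl
    simp only [fbmCov]
    rw [abs_of_pos hx.1, abs_one, Real.one_rpow, abs_of_nonneg h1,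
      show 2 * (H : ℂ) - α - 1 = (-α - 1) + 2 * H by ring, Complex.cpow_add _ _ hx', ← h2]
    push_cast
    ring
  have e2 : (∫ x in (0 : ℝ)..1, (x : ℂ) ^ (2 * (H : ℂ) - α - 1)) = 1 / (2 * H - α) := by
    rw [integral_cpow]
    · rw [sub_add_cancel, Complex.ofReal_one, Complex.one_cpow, Complex.ofReal_zero,
        Complex.zero_cpow hne, sub_zero]
    · left; simp at hre ⊢; linarith
  have e3 := mul_integral_cpow_mul_one_sub_rpow hp0 hp2 hα.1 hα1
  have e4 : ((2 * H : ℝ) : ℂ) * Complex.betaIntegral (1 - α) ((2 * H : ℝ) : ℂ) =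
      Real.Gamma (1 + 2 * H) * (Complex.Gamma (1 - α) / Complex.Gamma (2 * (H : ℂ) - α)) /
        (2 * H - α) := by
    have g1 := Complex.Gamma_mul_Gamma_eq_betaIntegral (s := 1 - α) (t := ((2 * H : ℝ) : ℂ))
      (by simpa using hα1) (by simpa using hH.1)
    have g2 : Complex.Gamma (1 - α + ((2 * H : ℝ) : ℂ)) =
        (2 * H - α) * Complex.Gamma (2 * H - α) := by
      rw [← Complex.Gamma_add_one _ hne]
      congr 1; push_cast; ring
    have g3 : (Real.Gamma (1 + 2 * H) : ℂ) = ((2 * H : ℝ) : ℂ) * Complex.Gamma ((2 * H : ℝ) : ℂ) := by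
      rw [add_comm, Real.Gamma_add_one hp0.ne', Complex.ofReal_mul, Complex.Gamma_ofReal]
    have g4 : Complex.Gamma (2 * (H : ℂ) - α) ≠ 0 := Complex.Gamma_ne_zero_of_re_pos hre
    rw [g3]
    rw [g2] at g1
    field_simp
    linear_combination -(((2 * H : ℝ) : ℂ)) * g1
  rw [e1, intervalIntegral.integral_const_mul, intervalIntegral.integral_add hpi hki, e2]
  rw [e4] at e3
  have e5 : (2 * α * (1 / 2 * (1 / (2 * (H : ℂ) - α) +
      ∫ x in (0 : ℝ)..1, (x : ℂ) ^ (-α - 1) * ((1 - (1 - x) ^ (2 * H) : ℝ) : ℂ)))) =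
      α / (2 * H - α) + α * ∫ x in (0 : ℝ)..1,
        (x : ℂ) ^ (-α - 1) * ((1 - (1 - x) ^ (2 * H) : ℝ) : ℂ) := by ring
  rw [e5, e3]
  field_simp
  ring

/-- Self-similarity of the covariance function. -/
lemma integral_cpow_mul_fbmCov {H t : ℝ} (ht : 0 < t) (α : ℂ) :
    (∫ v in (0 : ℝ)..t, (v : ℂ) ^ (-α - 1) * (fbmCov H v t : ℂ)) =
      (t : ℂ) ^ (2 * (H : ℂ) - α) *
        ∫ x in (0 : ℝ)..1, (x : ℂ) ^ (-α - 1) * (fbmCov H x 1 : ℂ) := by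
  have h1 := intervalIntegral.smul_integral_comp_mul_left (a := 0) (b := 1)
    (fun v : ℝ => (v : ℂ) ^ (-α - 1) * (fbmCov H v t : ℂ)) t
  rw [mul_zero, mul_one] at h1
  rw [← h1, Complex.real_smul, ← intervalIntegral.integral_const_mul,
    ← intervalIntegral.integral_const_mul]
  refine intervalIntegral.integral_congr fun x hx => ?_
  rw [uIcc_of_le zero_le_one] at hx
  have ht' : (t : ℂ) ≠ 0 := by exact_mod_cast ht.ne'
  have h2 : fbmCov H (t * x) t = t ^ (2 * H) * fbmCov H x 1 := by
    simp only [fbmCov]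
    rw [show t - t * x = t * (1 - x) by ring, abs_mul, abs_mul, abs_of_pos ht,
      Real.mul_rpow ht.le (abs_nonneg _), Real.mul_rpow ht.le (abs_nonneg _), abs_one,
      Real.one_rpow]
    ring
  have h3 : ((t ^ (2 * H) : ℝ) : ℂ) = (t : ℂ) ^ (2 * (H : ℂ)) := by
    rw [Complex.ofReal_cpow ht.le]; push_cast; rfl
  simp only [h2]
  rw [Complex.ofReal_mul, Complex.mul_cpow_ofReal_nonneg ht.le hx.1, Complex.ofReal_mul, h3,
    show 2 * (H : ℂ) - α = 2 * H + (-α - 1) + 1 by ring, Complex.cpow_add _ _ ht',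
    Complex.cpow_add _ _ ht', Complex.cpow_one]
  ring

/-! ### The second moment of the terminal value -/

/-- The singular part `∫_0^t v ^ (-α - 1) (z (T - v) - z T) dv` of the pathwise integral. -/
noncomputable def singularIntegral (T : ℝ) (α : ℂ) (z : ℝ → ℂ) (t : ℝ) : ℂ :=
  ∫ v in (0 : ℝ)..t, (v : ℂ) ^ (-α - 1) * revIncrement T z v

lemma pathIntegral_zero {α : ℂ} (hα : α ≠ 0) (T : ℝ) (z : ℝ → ℂ) :
    pathIntegral T α z 0 = -α * singularIntegral T α z T + (T : ℂ) ^ (-α) * z T := by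
  simp only [pathIntegral, singularIntegral, Complex.ofReal_zero,
    Complex.zero_cpow (neg_ne_zero.2 hα)]
  ring

/-- The square of the singular integral as an integral of its derivative. -/
lemma singularIntegral_mul_conj {T M γ : ℝ} {α : ℂ} {z : ℝ → ℂ} (hT : 0 < T) (hz : Continuous z)
    (hH : ∀ s ∈ Icc (0 : ℝ) T, ∀ t ∈ Icc (0 : ℝ) T, ‖z t - z s‖ ≤ M * |t - s| ^ γ)
    (hα : α.re < γ) :
    singularIntegral T α z T * (starRingEnd ℂ) (singularIntegral T α z T) =
      (∫ t in (0 : ℝ)..T, (t : ℂ) ^ (-α - 1) * revIncrement T z t *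
        (starRingEnd ℂ) (singularIntegral T α z t)) +
      (starRingEnd ℂ) (∫ t in (0 : ℝ)..T, (t : ℂ) ^ (-α - 1) * revIncrement T z t *
        (starRingEnd ℂ) (singularIntegral T α z t)) := by
  set g : ℝ → ℂ := fun v => (v : ℂ) ^ (-α - 1) * revIncrement T z v with hg
  set A : ℝ → ℂ := singularIntegral T α z with hA
  have hTm : T ∈ Icc (0 : ℝ) T := ⟨hT.le, le_rfl⟩
  have h0m : (0 : ℝ) ∈ Icc (0 : ℝ) T := ⟨le_rfl, hT.le⟩
  have hgi : ∀ t ∈ Icc (0 : ℝ) T, IntervalIntegrable g volume 0 t := fun t ht =>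
    intervalIntegrable_cpow_mul_revIncrement hT hz hH hα h0m ht
  have hgc : ContinuousOn g (Ioi 0) :=
    (continuousOn_ofReal_cpow _).mul (continuous_revIncrement T hz).continuousOn
  have hAc : ContinuousOn A (Icc 0 T) := by
    have h1 := intervalIntegral.continuousOn_primitive_interval' (hgi T hTm)
      (a := 0) (by rw [uIcc_of_le hT.le]; exact h0m)
    rwa [uIcc_of_le hT.le] at h1
  have hAd : ∀ t ∈ Ioo (0 : ℝ) T, HasDerivAt A (g t) t := fun t ht =>
    intervalIntegral.integral_hasDerivAt_right (hgi t (Ioo_subset_Icc_self ht))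
      (hgc.stronglyMeasurableAtFilter isOpen_Ioi t ht.1) (hgc.continuousAt (Ioi_mem_nhds ht.1))
  have hAsc : ContinuousOn (fun t => (starRingEnd ℂ) (A t)) (Icc 0 T) :=
    Complex.continuous_conj.comp_continuousOn hAc
  have hi1 : IntervalIntegrable (fun t => g t * (starRingEnd ℂ) (A t)) volume 0 T := by
    refine (hgi T hTm).mul_continuousOn ?_
    rwa [uIcc_of_le hT.le]
  have hi2 : IntervalIntegrable (fun t => (starRingEnd ℂ) (g t * (starRingEnd ℂ) (A t)))
      volume 0 T :=
    ⟨Complex.conjLIE.toContinuousLinearEquiv.toContinuousLinearMap.integrable_comp hi1.1,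
      Complex.conjLIE.toContinuousLinearEquiv.toContinuousLinearMap.integrable_comp hi1.2⟩
  have hftc := integral_eq_of_hasDerivAt_off_countable_of_le
    (fun t => A t * (starRingEnd ℂ) (A t))
    (fun t => g t * (starRingEnd ℂ) (A t) + (starRingEnd ℂ) (g t * (starRingEnd ℂ) (A t)))
    hT.le Set.countable_empty (hAc.mul hAsc) (fun t ht => ?_) (hi1.add hi2)
  · rw [intervalIntegral.integral_add hi1 hi2] at hftc
    have hA0 : A 0 = 0 := by simp [hA, singularIntegral]
    rw [hA0, zero_mul, sub_zero] at hftc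
    rw [← hftc]
    congr 1
    rw [intervalIntegral.integral_of_le hT.le, intervalIntegral.integral_of_le hT.le, integral_conj]
  · have h1 := hAd t ht.1
    have h2 : HasDerivAt (fun t => (starRingEnd ℂ) (A t)) ((starRingEnd ℂ) (g t)) t := h1.star
    refine (h1.mul h2).congr_deriv ?_
    simp only [map_mul, Complex.conj_conj]
    ring

lemma conj_ofReal_cpow {t : ℝ} (ht : 0 < t) (c : ℂ) :
    (starRingEnd ℂ) ((t : ℂ) ^ c) = (t : ℂ) ^ (starRingEnd ℂ) c := by
  have harg : (t : ℂ).arg ≠ Real.pi := by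
    rw [Complex.arg_ofReal_of_nonneg ht.le]; exact Real.pi_ne_zero.symm
  rw [Complex.cpow_conj _ _ harg, Complex.conj_ofReal]

section Moments

variable {Ω : Type*} [MeasurableSpace Ω] {P : Measure Ω} {H T : ℝ} {α : ℂ}
  {ζ z : ℝ → Ω → ℂ}

lemma IsHolderVersion.measurable_uncurry_integrand (hz : IsHolderVersion P H T ζ z) (α : ℂ) :
    Measurable fun p : Ω × ℝ => (p.2 : ℂ) ^ (-α - 1) * revIncrement T (fun s => z s p.1) p.2 := by
  have hj : Measurable (Function.uncurry z) :=
    measurable_uncurry_of_continuous_of_measurable hz.continuous hz.measurable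
  have h1 : Measurable fun p : Ω × ℝ => z (T - p.2) p.1 :=
    hj.comp ((measurable_const.sub measurable_snd).prodMk measurable_fst)
  have h2 : Measurable fun p : Ω × ℝ => z T p.1 := (hz.measurable T).comp measurable_fst
  have h3 : Measurable fun p : Ω × ℝ => (p.2 : ℂ) ^ (-α - 1) :=
    (Complex.measurable_ofReal.comp measurable_snd).pow_const _
  exact h3.mul (h1.sub h2)

/-- The singular integrals are measurable jointly in the path and in the upper limit. -/
lemma IsHolderVersion.measurable_uncurry_singularIntegral (hz : IsHolderVersion P H T ζ z)
    (α : ℂ) : Measurable fun p : Ω × ℝ =>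
      ∫ v in Ioc 0 p.2, (v : ℂ) ^ (-α - 1) * revIncrement T (fun s => z s p.1) v := by
  have hG := hz.measurable_uncurry_integrand α
  have hset : MeasurableSet {q : (Ω × ℝ) × ℝ | 0 < q.2 ∧ q.2 ≤ q.1.2} :=
    (measurableSet_lt measurable_const measurable_snd).inter
      (measurableSet_le measurable_snd (measurable_snd.comp measurable_fst))
  have hF : Measurable ({q : (Ω × ℝ) × ℝ | 0 < q.2 ∧ q.2 ≤ q.1.2}.indicator fun q =>
      (q.2 : ℂ) ^ (-α - 1) * revIncrement T (fun s => z s q.1.1) q.2) :=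
    (hG.comp ((measurable_fst.comp measurable_fst).prodMk measurable_snd)).indicator hset
  have h1 := (hF.stronglyMeasurable.integral_prod_right' (ν := volume)).measurable
  convert! h1 using 2 with p
  rw [← integral_indicator measurableSet_Ioc]
  congr 1

/-- Time reversal: the reversed increments have the covariance of fractional Brownian motion. -/
lemma integral_revIncrement_mul_conj
    (hz2 : ∀ t ∈ Icc (0 : ℝ) T, MemLp (z t) 2 P)
    (hcov : ∀ s ∈ Icc (0 : ℝ) T, ∀ t ∈ Icc (0 : ℝ) T,
      ∫ w, z s w * (starRingEnd ℂ) (z t w) ∂P = fbmCov H s t)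
    {a b : ℝ} (ha : a ∈ Icc (0 : ℝ) T) (hb : b ∈ Icc (0 : ℝ) T) (hH : 0 < H) :
    ∫ w, revIncrement T (fun s => z s w) a * (starRingEnd ℂ) (revIncrement T (fun s => z s w) b) ∂P
      = fbmCov H a b := by
  have hT : T ∈ Icc (0 : ℝ) T := ⟨ha.1.trans ha.2, le_rfl⟩
  have hrev : ∀ x ∈ Icc (0 : ℝ) T, T - x ∈ Icc (0 : ℝ) T := fun x hx =>
    ⟨by linarith [hx.2], by linarith [hx.1]⟩
  have hi : ∀ s ∈ Icc (0 : ℝ) T, ∀ t ∈ Icc (0 : ℝ) T,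
      Integrable (fun w => z s w * (starRingEnd ℂ) (z t w)) P := fun s hs t ht =>
    (hz2 s hs).integrable_mul (hz2 t ht).star
  have e : ∀ w, revIncrement T (fun s => z s w) a *
      (starRingEnd ℂ) (revIncrement T (fun s => z s w) b) =
      (z (T - a) w * (starRingEnd ℂ) (z (T - b) w) - z (T - a) w * (starRingEnd ℂ) (z T w)) -
      (z T w * (starRingEnd ℂ) (z (T - b) w) - z T w * (starRingEnd ℂ) (z T w)) := by
    intro w
    simp only [revIncrement, map_sub]; ring
  simp_rw [e]
  have i1 := hi _ (hrev a ha) _ (hrev b hb)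
  have i2 := hi _ (hrev a ha) _ hT
  have i3 := hi _ hT _ (hrev b hb)
  have i4 := hi _ hT _ hT
  have i12 : Integrable (fun w => z (T - a) w * (starRingEnd ℂ) (z (T - b) w) -
      z (T - a) w * (starRingEnd ℂ) (z T w)) P := i1.sub i2
  have i34 : Integrable (fun w => z T w * (starRingEnd ℂ) (z (T - b) w) -
      z T w * (starRingEnd ℂ) (z T w)) P := i3.sub i4
  rw [integral_sub i12 i34, integral_sub i1 i2, integral_sub i3 i4, hcov _ (hrev a ha) _ (hrev b hb),
    hcov _ (hrev a ha) _ hT, hcov _ hT _ (hrev b hb), hcov _ hT _ hT]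
  simp only [fbmCov]
  rw [show T - b - (T - a) = -(b - a) by ring, show T - (T - a) = a by ring,
    show T - b - T = -b by ring, sub_self, abs_neg, abs_neg, abs_zero,
    Real.zero_rpow (by linarith)]
  push_cast
  ring

/-- Fubini for the singular integral and a square integrable variable. -/
lemma IsHolderVersion.integral_singularIntegral_mul (hz : IsHolderVersion P H T ζ z)
    (hT : 0 < T) (hα : α.re ∈ Ioo 0 H) [SFinite P] {Y : Ω → ℂ} (hY : MemLp Y 2 P) {t : ℝ}
    (ht : t ∈ Icc (0 : ℝ) T) :
    ∫ w, singularIntegral T α (fun s => z s w) t * Y w ∂P =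
      ∫ v in (0 : ℝ)..t, (v : ℂ) ^ (-α - 1) *
        ∫ w, revIncrement T (fun s => z s w) v * Y w ∂P := by
  obtain ⟨M, hM2, hM0, hM⟩ := hz.holder ((α.re + H) / 2)
    ⟨by linarith [hα.1, hα.2], by linarith [hα.2]⟩
  have hint : Integrable (Function.uncurry fun (w : Ω) (v : ℝ) =>
      (v : ℂ) ^ (-α - 1) * revIncrement T (fun s => z s w) v * Y w)
      (P.prod (volume.restrict (Ioc 0 t))) := by
    have h1 : Integrable (fun w => M w * ‖Y w‖) P := hM2.integrable_mul hY.norm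
    have h2 : Integrable (fun v : ℝ => v ^ ((α.re + H) / 2 + (-α - 1).re))
        (volume.restrict (Ioc 0 t)) := by
      have : IntervalIntegrable (fun v : ℝ => v ^ ((α.re + H) / 2 + (-α - 1).re)) volume 0 t := by
        apply intervalIntegral.intervalIntegrable_rpow'
        simp; linarith [hα.2]
      exact this.1
    refine (h1.mul_prod h2).mono' ?_ ?_
    · exact (hz.measurable_uncurry_integrand α).aestronglyMeasurable.mul hY.1.comp_fst
    · have h3 : ∀ᵐ p ∂(P.prod (volume.restrict (Ioc 0 t))), p.2 ∈ Ioc 0 t :=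
        Measure.quasiMeasurePreserving_snd.ae (ae_restrict_mem measurableSet_Ioc)
      filter_upwards [h3] with p hp
      simp only [Function.uncurry]
      rw [norm_mul]
      have h4 := norm_cpow_mul_revIncrement_le hT (hM p.1) ⟨hp.1, hp.2.trans ht.2⟩ (-α - 1)
      calc _ ≤ _ := mul_le_mul_of_nonneg_right h4 (norm_nonneg _)
        _ = _ := by ring
  have hswap := integral_integral_swap hint
  simp only [singularIntegral]
  rw [intervalIntegral.integral_of_le ht.1]
  simp_rw [intervalIntegral.integral_of_le ht.1, ← integral_mul_const]
  rw [hswap]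
  simp_rw [mul_assoc, integral_const_mul]

/-- The second moment of the singular integral, by Fubini and self-similarity. -/
lemma IsHolderVersion.integral_singularIntegral_mul_conj [IsProbabilityMeasure P]
    (hz : IsHolderVersion P H T ζ z) (hT : 0 < T) (hH1 : H ≤ 1) (hα : α.re ∈ Ioo 0 H)
    (hz2 : ∀ t ∈ Icc (0 : ℝ) T, MemLp (z t) 2 P)
    (hcov : ∀ s ∈ Icc (0 : ℝ) T, ∀ t ∈ Icc (0 : ℝ) T,
      ∫ w, z s w * (starRingEnd ℂ) (z t w) ∂P = fbmCov H s t)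
    {J : ℂ} (hJ : J = ∫ x in (0 : ℝ)..1, (x : ℂ) ^ (-α - 1) * (fbmCov H x 1 : ℂ)) :
    (∀ t ∈ Ioc (0 : ℝ) T, ∫ w, singularIntegral T α (fun s => z s w) t *
        (starRingEnd ℂ) (revIncrement T (fun s => z s w) t) ∂P = (t : ℂ) ^ (2 * (H : ℂ) - α) * J) ∧
    ∫ w, singularIntegral T α (fun s => z s w) T *
      (starRingEnd ℂ) (singularIntegral T α (fun s => z s w) T) ∂P =
        ((J.re * T ^ (2 * (H - α.re)) / (H - α.re) : ℝ) : ℂ) := by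
  have hH : 0 < H := hα.1.trans hα.2
  have hη2 : ∀ t ∈ Icc (0 : ℝ) T, MemLp (fun w => revIncrement T (fun s => z s w) t) 2 P :=
    fun t ht => (hz2 (T - t) ⟨by linarith [ht.2], by linarith [ht.1]⟩).sub (hz2 T ⟨hT.le, le_rfl⟩)
  have hmom : ∀ t ∈ Ioc (0 : ℝ) T, ∫ w, singularIntegral T α (fun s => z s w) t *
      (starRingEnd ℂ) (revIncrement T (fun s => z s w) t) ∂P =
        (t : ℂ) ^ (2 * (H : ℂ) - α) * J := by
    intro t ht
    have ht' := Ioc_subset_Icc_self ht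
    have h := hz.integral_singularIntegral_mul hT hα (hη2 t ht').star ht'
    rw [hJ, ← integral_cpow_mul_fbmCov ht.1]
    refine h.trans (intervalIntegral.integral_congr fun v hv => ?_)
    rw [uIcc_of_le ht.1.le] at hv
    have := integral_revIncrement_mul_conj hz2 hcov ⟨hv.1, hv.2.trans ht.2⟩ ht' hH
    exact congrArg _ this
  refine ⟨hmom, ?_⟩
  obtain ⟨M, hM2, hM0, hM⟩ := hz.holder ((α.re + H) / 2)
    ⟨by linarith [hα.1, hα.2], by linarith [hα.2]⟩
  set δ : ℝ := (α.re + H) / 2 - α.re with hδd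
  have hδ : 0 < δ := by rw [hδd]; linarith [hα.2]
  set G : Ω → ℝ → ℂ := fun w t => (t : ℂ) ^ (-α - 1) * revIncrement T (fun s => z s w) t *
    (starRingEnd ℂ) (singularIntegral T α (fun s => z s w) t) with hG
  have hint : Integrable (Function.uncurry G) (P.prod (volume.restrict (Ioc 0 T))) := by
    have h1 : Integrable (fun w => M w * M w) P := hM2.integrable_mul hM2
    have h2 : Integrable (fun v : ℝ => v ^ (δ - 1) * (T ^ δ / δ))
        (volume.restrict (Ioc 0 T)) := by
      have : IntervalIntegrable (fun v : ℝ => v ^ (δ - 1)) volume 0 T := by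
        apply intervalIntegral.intervalIntegrable_rpow'
        linarith
      exact this.1.mul_const _
    have h3 : ∀ᵐ p ∂(P.prod (volume.restrict (Ioc 0 T))), p.2 ∈ Ioc 0 T :=
      Measure.quasiMeasurePreserving_snd.ae (ae_restrict_mem measurableSet_Ioc)
    refine (h1.mul_prod h2).mono' ?_ ?_
    · have h4 : AEStronglyMeasurable (fun p : Ω × ℝ =>
          (p.2 : ℂ) ^ (-α - 1) * revIncrement T (fun s => z s p.1) p.2 *
          (starRingEnd ℂ) (∫ v in Ioc 0 p.2, (v : ℂ) ^ (-α - 1) *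
            revIncrement T (fun s => z s p.1) v)) (P.prod (volume.restrict (Ioc 0 T))) :=
        ((hz.measurable_uncurry_integrand α).mul (Complex.continuous_conj.measurable.comp
          (hz.measurable_uncurry_singularIntegral α))).aestronglyMeasurable
      refine h4.congr ?_
      filter_upwards [h3] with p hp
      simp only [Function.uncurry, hG, singularIntegral]
      rw [intervalIntegral.integral_of_le hp.1.le]
    · filter_upwards [h3] with p hp
      have h4 := norm_cpow_mul_revIncrement_le hT (hM p.1) hp (-α - 1)
      have h5 := norm_integral_cpow_mul_revIncrement_le hT (hM p.1) (hM0 p.1) hα.1.le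
        (by linarith [hα.2]) (by linarith [hα.2]) le_rfl hp.1.le hp.2
      simp only [Function.uncurry, hG]
      rw [norm_mul, RCLike.norm_conj]
      have h6 : (α.re + H) / 2 + (-α - 1).re = δ - 1 := by rw [hδd]; simp; ring
      rw [h6] at h4
      have h7 : ‖singularIntegral T α (fun s => z s p.1) p.2‖ ≤ M p.1 * T ^ δ / δ := by
        refine h5.trans ?_
        have := hM0 p.1
        rw [sub_zero]
        gcongr
        · exact hp.1.le
        · exact hp.2
      calc _ ≤ (M p.1 * p.2 ^ (δ - 1)) * (M p.1 * T ^ δ / δ) :=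
            mul_le_mul h4 h7 (norm_nonneg _) ((norm_nonneg _).trans h4)
        _ = _ := by ring
  have hS : ∫ w, (∫ t in (0 : ℝ)..T, G w t) ∂P =
      ((T ^ (2 * (H - α.re)) / (2 * (H - α.re)) : ℝ) : ℂ) * (starRingEnd ℂ) J := by
    simp_rw [intervalIntegral.integral_of_le hT.le]
    rw [integral_integral_swap hint]
    have h1 : ∀ t ∈ Ioc (0 : ℝ) T, ∫ w, G w t ∂P =
        ((t ^ (2 * (H - α.re) - 1) : ℝ) : ℂ) * (starRingEnd ℂ) J := by
      intro t ht
      have ht0 : (t : ℂ) ≠ 0 := by exact_mod_cast ht.1.ne'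
      have h2 : ∀ w, G w t = (t : ℂ) ^ (-α - 1) * (starRingEnd ℂ)
          (singularIntegral T α (fun s => z s w) t *
            (starRingEnd ℂ) (revIncrement T (fun s => z s w) t)) := by
        intro w
        simp only [hG, map_mul, Complex.conj_conj]; ring
      simp_rw [h2]
      rw [integral_const_mul, integral_conj, hmom t ht, map_mul, ← mul_assoc]
      congr 1
      rw [conj_ofReal_cpow ht.1, map_sub, map_mul, Complex.conj_ofReal, map_ofNat,
        ← Complex.cpow_add _ _ ht0, Complex.ofReal_cpow ht.1.le]
      congr 1
      have := Complex.add_conj α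
      push_cast at this ⊢
      linear_combination -this
    rw [setIntegral_congr_fun measurableSet_Ioc h1, integral_mul_const, integral_complex_ofReal,
      ← intervalIntegral.integral_of_le hT.le, integral_rpow (Or.inl (by linarith [hα.2])),
      sub_add_cancel, Real.zero_rpow (by linarith [hα.2]), sub_zero]
  have hSi : Integrable (fun w => ∫ t in (0 : ℝ)..T, G w t) P := by
    simp_rw [intervalIntegral.integral_of_le hT.le]
    exact hint.integral_prod_left
  have hpath : ∀ w, singularIntegral T α (fun s => z s w) T *
      (starRingEnd ℂ) (singularIntegral T α (fun s => z s w) T) =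
      (∫ t in (0 : ℝ)..T, G w t) + (starRingEnd ℂ) (∫ t in (0 : ℝ)..T, G w t) := fun w =>
    singularIntegral_mul_conj hT (hz.continuous w) (hM w) (by linarith [hα.2])
  have hSi' : Integrable (fun w => (starRingEnd ℂ) (∫ t in (0 : ℝ)..T, G w t)) P :=
    Complex.conjLIE.toContinuousLinearEquiv.toContinuousLinearMap.integrable_comp hSi
  simp_rw [hpath]
  rw [integral_add hSi hSi', integral_conj, hS, Complex.add_conj, Complex.re_ofReal_mul,
    Complex.conj_re]
  congr 1
  have : H - α.re ≠ 0 := by linarith [hα.2]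
  field_simp

lemma IsHolderVersion.memLp_singularIntegral [IsProbabilityMeasure P]
    (hz : IsHolderVersion P H T ζ z) (hT : 0 < T) (hH1 : H ≤ 1) (hα : α.re ∈ Ioo 0 H) :
    MemLp (fun w => singularIntegral T α (fun s => z s w) T) 2 P := by
  obtain ⟨M, hM2, hM0, hM⟩ := hz.holder ((α.re + H) / 2)
    ⟨by linarith [hα.1, hα.2], by linarith [hα.2]⟩
  refine (hM2.mul_const (T ^ ((α.re + H) / 2 - α.re) / ((α.re + H) / 2 - α.re))).of_le ?_
    (Eventually.of_forall fun w => ?_)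
  · have := ((hz.measurable_uncurry_singularIntegral α).comp
      (measurable_id.prodMk (measurable_const (a := T)))).aestronglyMeasurable (μ := P)
    refine this.congr (Eventually.of_forall fun w => ?_)
    simp only [singularIntegral, intervalIntegral.integral_of_le hT.le]
    rfl
  · have h5 := norm_integral_cpow_mul_revIncrement_le hT (hM w) (hM0 w) hα.1.le
      (by linarith [hα.2]) (by linarith [hα.2]) le_rfl hT.le le_rfl
    rw [sub_zero, mul_div_assoc] at h5
    exact h5.trans (le_abs_self _)

/-- The second moment of the terminal value. -/
lemma IsHolderVersion.integral_norm_sq_pathIntegral_zero [IsProbabilityMeasure P]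
    (hz : IsHolderVersion P H T ζ z) (hT : 0 < T) (hH1 : H < 1) (hα : α.re ∈ Ioo 0 H)
    (hz2 : ∀ t ∈ Icc (0 : ℝ) T, MemLp (z t) 2 P)
    (hcov : ∀ s ∈ Icc (0 : ℝ) T, ∀ t ∈ Icc (0 : ℝ) T,
      ∫ w, z s w * (starRingEnd ℂ) (z t w) ∂P = fbmCov H s t) (hz0 : ∀ᵐ w ∂P, z 0 w = 0) :
    ∫ w, ‖pathIntegral T α (fun s => z s w) 0‖ ^ 2 ∂P =
      Real.Gamma (1 + 2 * H) / (2 * (H - α.re)) *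
        (Complex.Gamma (1 - α) / Complex.Gamma (2 * (H : ℂ) - α)).re * T ^ (2 * (H - α.re)) := by
  have hH : 0 < H := hα.1.trans hα.2
  have hα0 : α ≠ 0 := by rintro rfl; simp at hα
  have hTm : T ∈ Icc (0 : ℝ) T := ⟨hT.le, le_rfl⟩
  set J : ℂ := ∫ x in (0 : ℝ)..1, (x : ℂ) ^ (-α - 1) * (fbmCov H x 1 : ℂ) with hJ
  obtain ⟨hmom, hsq⟩ := hz.integral_singularIntegral_mul_conj hT hH1.le hα hz2 hcov hJ
  set A : Ω → ℂ := fun w => singularIntegral T α (fun s => z s w) T with hA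
  set η : Ω → ℂ := fun w => revIncrement T (fun s => z s w) T with hη
  have hA2 : MemLp A 2 P := hz.memLp_singularIntegral hT hH1.le hα
  have hη2 : MemLp η 2 P := (hz2 (T - T) (by simpa using hT.le)).sub (hz2 T hTm)
  have hηη := integral_revIncrement_mul_conj hz2 hcov hTm hTm hH
  have hAη := hmom T ⟨hT, le_rfl⟩
  have hT0 : (T : ℂ) ≠ 0 := by exact_mod_cast hT.ne'
  set c : ℂ := (T : ℂ) ^ (-α) with hc
  have hcn : Complex.normSq c = T ^ (-2 * α.re) := by
    rw [Complex.normSq_eq_norm_sq, hc, Complex.norm_cpow_eq_rpow_re_of_pos hT, ← Real.rpow_natCast,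
      ← Real.rpow_mul hT.le]
    congr 1; simp; ring
  have hpt : ∀ᵐ w ∂P, ‖pathIntegral T α (fun s => z s w) 0‖ ^ 2 =
      Complex.normSq α * (A w * (starRingEnd ℂ) (A w)).re +
      Complex.normSq c * (η w * (starRingEnd ℂ) (η w)).re +
      2 * (α * (starRingEnd ℂ) c * (A w * (starRingEnd ℂ) (η w))).re := by
    filter_upwards [hz0] with w hw
    have e1 : z T w = -η w := by simp [hη, revIncrement, hw]
    rw [pathIntegral_zero hα0, e1]
    have e2 : -α * singularIntegral T α (fun s => z s w) T + c * -η w = -(α * A w + c * η w) := by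
      simp only [hA]; ring
    rw [e2, norm_neg, ← Complex.normSq_eq_norm_sq, Complex.normSq_add, Complex.normSq_mul,
      Complex.normSq_mul, Complex.mul_conj, Complex.mul_conj, Complex.ofReal_re, Complex.ofReal_re,
      map_mul]
    congr 3
    ring
  have iAA : Integrable (fun w => A w * (starRingEnd ℂ) (A w)) P := hA2.integrable_mul hA2.star
  have iηη : Integrable (fun w => η w * (starRingEnd ℂ) (η w)) P := hη2.integrable_mul hη2.star
  have iAη : Integrable (fun w => A w * (starRingEnd ℂ) (η w)) P := hA2.integrable_mul hη2.star
  have i1 : Integrable (fun w => Complex.normSq α * (A w * (starRingEnd ℂ) (A w)).re) P :=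
    iAA.re.const_mul _
  have i2 : Integrable (fun w => Complex.normSq c * (η w * (starRingEnd ℂ) (η w)).re) P :=
    iηη.re.const_mul _
  have i3 : Integrable (fun w =>
      2 * (α * (starRingEnd ℂ) c * (A w * (starRingEnd ℂ) (η w))).re) P :=
    (iAη.const_mul (α * (starRingEnd ℂ) c)).re.const_mul 2
  have i12 : Integrable (fun w => Complex.normSq α * (A w * (starRingEnd ℂ) (A w)).re +
      Complex.normSq c * (η w * (starRingEnd ℂ) (η w)).re) P := i1.add i2
  have hre : ∀ {f : Ω → ℂ}, Integrable f P → ∫ w, (f w).re ∂P = (∫ w, f w ∂P).re :=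
    fun hf => integral_re hf
  rw [integral_congr_ae hpt, integral_add i12 i3, integral_add i1 i2, integral_const_mul,
    integral_const_mul, integral_const_mul, hre iAA, hre iηη, hre (iAη.const_mul _),
    integral_const_mul, hsq, hηη, hAη]
  have hcT : (starRingEnd ℂ) c * (T : ℂ) ^ (2 * (H : ℂ) - α) = ((T ^ (2 * (H - α.re)) : ℝ) : ℂ) := by
    rw [hc, conj_ofReal_cpow hT, map_neg, ← Complex.cpow_add _ _ hT0, Complex.ofReal_cpow hT.le]
    congr 1
    have := Complex.add_conj α
    push_cast at this ⊢
    linear_combination -this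
  have hfin : α * (starRingEnd ℂ) c * ((T : ℂ) ^ (2 * (H : ℂ) - α) * J) =
      ((T ^ (2 * (H - α.re)) : ℝ) : ℂ) * (α * J) := by
    rw [← hcT]; ring
  rw [hfin, Complex.re_ofReal_mul, Complex.ofReal_re, Complex.ofReal_re, hcn]
  have hcovT : fbmCov H T T = T ^ (2 * H) := by
    simp only [fbmCov, sub_self, abs_zero]
    rw [Real.zero_rpow (by linarith), abs_of_pos hT]; ring
  have hTT : T ^ (-2 * α.re) * T ^ (2 * H) = T ^ (2 * (H - α.re)) := by
    rw [← Real.rpow_add hT]; congr 1; ring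
  rw [hcovT, hTT]
  -- what remains is an identity for the real parts of `J` and `α * J`
  set Q : ℂ := Complex.Gamma (1 - α) / Complex.Gamma (2 * (H : ℂ) - α) with hQ
  have hJval := integral_cpow_mul_fbmCov_one ⟨hH, hH1⟩ hα
  rw [← hJ, ← hQ] at hJval
  have hne : 2 * (H : ℂ) - α ≠ 0 := by
    intro h
    have := congrArg Complex.re h
    simp at this
    linarith [hα.1, hα.2]
  rw [eq_div_iff hne] at hJval
  have hJre := congrArg Complex.re hJval
  simp only [Complex.mul_re, Complex.sub_re, Complex.add_re, Complex.mul_im, Complex.sub_im,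
    Complex.re_ofNat, Complex.im_ofNat, Complex.ofReal_re, Complex.ofReal_im] at hJre
  have hd : H - α.re ≠ 0 := by linarith [hα.2]
  simp only [Complex.mul_re, Complex.normSq_apply]
  field_simp
  linear_combination hJre

end Moments

/-! ### Almost sure properties of the bridge -/

/-- Two processes with continuous paths on `[0, T)` that agree almost surely at each time agree
almost surely at all times. -/
lemma ae_forall_eq_of_continuousOn {Ω : Type*} [MeasurableSpace Ω] {P : Measure Ω} {T : ℝ}
    {X Y : ℝ → Ω → ℂ} (h : ∀ t ∈ Ico (0 : ℝ) T, X t =ᵐ[P] Y t)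
    (hX : ∀ᵐ w ∂P, ContinuousOn (fun t => X t w) (Ico (0 : ℝ) T))
    (hY : ∀ᵐ w ∂P, ContinuousOn (fun t => Y t w) (Ico (0 : ℝ) T)) :
    ∀ᵐ w ∂P, ∀ t ∈ Ico (0 : ℝ) T, X t w = Y t w := by
  obtain ⟨S, hSc, hSd⟩ := TopologicalSpace.exists_countable_dense (Ico (0 : ℝ) T)
  have hS : ∀ᵐ w ∂P, ∀ t ∈ S, X t w = Y t w :=
    (ae_ball_iff hSc).2 fun t _ => h t t.2
  filter_upwards [hS, hX, hY] with w hw hXw hYw t ht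
  have := Continuous.ext_on hSd (continuousOn_iff_continuous_domRestrict.1 hXw)
    (continuousOn_iff_continuous_domRestrict.1 hYw) (fun t ht => hw t ht)
  exact congrFun this ⟨t, ht⟩

/-- A path that coincides with the pathwise integral before `T` yields a bridge path that coincides
with `(T - t) ^ α` times the pathwise integral on all of `[0, T]`. -/
lemma bridgeProcess_eq {Ω : Type*} {T : ℝ} {α : ℂ} {ω z : ℝ → Ω → ℂ} {w : Ω} (hα : 0 < α.re)
    (hω : ∀ t ∈ Ico (0 : ℝ) T, ω t w = pathIntegral T α (fun s => z s w) (T - t)) {t : ℝ}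
    (ht : t ∈ Icc (0 : ℝ) T) : bridgeProcess T α ω t w =
      ((T - t : ℝ) : ℂ) ^ α * pathIntegral T α (fun s => z s w) (T - t) := by
  have hα0 : α ≠ 0 := by rintro rfl; simp at hα
  unfold bridgeProcess
  split_ifs with h
  · rw [hω t ⟨ht.1, h⟩]
  · have : t = T := le_antisymm ht.2 (not_lt.1 h)
    rw [this, sub_self, Complex.ofReal_zero, Complex.zero_cpow hα0, zero_mul]

section Bridge

variable {Ω : Type*} [MeasurableSpace Ω] {P : Measure Ω} {H T : ℝ} {α : ℂ}
  {ζ z ω : ℝ → Ω → ℂ}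

lemma IsHolderVersion.continuousOn_pathIntegral (hz : IsHolderVersion P H T ζ z) (hT : 0 < T)
    (hH1 : H ≤ 1) (hα : α.re ∈ Ioo 0 H) (w : Ω) :
    ContinuousOn (fun t => pathIntegral T α (fun s => z s w) (T - t)) (Icc (0 : ℝ) T) := by
  obtain ⟨M, -, hM0, hM⟩ := hz.holder ((α.re + H) / 2)
    ⟨by linarith [hα.1, hα.2], by linarith [hα.2]⟩
  exact (_root_.continuousOn_pathIntegral hT (hz.continuous w) (hM w) (hM0 w) hα.1
    (by linarith [hα.2]) (by linarith [hα.2])).comp (by fun_prop)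
    fun t ht => ⟨by linarith [ht.2], by linarith [ht.1]⟩

lemma IsHolderVersion.continuousOn_bridgeProcess (hz : IsHolderVersion P H T ζ z) (hT : 0 < T)
    (hH1 : H ≤ 1) (hα : α.re ∈ Ioo 0 H) {w : Ω}
    (hω : ∀ t ∈ Ico (0 : ℝ) T, ω t w = pathIntegral T α (fun s => z s w) (T - t)) :
    ContinuousOn (fun t => bridgeProcess T α ω t w) (Icc (0 : ℝ) T) := by
  have h1 : Continuous fun t : ℝ => ((T - t : ℝ) : ℂ) ^ α :=
    (Complex.continuous_ofReal_cpow_const hα.1).comp (by fun_prop)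
  exact (h1.continuousOn.mul (hz.continuousOn_pathIntegral hT hH1 hα w)).congr
    fun t ht => bridgeProcess_eq hα.1 hω ht

/-- Pathwise form of the bridge equation. -/
lemma IsHolderVersion.bridgeProcess_equation (hz : IsHolderVersion P H T ζ z) (hT : 0 < T)
    (hH1 : H ≤ 1) (hα : α.re ∈ Ioo 0 H) {w : Ω} (hζ : ∀ t ∈ Icc (0 : ℝ) T, z t w = ζ t w)
    (hω : ∀ t ∈ Ico (0 : ℝ) T, ω t w = pathIntegral T α (fun s => z s w) (T - t)) {t : ℝ}
    (ht : t ∈ Ico (0 : ℝ) T) : bridgeProcess T α ω t w =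
      -α * (∫ u in (0 : ℝ)..t, bridgeProcess T α ω u w / ((T - u : ℝ) : ℂ)) + ζ t w := by
  obtain ⟨M, -, hM0, hM⟩ := hz.holder ((α.re + H) / 2)
    ⟨by linarith [hα.1, hα.2], by linarith [hα.2]⟩
  have h := cpow_mul_pathIntegral_eq hT (hz.continuous w) (hM w) (hM0 w) hα.1
    (by linarith [hα.2]) (by linarith [hα.2]) ht
  rw [bridgeProcess_eq hα.1 hω (Ico_subset_Icc_self ht), h, hζ t (Ico_subset_Icc_self ht)]
  congr 2
  refine intervalIntegral.integral_congr fun u hu => ?_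
  rw [uIcc_of_le ht.1] at hu
  simp only [bridgeProcess_eq hα.1 hω ⟨hu.1, hu.2.trans ht.2.le⟩]

/-- Every version of the process of Wiener integrals that agrees with the pathwise integrals gives
a fractional bridge. -/
lemma IsHolderVersion.isComplexFractionalBridge (hz : IsHolderVersion P H T ζ z) (hT : 0 < T)
    (hH1 : H ≤ 1) (hα : α.re ∈ Ioo 0 H) (hζ0 : ζ 0 =ᵐ[P] 0)
    (hm : ∀ t ∈ Ico (0 : ℝ) T, AEMeasurable (ω t) P)
    (hω : ∀ᵐ w ∂P, ∀ t ∈ Ico (0 : ℝ) T, ω t w = pathIntegral T α (fun s => z s w) (T - t)) :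
    IsComplexFractionalBridge P T α ζ (bridgeProcess T α ω) := by
  have heq : ∀ᵐ w ∂P, ∀ t ∈ Ico (0 : ℝ) T, bridgeProcess T α ω t w =
      -α * (∫ u in (0 : ℝ)..t, bridgeProcess T α ω u w / ((T - u : ℝ) : ℂ)) + ζ t w := by
    filter_upwards [hω, hz.ae_eq] with w hw hζ t ht
    exact hz.bridgeProcess_equation hT hH1 hα hζ hw ht
  have hcont : ∀ᵐ w ∂P, ContinuousOn (fun t => bridgeProcess T α ω t w) (Icc (0 : ℝ) T) :=
    hω.mono fun w hw => hz.continuousOn_bridgeProcess hT hH1 hα hw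
  refine ⟨⟨fun t ht => ?_, hcont.mono fun w hw => hw.mono Ico_subset_Icc_self, ?_, heq⟩, hcont,
    Eventually.of_forall fun w => by simp [bridgeProcess]⟩
  · have : bridgeProcess T α ω t = fun w => ((T - t : ℝ) : ℂ) ^ α * ω t w := by
      funext w
      rw [bridgeProcess, if_pos ht.2]
    rw [this]
    exact (hm t ht).const_mul _
  · filter_upwards [heq, hζ0] with w hw h0
    rw [hw 0 ⟨le_rfl, hT⟩, h0]
    simp

/-- Two solutions of the bridge equation driven by the same path coincide. -/
lemma IsBridgeSolution.ae_eq {Z Z' : ℝ → Ω → ℂ} (hZ : IsBridgeSolution P T α ζ Z)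
    (hZ' : IsBridgeSolution P T α ζ Z') : ∀ᵐ w ∂P, ∀ t ∈ Ico (0 : ℝ) T, Z t w = Z' t w := by
  filter_upwards [hZ.continuous_paths, hZ'.continuous_paths, hZ.equation, hZ'.equation] with
    w hc hc' he he' t ht
  have hint : ∀ {f : ℝ → ℂ}, ContinuousOn f (Ico (0 : ℝ) T) → ∀ t ∈ Ico (0 : ℝ) T,
      IntervalIntegrable (fun u => f u / ((T - u : ℝ) : ℂ)) volume 0 t := by
    intro f hf t ht
    refine ContinuousOn.intervalIntegrable ?_
    rw [uIcc_of_le ht.1]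
    have hsub : Icc 0 t ⊆ Ico 0 T := fun u hu => ⟨hu.1, hu.2.trans_lt ht.2⟩
    refine (hf.mono hsub).div (by fun_prop) fun u hu => ?_
    exact_mod_cast (sub_pos.2 (hsub hu).2).ne'
  refine sub_eq_zero.1 (eq_zero_of_bridge_equation (T := T) (α := α)
    (D := fun t => Z t w - Z' t w) (hc.sub hc') (fun s hs => ?_) ht)
  simp only [sub_div]
  rw [intervalIntegral.integral_sub (hint hc s hs) (hint hc' s hs)]
  linear_combination he s hs - he' s hs

end Bridge

theorem theorem1p1 {Ω : Type*} [MeasurableSpace Ω] (P : Measure Ω) [IsProbabilityMeasure P]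
    (H T : ℝ) (hH : H ∈ Ioo (0 : ℝ) 1) (hT : 0 < T)
    (α : ℂ) (hα : α.re ∈ Ioo (0 : ℝ) H)
    (B₁ B₂ : ℝ → Ω → ℝ) (hB : IsPlanarFractionalBrownianMotion P H T B₁ B₂) :
    -- the process of Wiener integrals exists
    (∃ ω : ℝ → Ω → ℂ, IsOmegaProcess P T α (complexFBM B₁ B₂) ω) ∧
    -- and every version of it has the following properties
    ∀ ω : ℝ → Ω → ℂ, IsOmegaProcess P T α (complexFBM B₁ B₂) ω →
      ∃ ωT : Ω → ℂ,
        -- convergence in mean square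
        MemLp ωT 2 P ∧
        Tendsto (fun t => eLpNorm (fun w => ω t w - ωT w) 2 P) (𝓝[<] T) (𝓝 0) ∧
        -- second moment of the limit
        ∫ w, ‖ωT w‖ ^ 2 ∂P =
          Real.Gamma (1 + 2 * H) / (2 * (H - α.re)) *
            (Complex.Gamma (1 - α) / Complex.Gamma (2 * (H : ℂ) - α)).re *
            T ^ (2 * (H - α.re)) ∧
        -- the process on the closed interval is Gaussian and has a Hölder modification
        IsGaussianProcess (fun t : Icc (0 : ℝ) T => Function.update ω T ωT t) P ∧
        (∃ ω' : ℝ → Ω → ℂ,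
          (∀ t ∈ Icc (0 : ℝ) T, Measurable (ω' t)) ∧
          (∀ t ∈ Icc (0 : ℝ) T, ω' t =ᵐ[P] Function.update ω T ωT t) ∧
          ∀ w, ∀ ε ∈ Ioo (0 : ℝ) (H - α.re), ∃ C : NNReal,
            HolderOnWith C (H - α.re - ε).toNNReal (fun t => ω' t w) (Icc (0 : ℝ) T)) ∧
        -- for every version with continuous paths on `[0, T)`: almost sure convergence, and
        -- existence and uniqueness of the bridge on `[0, T]`
        ∀ ω' : ℝ → Ω → ℂ, (∀ t ∈ Ico (0 : ℝ) T, ω' t =ᵐ[P] ω t) →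
          (∀ᵐ w ∂P, ContinuousOn (fun t => ω' t w) (Ico (0 : ℝ) T)) →
          (∀ᵐ w ∂P, Tendsto (fun t => ω' t w) (𝓝[<] T) (𝓝 (ωT w))) ∧
          IsComplexFractionalBridge P T α (complexFBM B₁ B₂) (bridgeProcess T α ω') ∧
          ∀ Z : ℝ → Ω → ℂ, IsBridgeSolution P T α (complexFBM B₁ B₂) Z →
            ∀ᵐ w ∂P, (∀ t ∈ Ico (0 : ℝ) T, Z t w = bridgeProcess T α ω' t w) ∧
              Tendsto (fun t => Z t w) (𝓝[<] T) (𝓝 0) := by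
  have hH0 : 0 < H := hH.1
  have hH1 : H ≤ 1 := hH.2.le
  have hL2 : ∀ t ∈ Icc (0 : ℝ) T, MemLp (complexFBM B₁ B₂ t) 2 P := fun t ht => hB.memLp ht
  have hcov : ∀ s ∈ Icc (0 : ℝ) T, ∀ t ∈ Icc (0 : ℝ) T, ∫ w, complexFBM B₁ B₂ s w *
      (starRingEnd ℂ) (complexFBM B₁ B₂ t w) ∂P = fbmCov H s t := fun s hs t ht =>
    hB.integral_mul_conj hs ht
  obtain ⟨z, hz⟩ := hB.exists_isHolderVersion hH0 hT
  -- the continuous version, defined at `t = T` as well, with which all others are compared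
  set W : ℝ → Ω → ℂ := fun t w => pathIntegral T α (fun s => z s w) (T - t) with hW
  have hWω : IsOmegaProcess P T α (complexFBM B₁ B₂) W := fun t ht =>
    hz.isWienerIntegral hL2 hT hH1 hα ht
  refine ⟨⟨W, hWω⟩, fun ω hω => ?_⟩
  have hTm : T ∈ Icc (0 : ℝ) T := ⟨hT.le, le_rfl⟩
  have h0m : (0 : ℝ) ∈ Icc (0 : ℝ) T := ⟨le_rfl, hT.le⟩
  have hae : ∀ t ∈ Ico (0 : ℝ) T, ω t =ᵐ[P] W t := fun t ht =>
    (hω t ht).ae_eq hH0 hT hL2 hcov (hWω t ht)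
  have hWT : W T = fun w => pathIntegral T α (fun s => z s w) 0 := by
    simp only [hW, sub_self]
  have haeT : ∀ t ∈ Icc (0 : ℝ) T, W t =ᵐ[P] Function.update ω T (W T) t := by
    intro t ht
    rcases ht.2.eq_or_lt with rfl | h
    · rw [Function.update_self]
    · rw [Function.update_of_ne h.ne]
      exact (hae t ⟨ht.1, h⟩).symm
  have hIco : ∀ᶠ t in 𝓝[<] T, t ∈ Ico (0 : ℝ) T := Ico_mem_nhdsLT hT
  have hrev : ∀ t ∈ Icc (0 : ℝ) T, T - t ∈ Icc (0 : ℝ) T := fun t ht =>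
    ⟨by linarith [ht.2], by linarith [ht.1]⟩
  have hz2 : ∀ t ∈ Icc (0 : ℝ) T, MemLp (z t) 2 P := fun t ht => hz.memLp hL2 ht
  have hzae : ∀ t ∈ Icc (0 : ℝ) T, z t =ᵐ[P] complexFBM B₁ B₂ t := fun t ht =>
    hz.ae_eq.mono fun w hw => hw t ht
  have hzcov : ∀ s ∈ Icc (0 : ℝ) T, ∀ t ∈ Icc (0 : ℝ) T,
      ∫ w, z s w * (starRingEnd ℂ) (z t w) ∂P = fbmCov H s t := by
    intro s hs t ht
    rw [← hcov s hs t ht]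
    refine integral_congr_ae ?_
    filter_upwards [hzae s hs, hzae t ht] with w h1 h2
    rw [h1, h2]
  have hζ0 : complexFBM B₁ B₂ 0 =ᵐ[P] 0 := by
    refine ae_eq_zero_of_integral_mul_conj_eq_zero (hL2 0 h0m) ?_
    rw [hcov 0 h0m 0 h0m]
    simp [fbmCov, Real.zero_rpow (by linarith : 2 * H ≠ 0)]
  refine ⟨W T, hz.memLp_pathIntegral hL2 hT hH1 hα (hrev T hTm), ?_, ?_, ?_, ?_, ?_⟩
  · have hδ : 0 < (H - α.re) / 2 := by linarith [hα.2]
    obtain ⟨M, hM2, hM⟩ := hz.exists_norm_pathIntegral_sub_le (α := α) hT hH1 hα.1 hδ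
      (by linarith)
    refine tendsto_eLpNorm_zero_of_le_mul (ε := fun t => |T - t| ^ ((H - α.re) / 2)) hM2 ?_ ?_
    · filter_upwards [hIco] with t ht
      filter_upwards [hae t ht] with w hw
      rw [hw, mul_comm]
      have h3 := hM w _ (hrev t (Ico_subset_Icc_self ht)) _ (hrev T hTm)
      rwa [show T - t - (T - T) = T - t by ring] at h3
    · have h1 : Continuous fun t : ℝ => |T - t| ^ ((H - α.re) / 2) :=
        (by fun_prop : Continuous fun t : ℝ => |T - t|).rpow_const fun _ => Or.inr hδ.le
      have h2 := h1.tendsto T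
      rw [sub_self, abs_zero, Real.zero_rpow hδ.ne'] at h2
      exact h2.mono_left nhdsWithin_le_nhds
  · rw [hWT]
    refine hz.integral_norm_sq_pathIntegral_zero hT hH.2 hα hz2 hzcov ?_
    filter_upwards [hzae 0 h0m, hζ0] with w h1 h2
    rw [h1, h2, Pi.zero_apply]
  · exact (hB.isGaussianProcess_pathIntegral hz hT hH1 hα).congr fun t => haeT t t.2
  · refine ⟨W, fun t _ => measurable_pathIntegral hz.measurable hz.continuous T α _, haeT,
      fun w ε hε => ?_⟩
    have hδ : 0 < H - α.re - ε := by linarith [hε.2]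
    obtain ⟨M, -, hM⟩ := hz.exists_norm_pathIntegral_sub_le (α := α) hT hH1 hα.1 hδ
      (by linarith [hε.1])
    refine ⟨(M w).toNNReal, fun s hs t ht => ?_⟩
    have h1 := hM w _ (hrev s hs) _ (hrev t ht)
    rw [Real.coe_toNNReal _ hδ.le, edist_dist, edist_dist, dist_eq_norm, Real.dist_eq,
      ENNReal.ofReal_rpow_of_nonneg (abs_nonneg _) hδ.le]
    refine (ENNReal.ofReal_le_ofReal h1).trans ?_
    rw [ENNReal.ofReal_mul' (by positivity), show T - s - (T - t) = -(s - t) by ring, abs_neg]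
    exact le_rfl
  · intro ω' hω' hcont
    have hWcont : ∀ w, ContinuousOn (fun t => W t w) (Icc (0 : ℝ) T) := fun w =>
      hz.continuousOn_pathIntegral hT hH1 hα w
    have hind : ∀ᵐ w ∂P, ∀ t ∈ Ico (0 : ℝ) T, ω' t w = W t w :=
      ae_forall_eq_of_continuousOn (fun t ht => (hω' t ht).trans (hae t ht)) hcont
        (Eventually.of_forall fun w => (hWcont w).mono Ico_subset_Icc_self)
    have hleft : 𝓝[<] T ≤ 𝓝[Icc (0 : ℝ) T] T := by
      rw [nhdsWithin_le_iff]
      exact mem_of_superset (Ico_mem_nhdsLT hT) Ico_subset_Icc_self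
    have hbridge : IsComplexFractionalBridge P T α (complexFBM B₁ B₂) (bridgeProcess T α ω') :=
      hz.isComplexFractionalBridge hT hH1 hα hζ0
        (fun t ht => (hω t ht).1.1.aemeasurable.congr (hω' t ht).symm) hind
    refine ⟨?_, hbridge, fun Z hZ => ?_⟩
    · filter_upwards [hind] with w hw
      have h1 : Tendsto (fun t => W t w) (𝓝[<] T) (𝓝 (W T w)) := (hWcont w T hTm).mono_left hleft
      refine h1.congr' ?_
      filter_upwards [hIco] with t ht
      exact (hw t ht).symm
    · filter_upwards [hZ.ae_eq hbridge.solution, hbridge.continuous_closed, hbridge.terminal] with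
        w heq hc hT0
      refine ⟨heq, ?_⟩
      have h1 : Tendsto (fun t => bridgeProcess T α ω' t w) (𝓝[<] T)
          (𝓝 (bridgeProcess T α ω' T w)) := (hc T hTm).mono_left hleft
      rw [hT0] at h1
      refine h1.congr' ?_
      filter_upwards [hIco] with t ht
      exact (heq t ht).symm
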